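/- Let $x=(x_1,\dots,x_n)$ with $n\ge 1$. For a polynomial map $H=(H_1,\dots,H_n)\in\mathbb C[x]^n$, the map $x+H$ is called a quasi-translation if $x-H$ is the inverse of $x+H$; it is called homogeneous if all $H_i$ are homogeneous of one common degree. Let $\mathcal JH$ be the Jacobian matrix of $H$ (its rank is taken over $\mathbb C(x)$), $V(H)\subseteq\mathbb C^n$ the set of common zeroes of $H_1,\dots,H_n$, and $W$ the Zariski closure of the image of $H$. A GN-plane of $H$ is a two-dimensional linear subspace of $\mathbb C^n$ contained in $V(H)$. An apex of a set $S\subseteq\mathbb C^n$ is an $a\in\mathbb C^n$ such that $(1-\lambda)c+\lambda a\in S$ for all $\lambda\in\mathbb C$, $c\in S$; a projective apex of $S$ is a $p\neq0$ such that $c+\lambda p\in S$ for all $\lambda\in\mathbb C$, $c\in S$. **A.** Let $x+H$ be a homogeneous quasi-translation in dimension $n\ge1$ with $\operatorname{rk}\mathcal JH\le (n+1)/2$. Consider the properties 1. $\dim V(H)=\operatorname{rk}\mathcal JH\le 3$ and $W$ has no nonzero apex; 2. $\dim V(H)=\operatorname{rk}\mathcal JH$, $W$ is not itself a two-dimensional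 linear subspace, and there is no nonzero $p\in W$ which is contained in infinitely many GN-planes of $H$ that are contained in $W$; 3. there exists a $p\in W$ which is contained in only finitely many GN-planes of $H$, but there is no nonzero $c\in V(H)$ which shares a GN-plane of $H$ with every $q\in W$ (that is, such that for every $q\in W$ some GN-plane of $H$ contains both $c$ and $q$); 4. $\operatorname{rk}\mathcal JH\le1$, or $W$ is properly contained in the linear span of two distinct GN-planes of $H$ which are contained in $W$; 5. $W$ is properly contained in a four-dimensional linear subspace of $\mathbb C^n$, and $\operatorname{rk}\mathcal JH\le3$. Then (1)$\Rightarrow$(2)$\Rightarrow$(3)$\Rightarrow$(4), and (4)$\Rightarrow$(5) if $n\ge4$. Moreover (1)$\Rightarrow$(5) for every $n\ge1$. **B.** Let $x+H$ be a homogeneous quasi-translation in dimension $n=5$ without linear invariants, i.e. there is no nonzero linear form $l$ with $l(x+H)=l(x)$. Then $W$ has a projective apex, and $x+H$ falls under case b): $\operatorname{rk}\mathcal JH=3$ and there is a $T\in\operatorname{GL}_5(\mathbb C)$ such that, for $\tilde H:=T^{-1}H(Tx)$, $x+\tilde H$ is a homogeneous quasi-translation with $\operatorname{rk}\mathcal J\tilde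 H=3$, $\tilde H_5$ is algebraically independent over $\mathbb C$ of $\tilde H_1,\tilde H_2,\tilde H_3,\tilde H_4$ (that is, transcendental over $\mathbb C(\tilde H_1,\dots,\tilde H_4)$), and the Zariski closure of the image of $\tilde H$ is not a three-dimensional linear subspace of $\mathbb C^5$. -/

import Mathlib

noncomputable section

namespace QuasiTranslation

open MvPolynomial

/-- Polynomial maps `ℂⁿ → ℂⁿ`, given by their components `H₁, …, Hₙ ∈ ℂ[x₁, …, xₙ]`. -/
abbrev PolyMap (n : ℕ) := Fin n → MvPolynomial (Fin n) ℂ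

namespace PolyMap

variable {n : ℕ}

/-- Composition `F ∘ G` of polynomial maps: substitute `xᵢ = Gᵢ` in the components of `F`. -/
def comp (F G : PolyMap n) : PolyMap n := fun i => bind₁ G (F i)

/-- The identity map `x`. -/
def ident (n : ℕ) : PolyMap n := fun i => X i

/-- `H` is homogeneous: all its components are homogeneous of one and the same degree. -/
def IsHomogeneous (H : PolyMap n) : Prop := ∃ d : ℕ, ∀ i, (H i).IsHomogeneous d

/-- `x + H` is a quasi-translation: `x - H` is the inverse of `x + H`. -/
def IsQuasiTranslation (H : PolyMap n) : Prop :=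
  comp (ident n - H) (ident n + H) = ident n ∧ comp (ident n + H) (ident n - H) = ident n

/-- The Jacobian matrix of `H` with respect to `x`. -/
def jacobian (H : PolyMap n) : Matrix (Fin n) (Fin n) (MvPolynomial (Fin n) ℂ) :=
  Matrix.of fun i j => pderiv j (H i)

/-- The rank of the Jacobian matrix, over the field `ℂ(x₁, …, xₙ)`. -/
def rkJ (H : PolyMap n) : ℕ :=
  ((jacobian H).map
    (algebraMap (MvPolynomial (Fin n) ℂ) (FractionRing (MvPolynomial (Fin n) ℂ)))).rank

/-- The map `ℂⁿ → ℂⁿ` defined by `H`. -/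
def toFun (H : PolyMap n) (x : Fin n → ℂ) : Fin n → ℂ := fun i => eval x (H i)

/-- `V(H)`: the set of common zeroes of the components of `H`. -/
def V (H : PolyMap n) : Set (Fin n → ℂ) := {x | ∀ i, eval x (H i) = 0}

/-- The Zariski closure of the image of `H`. -/
def imageClosure (H : PolyMap n) : Set (Fin n → ℂ) :=
  zeroLocus ℂ (vanishingIdeal ℂ (Set.range (toFun H)))

/-- A GN-plane of `H`: a two-dimensional linear subspace of `ℂⁿ` contained in `V(H)`. -/
def IsGNPlane (H : PolyMap n) (L : Submodule ℂ (Fin n → ℂ)) : Prop :=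
  Module.finrank ℂ L = 2 ∧ (L : Set (Fin n → ℂ)) ⊆ V H

/-- `f` is an invariant of `x + H`: `f(x + H) = f(x)`. -/
def IsInvariant (H : PolyMap n) (f : MvPolynomial (Fin n) ℂ) : Prop :=
  bind₁ (ident n + H) f = f

/-- `x + H` has a linear invariant: a nonzero linear form that is an invariant. -/
def HasLinearInvariant (H : PolyMap n) : Prop :=
  ∃ f : MvPolynomial (Fin n) ℂ, f ≠ 0 ∧ f.IsHomogeneous 1 ∧ IsInvariant H f

/-- The linear conjugate `T⁻¹ H(Tx)` of `H`. -/
def linConj (T : GL (Fin n) ℂ) (H : PolyMap n) : PolyMap n := fun i =>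
  ∑ j, C ((T⁻¹ : GL (Fin n) ℂ) i j) * bind₁ (fun k => ∑ l, C (T k l) * X l) (H j)

end PolyMap

/-- Dimension of (the Zariski closure of) a subset of `ℂⁿ`: the Krull dimension of its coordinate
ring. The empty set has dimension `⊥`. -/
def algDim {n : ℕ} (S : Set (Fin n → ℂ)) : WithBot ℕ∞ :=
  ringKrullDim (MvPolynomial (Fin n) ℂ ⧸ vanishingIdeal ℂ S)

/-- `a` is an apex of `S`. -/
def IsApex {n : ℕ} (S : Set (Fin n → ℂ)) (a : Fin n → ℂ) : Prop :=
  ∀ l : ℂ, ∀ c ∈ S, (1 - l) • c + l • a ∈ S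

/-- `p` is a projective apex of `S`. -/
def IsProjectiveApex {n : ℕ} (S : Set (Fin n → ℂ)) (p : Fin n → ℂ) : Prop :=
  p ≠ 0 ∧ ∀ l : ℂ, ∀ c ∈ S, c + l • p ∈ S

/-- `S` is a linear subspace of `ℂⁿ` of dimension `k`. -/
def IsLinearOfDim {n : ℕ} (S : Set (Fin n → ℂ)) (k : ℕ) : Prop :=
  ∃ L : Submodule ℂ (Fin n → ℂ), Module.finrank ℂ L = k ∧ (L : Set (Fin n → ℂ)) = S

open PolyMap

variable {n : ℕ}

/-- `dim V(H) = rk JH ≤ 3` and the image closure `W` has no nonzero apex. -/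
def NoApexCond (H : PolyMap n) : Prop :=
  algDim (V H) = (rkJ H : WithBot ℕ∞) ∧ rkJ H ≤ 3 ∧
    ¬ ∃ a : Fin n → ℂ, a ≠ 0 ∧ IsApex (imageClosure H) a

/-- `dim V(H) = rk JH`, the image closure `W` is not a two-dimensional linear subspace, and no
nonzero `p ∈ W` is contained in infinitely many GN-planes of `H` that are contained in `W`. -/
def FinitePlanesInClosureCond (H : PolyMap n) : Prop :=
  algDim (V H) = (rkJ H : WithBot ℕ∞) ∧ ¬ IsLinearOfDim (imageClosure H) 2 ∧
    ¬ ∃ p ∈ imageClosure H, p ≠ 0 ∧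
      {L : Submodule ℂ (Fin n → ℂ) |
        IsGNPlane H L ∧ p ∈ L ∧ (L : Set (Fin n → ℂ)) ⊆ imageClosure H}.Infinite

/-- Some `p ∈ W` is contained in only finitely many GN-planes of `H`, but no nonzero `c ∈ V(H)`
shares a GN-plane of `H` with every `q ∈ W`. -/
def NoCommonPartnerCond (H : PolyMap n) : Prop :=
  (∃ p ∈ imageClosure H, {L : Submodule ℂ (Fin n → ℂ) | IsGNPlane H L ∧ p ∈ L}.Finite) ∧
    ¬ ∃ c ∈ V H, c ≠ 0 ∧ ∀ q ∈ imageClosure H, ∃ L, IsGNPlane H L ∧ c ∈ L ∧ q ∈ L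

/-- `rk JH ≤ 1` or `W` is properly contained in the linear span of two GN-planes of `H` which are
contained in `W`. -/
def SpanOfTwoPlanesCond (H : PolyMap n) : Prop :=
  rkJ H ≤ 1 ∨ ∃ L₁ L₂ : Submodule ℂ (Fin n → ℂ), L₁ ≠ L₂ ∧ IsGNPlane H L₁ ∧ IsGNPlane H L₂ ∧
    (L₁ : Set (Fin n → ℂ)) ⊆ imageClosure H ∧ (L₂ : Set (Fin n → ℂ)) ⊆ imageClosure H ∧
    imageClosure H ⊂ ((L₁ ⊔ L₂ : Submodule ℂ (Fin n → ℂ)) : Set (Fin n → ℂ))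

/-- `W` is properly contained in a four-dimensional linear subspace of `ℂⁿ` and `rk JH ≤ 3`. -/
def FourDimCond (H : PolyMap n) : Prop :=
  (∃ L : Submodule ℂ (Fin n → ℂ), Module.finrank ℂ L = 4 ∧
    imageClosure H ⊂ (L : Set (Fin n → ℂ))) ∧ rkJ H ≤ 3

/-- Case b) of Gordan and Nöther: a homogeneous quasi-translation in dimension five with Jacobian
rank three that is linearly conjugate to another such quasi-translation `x + H'` for which `H'₅`
is algebraically independent over `ℂ` of `H'₁, …, H'₄` (that is, transcendental over
`ℂ[H'₁, …, H'₄]`), while the Zariski closure of the image of `H'` is not a three-dimensional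
linear subspace. -/
def IsCaseB (H : PolyMap 5) : Prop :=
  (IsHomogeneous H ∧ IsQuasiTranslation H ∧ rkJ H = 3) ∧
  ∃ T : GL (Fin 5) ℂ,
    (IsHomogeneous (linConj T H) ∧ IsQuasiTranslation (linConj T H) ∧ rkJ (linConj T H) = 3) ∧
    Transcendental (Algebra.adjoin ℂ (linConj T H '' {i | i ≠ 4})) (linConj T H 4) ∧
    ¬ IsLinearOfDim (imageClosure (linConj T H)) 3

end QuasiTranslation

end

noncomputable section

namespace QuasiTranslation

open MvPolynomial

/-! ### Krull dimension along integral extensions and chains of primes; ideals of points. -/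

section

section Dimension

variable {A B : Type*} [CommRing A] [CommRing B] [Algebra A B]

/-! Write $r=\operatorname{rk}\mathcal JH$. In positive degree, $H$ is constant on each line
$x+\mathbb C H(x)$, and homogeneity turns this into $H(H(x))=0$. So $W$ is an irreducible cone
inside $V(H)$, of dimension $r$ (`algDim_imageClosure`). Call $c,q$ joined if their span lies in
$V(H)$.

The bound $2r\le n+1$ enters only through `exists_joined_pair`: any two points of $W$ have a common
nonzero partner. For independent $q=H(a)$ and $q'=H(a')$, a component through which $H\times H$
takes values in $\mathbb Cq\times\mathbb Cq'$ gives a closed cone in $\mathbb C^{2n}$ of dimension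
at least $2(n-r)+2>n$. It meets the diagonal in some $(c,c)\ne0$. Then $H(c)\in\mathbb Cq\cap\mathbb
Cq'=0$, and $H$ is invariant at $c$ under translation by multiples of $q$ and of $q'$. Elimination
theory carries the result from the image to $W$.

(1)⇒(2): if $W$ is not stable under translation by $p$, the planes in $W$ through $p$ lie in a
proper closed subset of $W$; as $\dim W\le3$ they are components of it, hence finite in number.
(2)⇒(3): $V(H)$ and $W$ agree near a generic point of $W$, so GN-planes through such a point lie in
$W$.

(3)⇒(4): rank two is impossible, because then the span of $W$ lies in $V(H)$
(`IsHQT.span_subset_V`). If only finitely many GN-planes pass through $p$, one of them contains a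
nonzero partner of every point of $W$ (`exists_isHub`). Generic points lie on finitely many planes,
so infinitely many such hubs exist. For a very general $q$, two hubs contain independent partners of
$q$ in one plane through $q$; hence $q$, and therefore $W$, lies in the sum of these hubs
(`exists_hubs_span`). Dimension counts then yield (4) and (5).

For B, dividing out a common factor makes $V(H)$ of codimension at least two without changing $W$.
Together with the rank-two result this forces $r=3=\dim V(H)$. Without a projective apex, A would
put $W$ in a hyperplane, whose equation is a linear invariant. Moving the apex to the last basis
vector gives case b), since $W$ is then stable under changes of the last coordinate alone. -/

theorem ringKrullDim_le_of_isIntegral [Algebra.IsIntegral A B] :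
    ringKrullDim B ≤ ringKrullDim A :=
  Order.krullDim_le_of_strictMono (PrimeSpectrum.comap (algebraMap A B)) fun I J h =>
    Ideal.IsIntegral.comap_lt_comap (I := I.asIdeal) (J := J.asIdeal) h

theorem ringKrullDim_le_of_isIntegral_of_injective [Algebra.IsIntegral A B] [IsDomain B]
    (h : Function.Injective (algebraMap A B)) : ringKrullDim A ≤ ringKrullDim B := by
  refine iSup_le fun l => ?_
  have hk : RingHom.ker (algebraMap A B) ≤ l.head.asIdeal := by
    rw [(RingHom.injective_iff_ker_eq_bot _).1 h]; exact bot_le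
  obtain ⟨Q, hQ, hQl⟩ := Ideal.exists_ideal_over_prime_of_isIntegral_of_isDomain
    (S := B) l.head.asIdeal hk
  have : Q.LiesOver l.head.asIdeal := ⟨hQl.symm⟩
  obtain ⟨L, hL, -⟩ := Ideal.exists_ltSeries_of_hasGoingUp l Q
  rw [← hL]
  exact Order.LTSeries.length_le_krullDim L

/-- A chain of primes below a prime of the quotient gives a quotient domain of large dimension. -/
theorem exists_prime_le_ringKrullDim_quotient_ge {I m : Ideal A} [m.IsPrime] (hI : I ≤ m) {k : ℕ}
    (hk : (k : ℕ∞) ≤ (m.map (Ideal.Quotient.mk I)).height) :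
    ∃ P : Ideal A, P.IsPrime ∧ I ≤ P ∧ P ≤ m ∧ (k : WithBot ℕ∞) ≤ ringKrullDim (A ⧸ P) := by
  have hm : (m.map (Ideal.Quotient.mk I)).IsPrime := Ideal.isPrime_map_quotientMk_of_isPrime hI
  let m' : PrimeSpectrum (A ⧸ I) := ⟨_, hm⟩
  have hk' : (k : ℕ∞) ≤ Order.height m' := by
    rw [← PrimeSpectrum.height_eq_orderHeight]; exact hk
  obtain ⟨l, hl, hlk⟩ := Order.exists_series_of_le_height m' hk'
  have hcomap : ∀ J : Ideal (A ⧸ I), I ≤ J.comap (Ideal.Quotient.mk I) := fun J x hx => by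
    rw [Ideal.mem_comap, Ideal.Quotient.eq_zero_iff_mem.2 hx]; exact J.zero_mem
  refine ⟨l.head.asIdeal.comap (Ideal.Quotient.mk I), inferInstance, hcomap _, ?_, ?_⟩
  · have h1 : l.head ≤ m' := hl ▸ LTSeries.head_le_last l
    have h2 : m'.asIdeal.comap (Ideal.Quotient.mk I) = m := by
      simp [m', Ideal.comap_map_of_surjective' _ Ideal.Quotient.mk_surjective, hI]
    rw [← h2]
    exact Ideal.comap_mono h1
  · rw [ringKrullDim_quotient]
    let f : LTSeries (PrimeSpectrum.zeroLocus
        (l.head.asIdeal.comap (Ideal.Quotient.mk I) : Set A)) :=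
      { length := l.length
        toFun := fun i => ⟨PrimeSpectrum.comap (Ideal.Quotient.mk I) (l i),
          Ideal.comap_mono (show l.head ≤ l i from LTSeries.head_le l i)⟩
        step := fun i => by
          have h : l i.castSucc < l i.succ := l.step i
          refine lt_of_le_of_ne (Ideal.comap_mono h.le) fun e => h.ne ?_
          exact PrimeSpectrum.comap_injective_of_surjective _ Ideal.Quotient.mk_surjective
            (PrimeSpectrum.ext (by simpa using e)) }
    have := Order.LTSeries.length_le_krullDim f
    rwa [show f.length = k from hlk] at this

/-- The tool behind most dimension comparisons below: a chain above `Q` is prolonged by `P`.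
Natural-number lower bounds avoid any finiteness assumption on the dimension. -/
theorem ringKrullDim_quotient_succ_le {P Q : Ideal A} [P.IsPrime] [Q.IsPrime] (h : P < Q) {k : ℕ}
    (hk : (k : WithBot ℕ∞) ≤ ringKrullDim (A ⧸ Q)) :
    ((k + 1 : ℕ) : WithBot ℕ∞) ≤ ringKrullDim (A ⧸ P) := by
  rw [ringKrullDim_quotient] at hk ⊢
  obtain ⟨l, hl⟩ := Order.le_krullDim_iff.1 hk
  let l' := l.map Subtype.val (fun _ _ h => h)
  have hP : (⟨P, inferInstance⟩ : PrimeSpectrum A) < l'.head :=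
    lt_of_lt_of_le (b := ⟨Q, inferInstance⟩) h l.head.2
  refine Order.le_krullDim_iff.2 ⟨⟨(l'.cons _ hP).length, fun i => ⟨(l'.cons _ hP) i, ?_⟩,
    (l'.cons _ hP).step⟩, ?_⟩
  · have := LTSeries.head_le (l'.cons _ hP) i
    rwa [RelSeries.head_cons] at this
  · show 0 + l.length + 1 = k + 1
    rw [hl, zero_add]
theorem height_add_le_ringKrullDim {P : Ideal A} [P.IsPrime] {h k : ℕ} (hh : (h : ℕ∞) ≤ P.height)
    (hk : (k : WithBot ℕ∞) ≤ ringKrullDim (A ⧸ P)) :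
    ((h + k : ℕ) : WithBot ℕ∞) ≤ ringKrullDim A := by
  rw [ringKrullDim_quotient] at hk
  obtain ⟨l, hl⟩ := Order.le_krullDim_iff.1 hk
  let p : PrimeSpectrum A := ⟨P, inferInstance⟩
  have hh' : (h : ℕ∞) ≤ Order.height p := by
    rw [← PrimeSpectrum.height_eq_orderHeight]; exact hh
  obtain ⟨l₁, hl₁, hl₁k⟩ := Order.exists_series_of_le_height p hh'
  let l' := l.map Subtype.val (fun _ _ h => h)
  have h1 : p ≤ l'.head := l.head.2
  have h2 : (h : ℕ∞) ≤ Order.height l'.head := hh'.trans (Order.height_mono h1)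
  obtain ⟨l₂, hl₂, hl₂k⟩ := Order.exists_series_of_le_height l'.head h2
  refine Order.le_krullDim_iff.2 ⟨l₂.smash l' hl₂, ?_⟩
  exact congrArg₂ (· + ·) hl₂k hl

end Dimension

section PointIdeal

variable {σ : Type*}

/-- The automorphism `p(x) ↦ p(x + a)`. -/
def translate (a : σ → ℂ) : MvPolynomial σ ℂ →ₐ[ℂ] MvPolynomial σ ℂ :=
  aeval fun i => X i + C (a i)

theorem eval_translate (a b : σ → ℂ) (p : MvPolynomial σ ℂ) :
    eval b (translate a p) = eval (b + a) p := by
  induction p using MvPolynomial.induction_on with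
  | C c => simp [translate]
  | add p q hp hq => simp [hp, hq]
  | mul_X p i hp => simp [hp]; simp [translate]

/-- Translation as an automorphism. -/
def translateEquiv (a : σ → ℂ) : MvPolynomial σ ℂ ≃ₐ[ℂ] MvPolynomial σ ℂ :=
  AlgEquiv.ofAlgHom (translate a) (translate (-a)) (by ext i; simp [translate])
    (by ext i; simp [translate])

theorem mem_vanishingIdeal_singleton {a : σ → ℂ} {p : MvPolynomial σ ℂ} :
    p ∈ vanishingIdeal ℂ {a} ↔ eval a p = 0 := by
  simp

variable [Finite σ]

/-- Some maximal ideal has full height and is a point ideal by the Nullstellensatz; a translation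
carries it to the ideal of `a`. -/
theorem height_vanishingIdeal_singleton (a : σ → ℂ) :
    (vanishingIdeal ℂ {a}).height = Nat.card σ := by
  have hdim : ringKrullDim (MvPolynomial σ ℂ) = (Nat.card σ : ℕ∞) := by
    rw [MvPolynomial.ringKrullDim_of_isNoetherianRing, ringKrullDim_eq_zero_of_field, zero_add]
    rfl
  have : FiniteRingKrullDim (MvPolynomial σ ℂ) := by
    refine finiteRingKrullDim_iff_ne_bot_and_top.2 ⟨?_, ?_⟩ <;> rw [hdim]
    · exact WithBot.coe_ne_bot
    · exact fun h => ENat.natCast_ne_top _ (WithBot.coe_injective h)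
  obtain ⟨p, hp, hph⟩ := Ideal.exists_isMaximal_height (R := MvPolynomial σ ℂ)
  obtain ⟨b, rfl⟩ := eq_vanishingIdeal_singleton_of_isMaximal ℂ hp
  rw [hdim] at hph
  have h2 : (vanishingIdeal ℂ {b}).comap (translateEquiv (b - a)).toRingEquiv.symm
      = vanishingIdeal ℂ {a} := by
    ext q
    obtain ⟨q, rfl⟩ := (translateEquiv (b - a)).surjective q
    rw [Ideal.mem_comap]
    simp only [mem_vanishingIdeal_singleton]
    have e1 : (translateEquiv (b - a)).toRingEquiv.symm ((translateEquiv (b - a)) q) = q :=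
      (translateEquiv (b - a)).symm_apply_apply q
    have e2 : eval a (translateEquiv (b - a) q) = eval b q := by
      have := eval_translate (b - a) a q
      rwa [add_sub_cancel] at this
    rw [e1, e2]
  have h3 := RingEquiv.height_comap (translateEquiv (b - a)).toRingEquiv.symm
    (vanishingIdeal ℂ {b})
  rw [h2] at h3
  rw [h3]
  exact WithBot.coe_injective hph

theorem eq_vanishingIdeal_singleton_of_zeroLocus_subset {P : Ideal (MvPolynomial σ ℂ)} [P.IsPrime]
    {a : σ → ℂ} (h : zeroLocus ℂ P ⊆ {a}) : P = vanishingIdeal ℂ {a} := by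
  have h1 : vanishingIdeal ℂ {a} ≤ P := by
    conv_rhs => rw [← IsPrime.vanishingIdeal_zeroLocus (K := ℂ) P]
    exact vanishingIdeal_anti_mono h
  have hm : (vanishingIdeal ℂ {a} : Ideal (MvPolynomial σ ℂ)).IsMaximal := inferInstance
  exact (hm.eq_of_le Ideal.IsPrime.ne_top' h1).symm

end PointIdeal

end

/-! ### Elimination for systems of forms, and linear sections of cones. -/

section

section Elimination

attribute [local instance] MvPolynomial.gradedAlgebra

theorem homogeneousComponent_mul_right {σ R : Type*} [CommRing R] (f : MvPolynomial σ R)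
    {g : MvPolynomial σ R} {d : ℕ} (hg : g.IsHomogeneous d) (k : ℕ) :
    homogeneousComponent k (f * g) = if d ≤ k then homogeneousComponent (k - d) f * g else 0 := by
  rw [← decomposition.decompose'_apply, ← decomposition.decompose'_apply]
  exact DirectSum.coe_decompose_mul_of_right_mem (homogeneousSubmodule σ R) k (a := f) hg

variable {σ : Type*} [Finite σ]

theorem pow_idealOfVars_le_of_zeroLocus_subset {I : Ideal (MvPolynomial σ ℂ)}
    (h : zeroLocus ℂ I ⊆ {0}) : ∃ s : ℕ, idealOfVars σ ℂ ^ s ≤ I := by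
  refine Ideal.exists_pow_le_of_le_radical_of_fg ?_ (idealOfVars_fg σ ℂ)
  rw [← vanishingIdeal_zeroLocus_eq_radical (K := ℂ)]
  refine le_trans ?_ (vanishingIdeal_anti_mono h)
  rw [idealOfVars, Ideal.span_le]
  rintro _ ⟨i, rfl⟩
  simp

/-- If a system of forms depending on parameters has only the trivial zero at `q₀`, then this
holds for all parameters outside a proper closed set. -/
theorem exists_eval_ne_zero_of_only_trivial_zero {τ ι : Type*} [Fintype ι]
    {F : ι → MvPolynomial σ (MvPolynomial τ ℂ)} {d : ι → ℕ}
    (hF : ∀ i, (F i).IsHomogeneous (d i)) {q₀ : τ → ℂ}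
    (h : ∀ c : σ → ℂ, (∀ i, eval c (map (eval q₀) (F i)) = 0) → c = 0) :
    ∃ g : MvPolynomial τ ℂ, eval q₀ g ≠ 0 ∧ ∀ q, eval q g ≠ 0 →
      ∀ c : σ → ℂ, (∀ i, eval c (map (eval q) (F i)) = 0) → c = 0 := by
  classical
  obtain ⟨s, hs⟩ := pow_idealOfVars_le_of_zeroLocus_subset
    (I := Ideal.span (Set.range fun i => map (eval q₀) (F i))) (by
      rw [zeroLocus_span]
      intro c hc
      refine h c fun i => ?_
      simpa [aeval_eq_eval] using hc _ ⟨i, rfl⟩)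
  let I : Ideal (MvPolynomial σ (MvPolynomial τ ℂ)) := Ideal.span (Set.range F)
  let m : Ideal (MvPolynomial τ ℂ) := RingHom.ker (eval q₀)
  -- At `q₀` every form of degree `s` is a combination of the specialised system; lifting this
  -- leaves an error with coefficients in `m`, which is the input for Nakayama.
  have hle : homogeneousSubmodule σ (MvPolynomial τ ℂ) s ≤
      I.restrictScalars (MvPolynomial τ ℂ) ⊔ m • homogeneousSubmodule σ (MvPolynomial τ ℂ) s := by
    intro f hf
    rw [mem_homogeneousSubmodule] at hf
    have h1 : map (eval q₀) f ∈ Ideal.span (Set.range fun i => map (eval q₀) (F i)) := by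
      refine hs ((mem_pow_idealOfVars_iff s _).2 fun x hx => ?_)
      by_contra hlt
      exact (mem_support_iff.1 hx) ((hf.map (eval q₀)).coeff_eq_zero (by omega))
    obtain ⟨a, ha⟩ := (Ideal.mem_span_range_iff_exists_fun).1 h1
    -- Only the part of `a i` of degree `s - d i` matters in degree `s`; it is lifted with
    -- coefficients constant in the parameters.
    let b : ι → MvPolynomial σ (MvPolynomial τ ℂ) := fun i =>
      if d i ≤ s then map C (homogeneousComponent (s - d i) (a i)) else 0
    have hb : (∑ i, b i * F i).IsHomogeneous s := by
      refine IsHomogeneous.sum _ _ _ fun i _ => ?_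
      by_cases hi : d i ≤ s
      · have := ((homogeneousComponent_isHomogeneous (s - d i) (a i)).map
          (C : ℂ →+* MvPolynomial τ ℂ)).mul (hF i)
        simpa [b, hi] using this
      · simp [b, hi, isHomogeneous_zero]
    have he : map (eval q₀) (f - ∑ i, b i * F i) = 0 := by
      rw [map_sub, map_sum, sub_eq_zero]
      have h2 := congrArg (homogeneousComponent s) ha
      rw [homogeneousComponent_eq_self (hf.map _), map_sum] at h2
      rw [← h2]
      refine Finset.sum_congr rfl fun i _ => ?_
      rw [homogeneousComponent_mul_right _ ((hF i).map (eval q₀)), map_mul]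
      by_cases hi : d i ≤ s
      · have : (eval q₀).comp (C : ℂ →+* MvPolynomial τ ℂ) = RingHom.id ℂ := by ext; simp
        simp [b, hi, map_map, this, map_id]
      · simp [b, hi]
    rw [← sub_add_cancel f (∑ i, b i * F i), add_comm]
    refine Submodule.add_mem_sup ?_ ?_
    · exact I.sum_mem fun i _ => I.mul_mem_left _ (Ideal.subset_span ⟨i, rfl⟩)
    · rw [(f - ∑ i, b i * F i).as_sum]
      refine Submodule.sum_mem _ fun x hx => ?_
      rw [← mul_one (coeff x _), ← smul_eq_mul, ← smul_monomial]
      refine Submodule.smul_mem_smul ?_ ?_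
      · have := congrArg (coeff x) he
        rwa [coeff_map, coeff_zero] at this
      · refine isHomogeneous_monomial _ ?_
        by_contra hne
        exact (mem_support_iff.1 hx) ((hf.sub hb).coeff_eq_zero hne)
  -- Nakayama gives `r` with value 1 at `q₀` that multiplies all forms of degree `s` into `I`.
  -- Wherever `r` is nonzero, each `X i ^ s` vanishes at every common zero.
  obtain ⟨r, hr, hrI⟩ := Submodule.exists_sub_one_mem_and_smul_le_of_fg_of_le_sup
    (homogeneousSubmodule_fg (σ := σ) (R := MvPolynomial τ ℂ) s) le_rfl hle
  have hr1 : eval q₀ r = 1 := by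
    have : eval q₀ (r - 1) = 0 := hr
    rwa [map_sub, map_one, sub_eq_zero] at this
  refine ⟨r, by rw [hr1]; exact one_ne_zero, fun q hq c hc => funext fun i => ?_⟩
  have h3 : r • (X i ^ s : MvPolynomial σ (MvPolynomial τ ℂ)) ∈ I :=
    hrI (Submodule.smul_mem_pointwise_smul _ _ _
      (by simpa using isHomogeneous_X_pow (R := MvPolynomial τ ℂ) i s))
  have h4 : I ≤ RingHom.ker ((eval c).comp (map (eval q))) := by
    rw [Ideal.span_le]
    rintro _ ⟨j, rfl⟩
    exact hc j
  have h5 := h4 h3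
  rw [RingHom.mem_ker, RingHom.comp_apply, smul_eq_C_mul] at h5
  simp only [map_mul, map_C, eval_C, map_pow, map_X, eval_X, mul_eq_zero, hq, false_or] at h5
  exact eq_zero_of_pow_eq_zero h5

/-- A homogeneous ideal meeting a linear subspace of codimension `k` only in the origin has
dimension at most `k`. -/
theorem ringKrullDim_le_of_zeroLocus_ker_subset {B : Type*} [CommRing B] [Algebra ℂ B]
    {π : MvPolynomial σ ℂ →ₐ[ℂ] B} (hπ : Function.Surjective π)
    (hP : (RingHom.ker π).IsHomogeneous (homogeneousSubmodule σ ℂ)) {κ : Type*} [Fintype κ]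
    {l : κ → MvPolynomial σ ℂ} (hl : ∀ j, (l j).IsHomogeneous 1)
    (h : ∀ c ∈ zeroLocus ℂ (RingHom.ker π), (∀ j, eval c (l j) = 0) → c = 0) :
    ringKrullDim B ≤ Fintype.card κ := by
  classical
  obtain ⟨s, hs⟩ := pow_idealOfVars_le_of_zeroLocus_subset
    (I := RingHom.ker π ⊔ Ideal.span (Set.range l)) (by
      intro c hc
      refine h c (zeroLocus_anti_mono le_sup_left hc) fun j => ?_
      simpa [aeval_eq_eval] using hc (l j) (Ideal.mem_sup_right (Ideal.subset_span ⟨j, rfl⟩)))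
  let φ : MvPolynomial κ ℂ →ₐ[ℂ] B := aeval fun j => π (l j)
  let : Algebra (MvPolynomial κ ℂ) B := φ.toRingHom.toAlgebra
  have hsmul : ∀ (a : MvPolynomial κ ℂ) (b : B), a • b = φ a * b := fun _ _ => rfl
  let T : Set (σ →₀ ℕ) := {x | x.degree < s}
  have hT : T.Finite := Finsupp.finite_of_degree_lt s
  let N : Submodule (MvPolynomial κ ℂ) B :=
    Submodule.span _ ((fun x => π (monomial x 1)) '' T)
  -- Monomials of degree below `s` generate `B` over the polynomial ring in the `l j`: modulo the
  -- kernel, a form of degree at least `s` is a combination of the `l j` with coefficients of degree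
  -- one less. So `B` is finite over that ring.
  have hmem : ∀ D : ℕ, ∀ f : MvPolynomial σ ℂ, f.IsHomogeneous D → π f ∈ N := by
    intro D
    induction D using Nat.strong_induction_on with
    | _ D ih =>
      intro f hf
      by_cases hD : D < s
      · rw [f.as_sum, map_sum]
        refine N.sum_mem fun x hx => ?_
        have hx' : x ∈ T := by
          show x.degree < s
          by_contra hlt
          exact (mem_support_iff.1 hx) (hf.coeff_eq_zero (by omega))
        have : π (monomial x (coeff x f)) =
            (C (coeff x f) : MvPolynomial κ ℂ) • π (monomial x 1) := by
          rw [hsmul, ← algebraMap_eq, AlgHom.commutes, ← Algebra.smul_def, ← map_smul,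
            smul_monomial, smul_eq_mul, mul_one]
        rw [this]
        exact N.smul_mem _ (Submodule.subset_span ⟨x, hx', rfl⟩)
      · have h1 : f ∈ RingHom.ker π ⊔ Ideal.span (Set.range l) := by
          refine hs ((mem_pow_idealOfVars_iff s _).2 fun x hx => ?_)
          by_contra hlt
          exact (mem_support_iff.1 hx) (hf.coeff_eq_zero (by omega))
        obtain ⟨p, hp, g, hg, rfl⟩ := Submodule.mem_sup.1 h1
        obtain ⟨a, rfl⟩ := (Ideal.mem_span_range_iff_exists_fun).1 hg
        rw [← homogeneousComponent_eq_self hf, map_add, map_add]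
        refine N.add_mem ?_ ?_
        · rw [(RingHom.mem_ker).1 (homogeneousComponent_mem_of_mem hP hp D)]
          exact N.zero_mem
        · rw [map_sum, map_sum]
          refine N.sum_mem fun j _ => ?_
          rw [homogeneousComponent_mul_right _ (hl j)]
          by_cases hD1 : 1 ≤ D
          · rw [if_pos hD1, mul_comm, map_mul]
            have : π (l j) * π (homogeneousComponent (D - 1) (a j)) =
                (X j : MvPolynomial κ ℂ) • π (homogeneousComponent (D - 1) (a j)) := by
              rw [hsmul]; simp [φ]
            rw [this]
            exact N.smul_mem _ (ih _ (by omega) _ (homogeneousComponent_isHomogeneous _ _))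
          · rw [if_neg hD1, map_zero]; exact N.zero_mem
  have htop : N = ⊤ := by
    refine eq_top_iff.2 fun x _ => ?_
    obtain ⟨f, rfl⟩ := hπ x
    rw [← sum_homogeneousComponent f, map_sum]
    exact N.sum_mem fun i _ => hmem i _ (homogeneousComponent_isHomogeneous _ _)
  have hfin : Module.Finite (MvPolynomial κ ℂ) B :=
    ⟨⟨(hT.image _).toFinset, by rw [Set.Finite.coe_toFinset]; exact htop⟩⟩
  refine (ringKrullDim_le_of_isIntegral (A := MvPolynomial κ ℂ)).trans ?_
  rw [MvPolynomial.ringKrullDim_of_isNoetherianRing, ringKrullDim_eq_zero_of_field, zero_add]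
  simp

end Elimination

end

/-! ### Jacobian criterion and Noether normalization with `rkJ H` parameters. -/

section

section JacobianCriterion

variable {σ : Type*}

/-- The gradient, with entries in the field of rational functions. -/
def grad (f : MvPolynomial σ ℂ) : σ → FractionRing (MvPolynomial σ ℂ) :=
  fun j => algebraMap _ _ (pderiv j f)

theorem grad_add (f g : MvPolynomial σ ℂ) : grad (f + g) = grad f + grad g := by
  ext j; simp [grad]

theorem grad_mul (f g : MvPolynomial σ ℂ) :
    grad (f * g) = algebraMap _ (FractionRing (MvPolynomial σ ℂ)) f • grad g +
      algebraMap _ (FractionRing (MvPolynomial σ ℂ)) g • grad f := by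
  ext j; simp [grad, Derivation.leibniz, Algebra.smul_def]

theorem grad_C (c : ℂ) : grad (C c : MvPolynomial σ ℂ) = 0 := by
  ext j; simp [grad]

theorem grad_X [DecidableEq σ] (i : σ) : grad (X i) = Pi.single i 1 := by
  ext j
  by_cases h : i = j
  · subst h; simp [grad]
  · simp [grad, pderiv_X, h, Ne.symm h]

theorem grad_mem_span_of_mem_adjoin {T : Set (MvPolynomial σ ℂ)} {f : MvPolynomial σ ℂ}
    (hf : f ∈ Algebra.adjoin ℂ T) :
    grad f ∈ Submodule.span (FractionRing (MvPolynomial σ ℂ)) (grad '' T) := by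
  induction hf using Algebra.adjoin_induction with
  | mem x hx => exact Submodule.subset_span ⟨x, hx, rfl⟩
  | algebraMap c => rw [algebraMap_eq, grad_C]; exact Submodule.zero_mem _
  | add x y _ _ hx hy => rw [grad_add]; exact Submodule.add_mem _ hx hy
  | mul x y _ _ hx hy =>
    rw [grad_mul]
    exact Submodule.add_mem _ (Submodule.smul_mem _ _ hy) (Submodule.smul_mem _ _ hx)

theorem grad_pow (f : MvPolynomial σ ℂ) (k : ℕ) :
    grad (f ^ k) = algebraMap _ (FractionRing (MvPolynomial σ ℂ)) (k * f ^ (k - 1)) • grad f := by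
  ext j; simp [grad, Derivation.leibniz_pow]; ring

/-- The chain rule, modulo the gradients of the coefficients. -/
theorem grad_aeval_sub_mem {T : Set (MvPolynomial σ ℂ)} (f : MvPolynomial σ ℂ)
    (p : Polynomial (Algebra.adjoin ℂ T)) :
    grad (Polynomial.aeval f p) - algebraMap _ (FractionRing (MvPolynomial σ ℂ))
      (Polynomial.aeval f (Polynomial.derivative p)) • grad f ∈
      Submodule.span (FractionRing (MvPolynomial σ ℂ)) (grad '' T) := by
  induction p using Polynomial.induction_on' with
  | add p q hp hq =>
    have := Submodule.add_mem _ hp hq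
    convert this using 1
    simp only [map_add, grad_add, add_smul]
    abel
  | monomial k a =>
    have h := grad_mem_span_of_mem_adjoin a.2
    have := Submodule.smul_mem _ (algebraMap _ (FractionRing (MvPolynomial σ ℂ)) (f ^ k)) h
    convert this using 1
    rw [Polynomial.derivative_monomial, Polynomial.aeval_monomial, Polynomial.aeval_monomial,
      grad_mul, grad_pow]
    have e : (algebraMap (Algebra.adjoin ℂ T) (MvPolynomial σ ℂ)) a = (a : MvPolynomial σ ℂ) := rfl
    simp only [map_mul, map_natCast, e]
    rw [smul_smul, ← mul_assoc]
    abel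

/-- Differentiating a relation $p(f)=0$ lets one solve for the gradient when $p'(f)\ne0$. Otherwise
$p'$ is a relation of smaller degree, and characteristic zero keeps it nonzero. -/
theorem grad_mem_span_of_isAlgebraic {T : Set (MvPolynomial σ ℂ)} {f : MvPolynomial σ ℂ}
    (hf : IsAlgebraic (Algebra.adjoin ℂ T) f) :
    grad f ∈ Submodule.span (FractionRing (MvPolynomial σ ℂ)) (grad '' T) := by
  obtain ⟨p, hp, hpf⟩ := hf
  induction h : p.natDegree using Nat.strong_induction_on generalizing p with
  | _ k ih =>
    by_cases hd : Polynomial.aeval f (Polynomial.derivative p) = 0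
    · have hpos : p.natDegree ≠ 0 := by
        intro h0
        rw [Polynomial.eq_C_of_natDegree_eq_zero h0] at hpf hp
        rw [Polynomial.aeval_C] at hpf
        exact hp (by rw [(FaithfulSMul.algebraMap_eq_zero_iff _ _).1 hpf, map_zero])
      refine ih _ ?_ (Polynomial.derivative p) ?_ hd rfl
      · rw [← h]; exact Polynomial.natDegree_derivative_lt hpos
      · intro h0
        exact hpos (Polynomial.derivative_eq_zero.1 h0)
    · have h1 := grad_aeval_sub_mem f p
      rw [hpf] at h1
      have h2 : grad (0 : MvPolynomial σ ℂ) = 0 := by rw [← C_0, grad_C]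
      rw [h2, zero_sub, Submodule.neg_mem_iff] at h1
      have hd' : algebraMap _ (FractionRing (MvPolynomial σ ℂ))
          (Polynomial.aeval f (Polynomial.derivative p)) ≠ 0 := by simpa using hd
      have h3 := Submodule.smul_mem _ (algebraMap _ (FractionRing (MvPolynomial σ ℂ))
          (Polynomial.aeval f (Polynomial.derivative p)))⁻¹ h1
      rwa [smul_smul, inv_mul_cancel₀ hd', one_smul] at h3

/-- Complete `z` by variables to a transcendence basis. The variables are algebraic over it, so its
gradients span everything; there are as many of them as variables, hence they are independent. -/
theorem linearIndependent_grad [Fintype σ] {s : ℕ} {z : Fin s → MvPolynomial σ ℂ}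
    (hz : AlgebraicIndependent ℂ z) :
    LinearIndependent (FractionRing (MvPolynomial σ ℂ)) (fun j => grad (z j)) := by
  classical
  have htop : Algebra.adjoin ℂ (Set.range (X : σ → MvPolynomial σ ℂ)) = ⊤ := adjoin_range_X
  have halg : Algebra.IsAlgebraic
      (Algebra.adjoin ℂ (Set.range z ∪ Set.range (X : σ → MvPolynomial σ ℂ)))
      (MvPolynomial σ ℂ) := by
    have : Algebra.adjoin ℂ (Set.range z ∪ Set.range (X : σ → MvPolynomial σ ℂ)) = ⊤ :=
      top_le_iff.1 (htop ▸ Algebra.adjoin_mono Set.subset_union_right)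
    rw [this]
    exact ⟨fun x => isAlgebraic_algebraMap (⟨x, trivial⟩ : (⊤ : Subalgebra ℂ _))⟩
  obtain ⟨T, hzT, hT, hbasis⟩ := exists_isTranscendenceBasis_between (R := ℂ) (Set.range z)
    (Set.range z ∪ Set.range X) Set.subset_union_left hz.to_subtype_range
  have hcard : Cardinal.mk T = Fintype.card σ := by
    have := hbasis.lift_cardinalMk_eq (IsTranscendenceBasis.mvPolynomial σ ℂ)
    simpa using this
  have hfin : Finite T := by
    rw [← Cardinal.mk_lt_aleph0_iff, hcard]; exact Cardinal.natCast_lt_aleph0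
  have := Fintype.ofFinite T
  have hcard' : Fintype.card T = Fintype.card σ := by
    rw [Cardinal.mk_fintype] at hcard; exact_mod_cast hcard
  have halgT : Algebra.IsAlgebraic (Algebra.adjoin ℂ T) (MvPolynomial σ ℂ) := by
    have := hbasis.isAlgebraic
    rwa [Subtype.range_coe] at this
  have hspan : ⊤ ≤ Submodule.span (FractionRing (MvPolynomial σ ℂ))
      (Set.range fun t : T => grad (t : MvPolynomial σ ℂ)) := by
    rw [← (Pi.basisFun (FractionRing (MvPolynomial σ ℂ)) σ).span_eq, Submodule.span_le]
    rintro _ ⟨i, rfl⟩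
    rw [Pi.basisFun_apply, ← grad_X]
    have := grad_mem_span_of_isAlgebraic (T := T) (halgT.isAlgebraic (X i))
    rwa [Set.image_eq_range] at this
  have hli : LinearIndependent (FractionRing (MvPolynomial σ ℂ))
      (fun t : T => grad (t : MvPolynomial σ ℂ)) := by
    refine linearIndependent_of_top_le_span_of_card_eq_finrank hspan ?_
    rw [hcard', Module.finrank_fintype_fun_eq_card]
  exact hli.comp (fun j => (⟨z j, hzT ⟨j, rfl⟩⟩ : T)) fun i j hij =>
    hz.injective (congrArg Subtype.val hij)

end JacobianCriterion

open PolyMap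

/-- Noether normalization of the algebra generated by the components of `H`, with the number of
parameters equal to the rank of the Jacobian matrix. -/
theorem exists_noether_normalization {n : ℕ} (H : PolyMap n) :
    ∃ z : Fin (rkJ H) → MvPolynomial (Fin n) ℂ, AlgebraicIndependent ℂ z ∧
      (∀ j, z j ∈ Algebra.adjoin ℂ (Set.range H)) ∧
      ∀ f ∈ Algebra.adjoin ℂ (Set.range H), IsIntegral (Algebra.adjoin ℂ (Set.range z)) f := by
  have hft : Algebra.FiniteType ℂ (Algebra.adjoin ℂ (Set.range H)) :=
    (Algebra.adjoin ℂ (Set.range H)).fg_iff_finiteType.1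
      ⟨(Set.finite_range H).toFinset, by rw [Set.Finite.coe_toFinset]⟩
  obtain ⟨s, g, hg, hgi⟩ := exists_integral_inj_algHom_of_fg ℂ (Algebra.adjoin ℂ (Set.range H))
  let z : Fin s → MvPolynomial (Fin n) ℂ := fun j => g (X j)
  have hz : AlgebraicIndependent ℂ z := by
    have : (aeval z : MvPolynomial (Fin s) ℂ →ₐ[ℂ] _) =
        (Algebra.adjoin ℂ (Set.range H)).val.comp g := by ext j; simp [z]
    rw [AlgebraicIndependent, this]
    exact Subtype.val_injective.comp hg
  have hzm : ∀ j, z j ∈ Algebra.adjoin ℂ (Set.range H) := fun j => (g (X j)).2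
  have hint : ∀ f ∈ Algebra.adjoin ℂ (Set.range H),
      IsIntegral (Algebra.adjoin ℂ (Set.range z)) f := by
    intro f hf
    obtain ⟨p, hp, hpf⟩ := hgi ⟨f, hf⟩
    let φ : MvPolynomial (Fin s) ℂ →ₐ[ℂ] Algebra.adjoin ℂ (Set.range z) :=
      aeval fun j => ⟨z j, Algebra.subset_adjoin ⟨j, rfl⟩⟩
    refine ⟨p.map φ.toRingHom, hp.map _, ?_⟩
    rw [Polynomial.eval₂_map]
    have e : (algebraMap (Algebra.adjoin ℂ (Set.range z)) (MvPolynomial (Fin n) ℂ)).comp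
        φ.toRingHom = (Algebra.adjoin ℂ (Set.range H)).val.toRingHom.comp g.toRingHom := by
      have : (Algebra.adjoin ℂ (Set.range z)).val.comp φ =
          (Algebra.adjoin ℂ (Set.range H)).val.comp g := by ext j; simp [φ, z]
      exact congrArg AlgHom.toRingHom this
    have h2 := congrArg (Algebra.adjoin ℂ (Set.range H)).val.toRingHom hpf
    rw [Polynomial.hom_eval₂, map_zero] at h2
    rw [e]
    exact h2
  -- The components of `H` and the parameters `z` are algebraic over each other, so their gradients
  -- span the same space.
  have hs : s = rkJ H := by
    have h1 : rkJ H = Module.finrank (FractionRing (MvPolynomial (Fin n) ℂ))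
        (Submodule.span (FractionRing (MvPolynomial (Fin n) ℂ)) (grad '' Set.range H)) := by
      rw [rkJ, Matrix.rank_eq_finrank_span_row, ← Set.range_comp]
      rfl
    have h2 : Submodule.span (FractionRing (MvPolynomial (Fin n) ℂ)) (grad '' Set.range H) =
        Submodule.span (FractionRing (MvPolynomial (Fin n) ℂ)) (Set.range fun j => grad (z j)) := by
      apply le_antisymm <;> rw [Submodule.span_le]
      · rintro _ ⟨f, hf, rfl⟩
        have := grad_mem_span_of_isAlgebraic (hint f (Algebra.subset_adjoin hf)).isAlgebraic
        rwa [← Set.range_comp] at this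
      · rintro _ ⟨j, rfl⟩
        exact grad_mem_span_of_mem_adjoin (hzm j)
    rw [h1, h2, finrank_span_eq_card (linearIndependent_grad hz), Fintype.card_fin]
  subst hs
  exact ⟨z, hz, hzm, hint⟩

end

/-! ### Dimension and height of fibres. -/

section

section Fibres

variable {σ : Type*}

theorem ringKrullDim_mvPolynomial_complex (σ : Type*) [Finite σ] :
    ringKrullDim (MvPolynomial σ ℂ) = (Nat.card σ : ℕ∞) := by
  rw [MvPolynomial.ringKrullDim_of_isNoetherianRing, ringKrullDim_eq_zero_of_field, zero_add]
  rfl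

theorem isIntegral_inclusion {R : Type*} [CommRing R] [Algebra ℂ R] {A₀ A : Subalgebra ℂ R}
    (h : A₀ ≤ A) (hint : ∀ f ∈ A, IsIntegral A₀ f) :
    (Subalgebra.inclusion h).toRingHom.IsIntegral := by
  intro f
  obtain ⟨p, hp, hpf⟩ := hint f f.2
  refine ⟨p, hp, Subtype.val_injective ?_⟩
  have := Polynomial.hom_eval₂ p (Subalgebra.inclusion h).toRingHom A.val.toRingHom f
  change A.val.toRingHom _ = 0
  rw [this]
  exact hpf

theorem ringKrullDim_subalgebra_le {R : Type*} [CommRing R] [Algebra ℂ R] {A₀ A : Subalgebra ℂ R}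
    (h : A₀ ≤ A) (hint : ∀ f ∈ A, IsIntegral A₀ f) : ringKrullDim A ≤ ringKrullDim A₀ := by
  let : Algebra A₀ A := (Subalgebra.inclusion h).toRingHom.toAlgebra
  have : Algebra.IsIntegral A₀ A := ⟨isIntegral_inclusion h hint⟩
  exact ringKrullDim_le_of_isIntegral

theorem le_ringKrullDim_subalgebra {R : Type*} [CommRing R] [IsDomain R] [Algebra ℂ R]
    {A₀ A : Subalgebra ℂ R}
    (h : A₀ ≤ A) (hint : ∀ f ∈ A, IsIntegral A₀ f) : ringKrullDim A₀ ≤ ringKrullDim A := by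
  let : Algebra A₀ A := (Subalgebra.inclusion h).toRingHom.toAlgebra
  have : Algebra.IsIntegral A₀ A := ⟨isIntegral_inclusion h hint⟩
  exact ringKrullDim_le_of_isIntegral_of_injective (Subalgebra.inclusion_injective h)

theorem ringKrullDim_adjoin_range_le {κ R : Type*} [Fintype κ] [CommRing R] [Algebra ℂ R]
    (z : κ → R) : ringKrullDim (Algebra.adjoin ℂ (Set.range z)) ≤ (Fintype.card κ : ℕ∞) := by
  rw [Algebra.adjoin_range_eq_range_aeval]
  refine (ringKrullDim_le_of_surjective (aeval z : MvPolynomial κ ℂ →ₐ[ℂ] R).rangeRestrict.toRingHom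
    (AlgHom.rangeRestrict_surjective _)).trans ?_
  rw [ringKrullDim_mvPolynomial_complex, Nat.card_eq_fintype_card]

variable {ι κ : Type*} [Fintype κ] {G : ι → MvPolynomial σ ℂ} {z : κ → MvPolynomial σ ℂ}

/-- The ideal of the fibre of `G` through `a`. -/
def fibreIdeal (G : ι → MvPolynomial σ ℂ) (a : σ → ℂ) : Ideal (MvPolynomial σ ℂ) :=
  ((vanishingIdeal ℂ {a}).comap (algebraMap (Algebra.adjoin ℂ (Set.range G)) _)).map
    (algebraMap (Algebra.adjoin ℂ (Set.range G)) (MvPolynomial σ ℂ))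

theorem mem_map_comap {A : Subalgebra ℂ (MvPolynomial σ ℂ)} {I : Ideal (MvPolynomial σ ℂ)}
    {f : MvPolynomial σ ℂ} (hf : f ∈ A) (hI : f ∈ I) :
    f ∈ (I.comap (algebraMap A _)).map (algebraMap A (MvPolynomial σ ℂ)) := by
  have h : (⟨f, hf⟩ : A) ∈ I.comap (algebraMap A (MvPolynomial σ ℂ)) := hI
  exact Ideal.mem_map_of_mem (algebraMap A (MvPolynomial σ ℂ)) h

theorem sub_C_mem_fibreIdeal (a : σ → ℂ) (i : ι) :
    G i - C (eval a (G i)) ∈ fibreIdeal G a := by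
  have h1 : G i - C (eval a (G i)) ∈ Algebra.adjoin ℂ (Set.range G) :=
    sub_mem (Algebra.subset_adjoin ⟨i, rfl⟩) (Subalgebra.algebraMap_mem _ _)
  exact mem_map_comap h1 (by rw [mem_vanishingIdeal_singleton]; simp)

theorem fibreIdeal_le (a : σ → ℂ) : fibreIdeal G a ≤ vanishingIdeal ℂ {a} :=
  Ideal.map_comap_le

/-- The algebra of `G` is integral over one with `card κ` generators, so its dimension bounds the
height. -/
theorem height_comap_le (hz : ∀ j, z j ∈ Algebra.adjoin ℂ (Set.range G))
    (hint : ∀ f ∈ Algebra.adjoin ℂ (Set.range G), IsIntegral (Algebra.adjoin ℂ (Set.range z)) f)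
    (a : σ → ℂ) : ((vanishingIdeal ℂ {a}).comap
      (algebraMap (Algebra.adjoin ℂ (Set.range G)) (MvPolynomial σ ℂ))).height ≤
        Fintype.card κ := by
  have h1 := Ideal.height_le_ringKrullDim_of_isPrime (I := (vanishingIdeal ℂ {a}).comap
      (algebraMap (Algebra.adjoin ℂ (Set.range G)) (MvPolynomial σ ℂ)))
  have h2 := ringKrullDim_subalgebra_le
    (Algebra.adjoin_le (by rintro _ ⟨j, rfl⟩; exact hz j)) hint
  exact WithBot.coe_le_coe.1 (h1.trans (h2.trans (ringKrullDim_adjoin_range_le z)))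

theorem isNoetherianRing_adjoin_range {R : Type*} [CommRing R] [Algebra ℂ R] [Finite ι]
    (G : ι → R) : IsNoetherianRing (Algebra.adjoin ℂ (Set.range G)) := by
  have : Algebra.FiniteType ℂ (Algebra.adjoin ℂ (Set.range G)) :=
    (Algebra.adjoin ℂ (Set.range G)).fg_iff_finiteType.1
      ⟨(Set.finite_range G).toFinset, by rw [Set.Finite.coe_toFinset]⟩
  exact Algebra.FiniteType.isNoetherianRing ℂ _

variable [Finite σ] [Finite ι]

/-- Some component of a fibre through `a` is cut out by a prime of height at most the dimension of
the target. -/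
theorem exists_prime_fibre_height_le (hz : ∀ j, z j ∈ Algebra.adjoin ℂ (Set.range G))
    (hint : ∀ f ∈ Algebra.adjoin ℂ (Set.range G), IsIntegral (Algebra.adjoin ℂ (Set.range z)) f)
    (a : σ → ℂ) : ∃ P : Ideal (MvPolynomial σ ℂ), P.IsPrime ∧
      (∀ i, G i - C (eval a (G i)) ∈ P) ∧ P.height ≤ Fintype.card κ := by
  have hN := isNoetherianRing_adjoin_range G
  obtain ⟨P, hP, hPa⟩ := Ideal.exists_minimalPrimes_le (fibreIdeal_le (G := G) a)
  have hPp := hP.isPrime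
  refine ⟨P, hPp, fun i => hP.1.2 (sub_C_mem_fibreIdeal a i), ?_⟩
  have hover : P.LiesOver ((vanishingIdeal ℂ {a}).comap
      (algebraMap (Algebra.adjoin ℂ (Set.range G)) (MvPolynomial σ ℂ))) :=
    ⟨le_antisymm (Ideal.map_le_iff_le_comap.1 hP.1.2) (Ideal.comap_mono hPa)⟩
  refine (Ideal.height_le_height_add_of_liesOver ((vanishingIdeal ℂ {a}).comap
      (algebraMap (Algebra.adjoin ℂ (Set.range G)) (MvPolynomial σ ℂ))) P).trans ?_
  -- `P` is minimal over the fibre ideal, so the fibre contributes nothing to its height.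
  have h0 : (P.map (Ideal.Quotient.mk (fibreIdeal G a))).height = 0 := by
    have hmp : (P.map (Ideal.Quotient.mk (fibreIdeal G a))).IsPrime :=
      Ideal.isPrime_map_quotientMk_of_isPrime hP.1.2
    rw [Ideal.height_eq_zero_iff]
    have := Ideal.minimalPrimes_map_of_surjective
      (Ideal.Quotient.mk_surjective (I := fibreIdeal G a)) (fibreIdeal G a)
    rw [Ideal.map_quotient_self, Ideal.mk_ker, sup_idem] at this
    have e : minimalPrimes (MvPolynomial σ ℂ ⧸ fibreIdeal G a) =
        (⊥ : Ideal (MvPolynomial σ ℂ ⧸ fibreIdeal G a)).minimalPrimes := rfl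
    rw [e, this]
    exact ⟨P, hP, rfl⟩
  change _ + (P.map (Ideal.Quotient.mk (fibreIdeal G a))).height ≤ _
  rw [h0, add_zero]
  exact height_comap_le hz hint a

/-- Some component of a fibre through `a` has dimension at least that of the source minus that of
the target. -/
theorem exists_prime_fibre_ringKrullDim_ge (hz : ∀ j, z j ∈ Algebra.adjoin ℂ (Set.range G))
    (hint : ∀ f ∈ Algebra.adjoin ℂ (Set.range G), IsIntegral (Algebra.adjoin ℂ (Set.range z)) f)
    (a : σ → ℂ) {m : ℕ} (hm : Fintype.card κ + m ≤ Nat.card σ) :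
    ∃ P : Ideal (MvPolynomial σ ℂ), P.IsPrime ∧ (∀ i, G i - C (eval a (G i)) ∈ P) ∧
      (m : WithBot ℕ∞) ≤ ringKrullDim (MvPolynomial σ ℂ ⧸ P) := by
  have hN := isNoetherianRing_adjoin_range G
  have h1 := Ideal.height_le_height_add_of_liesOver ((vanishingIdeal ℂ {a}).comap
      (algebraMap (Algebra.adjoin ℂ (Set.range G)) (MvPolynomial σ ℂ))) (vanishingIdeal ℂ {a})
  rw [height_vanishingIdeal_singleton] at h1
  -- The point has height `card σ` and the base accounts for at most `card κ`; the fibre must supply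
  -- the rest.
  have h2 : (m : ℕ∞) ≤
      ((vanishingIdeal ℂ {a}).map (Ideal.Quotient.mk (fibreIdeal G a))).height := by
    have h3 := h1.trans (add_le_add_left (height_comap_le hz hint a) _)
    have h4 : ((Fintype.card κ + m : ℕ) : ℕ∞) ≤ (Nat.card σ : ℕ∞) := by exact_mod_cast hm
    rw [Nat.cast_add] at h4
    exact (ENat.add_le_add_iff_left (ENat.natCast_ne_top _)).1 (h4.trans h3)
  obtain ⟨P, hP, hIP, -, hd⟩ := exists_prime_le_ringKrullDim_quotient_ge (fibreIdeal_le a) h2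
  exact ⟨P, hP, fun i => hIP (sub_C_mem_fibreIdeal a i), hd⟩

end Fibres

/-! ### The image closure: ideal, irreducibility, dimension. -/

section Image

open PolyMap

variable {n : ℕ} (H : PolyMap n)

theorem vanishingIdeal_imageClosure :
    vanishingIdeal ℂ (imageClosure H) = vanishingIdeal ℂ (Set.range (toFun H)) :=
  le_antisymm (vanishingIdeal_anti_mono (zeroLocus_vanishingIdeal_le _))
    (le_vanishingIdeal_zeroLocus _)

theorem eval_bind (x : Fin n → ℂ) (f : MvPolynomial (Fin n) ℂ) :
    eval x (bind₁ H f) = eval (toFun H x) f := by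
  rw [← coe_aeval_eq_eval, ← coe_aeval_eq_eval]
  simp only [RingHom.coe_coe]
  rw [aeval_bind₁]
  rfl

theorem mem_vanishingIdeal_imageClosure {f : MvPolynomial (Fin n) ℂ} :
    f ∈ vanishingIdeal ℂ (imageClosure H) ↔ ∀ x, eval (toFun H x) f = 0 := by
  rw [vanishingIdeal_imageClosure, mem_vanishingIdeal_iff, Set.forall_mem_range]
  simp [aeval_eq_eval]

theorem vanishingIdeal_imageClosure_eq_ker :
    vanishingIdeal ℂ (imageClosure H) = RingHom.ker (aeval H : MvPolynomial (Fin n) ℂ →ₐ[ℂ] _) := by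
  ext f
  rw [mem_vanishingIdeal_imageClosure, RingHom.mem_ker, aeval_eq_bind₁]
  constructor
  · intro h
    refine MvPolynomial.funext fun x => ?_
    rw [map_zero, eval_bind, h]
  · intro h x
    rw [← eval_bind, h, map_zero]

instance : (vanishingIdeal ℂ (imageClosure H)).IsPrime := by
  rw [vanishingIdeal_imageClosure_eq_ker]; exact RingHom.ker_isPrime _

/-- The coordinate ring is the algebra generated by the components of `H`, which is integral over a
polynomial ring in `rkJ H` variables. -/
theorem algDim_imageClosure : algDim (imageClosure H) = (rkJ H : WithBot ℕ∞) := by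
  obtain ⟨z, hz, hzm, hint⟩ := exists_noether_normalization H
  have hle : Algebra.adjoin ℂ (Set.range z) ≤ Algebra.adjoin ℂ (Set.range H) :=
    Algebra.adjoin_le (by rintro _ ⟨j, rfl⟩; exact hzm j)
  have h1 : algDim (imageClosure H) = ringKrullDim (Algebra.adjoin ℂ (Set.range H)) := by
    rw [algDim, vanishingIdeal_imageClosure_eq_ker, Algebra.adjoin_range_eq_range_aeval]
    exact ringKrullDim_eq_of_ringEquiv
      (Ideal.quotientKerEquivRange (aeval H : MvPolynomial (Fin n) ℂ →ₐ[ℂ] _)).toRingEquiv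
  have h2 : ringKrullDim (Algebra.adjoin ℂ (Set.range z)) = (rkJ H : ℕ∞) := by
    rw [← ringKrullDim_eq_of_ringEquiv hz.aevalEquiv.toRingEquiv,
      ringKrullDim_mvPolynomial_complex, Nat.card_eq_fintype_card, Fintype.card_fin]
  rw [h1]
  refine le_antisymm ?_ ?_
  · exact (ringKrullDim_subalgebra_le hle hint).trans h2.le
  · exact h2.ge.trans (le_ringKrullDim_subalgebra hle hint)

end Image

end

/-! ### Restriction to lines; basic properties of homogeneous quasi-translations. -/

section

section Lines

variable {σ : Type*}

theorem eval_smul_of_isHomogeneous {p : MvPolynomial σ ℂ} {d : ℕ} (hp : p.IsHomogeneous d) (c : ℂ)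
    (x : σ → ℂ) : eval (c • x) p = c ^ d * eval x p := by
  rw [eval_eq, eval_eq, Finset.mul_sum]
  refine Finset.sum_congr rfl fun m hm => ?_
  have h1 : m.degree = d := by
    by_contra hne
    exact mem_support_iff.1 hm (hp.coeff_eq_zero hne)
  simp only [Pi.smul_apply, smul_eq_mul, mul_pow, Finset.prod_mul_distrib]
  rw [Finset.prod_pow_eq_pow_sum, ← Finsupp.degree_apply, h1]
  ring

/-- The restriction of a polynomial to the line `t ↦ a + t b`. -/
def lineRestrict (a b : σ → ℂ) (p : MvPolynomial σ ℂ) : Polynomial ℂ :=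
  aeval (fun i => Polynomial.C (a i) + Polynomial.X * Polynomial.C (b i)) p

theorem eval_lineRestrict (a b : σ → ℂ) (p : MvPolynomial σ ℂ) (t : ℂ) :
    (lineRestrict a b p).eval t = eval (a + t • b) p := by
  induction p using MvPolynomial.induction_on with
  | C c => simp [lineRestrict]
  | add p q hp hq => simp [lineRestrict, ← hp, ← hq]
  | mul_X p i hp =>
    rw [map_mul, eval_X, ← hp]
    simp [lineRestrict, mul_comm t]

theorem eval_line_eq_zero {a b : σ → ℂ} {p : MvPolynomial σ ℂ}
    (h : {t : ℂ | eval (a + t • b) p = 0}.Infinite) (t : ℂ) : eval (a + t • b) p = 0 := by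
  have h0 : lineRestrict a b p = 0 :=
    Polynomial.eq_zero_of_infinite_isRoot _ (h.mono fun t ht => by
      change Polynomial.eval t _ = 0
      rw [eval_lineRestrict]; exact ht)
  rw [← eval_lineRestrict, h0, Polynomial.eval_zero]

theorem eval_line_eq_zero_of_ne {a b : σ → ℂ} {p : MvPolynomial σ ℂ} {t₀ : ℂ}
    (h : ∀ t ≠ t₀, eval (a + t • b) p = 0) (t : ℂ) : eval (a + t • b) p = 0 :=
  eval_line_eq_zero ((Set.finite_singleton t₀).infinite_compl.mono fun t ht => h t ht) t

end Lines

open PolyMap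

variable {n : ℕ} {H : PolyMap n}

theorem mem_imageClosure {w : Fin n → ℂ} :
    w ∈ imageClosure H ↔ ∀ f ∈ vanishingIdeal ℂ (imageClosure H), eval w f = 0 := by
  rw [imageClosure, mem_zeroLocus_iff, ← vanishingIdeal_imageClosure]
  simp [aeval_eq_eval, imageClosure]

theorem toFun_mem_imageClosure (H : PolyMap n) (x : Fin n → ℂ) : toFun H x ∈ imageClosure H :=
  zeroLocus_vanishingIdeal_le _ ⟨x, rfl⟩

theorem eval_eq_zero_of_mem {f : MvPolynomial (Fin n) ℂ}
    (hf : ∀ x, eval (toFun H x) f = 0) {w : Fin n → ℂ} (hw : w ∈ imageClosure H) :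
    eval w f = 0 :=
  mem_imageClosure.1 hw f ((mem_vanishingIdeal_imageClosure H).2 hf)

theorem mem_imageClosure' {w : Fin n → ℂ} :
    w ∈ imageClosure H ↔ ∀ f : MvPolynomial (Fin n) ℂ, (∀ x, eval (toFun H x) f = 0) →
      eval w f = 0 := by
  simp_rw [mem_imageClosure, mem_vanishingIdeal_imageClosure]

theorem notMem_vanishingIdeal {f : MvPolynomial (Fin n) ℂ} {w : Fin n → ℂ}
    (hw : w ∈ imageClosure H) (hf : eval w f ≠ 0) : f ∉ vanishingIdeal ℂ (imageClosure H) :=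
  fun h => hf (mem_imageClosure.1 hw f h)

theorem exists_toFun_eval_ne_zero {f : MvPolynomial (Fin n) ℂ}
    (hf : f ∉ vanishingIdeal ℂ (imageClosure H)) : ∃ x, eval (toFun H x) f ≠ 0 := by
  by_contra h
  push Not at h
  exact hf ((mem_vanishingIdeal_imageClosure H).2 h)

theorem prod_notMem_vanishingIdeal {ι : Type*} (s : Finset ι) {p : ι → MvPolynomial (Fin n) ℂ}
    (hp : ∀ i ∈ s, p i ∉ vanishingIdeal ℂ (imageClosure H)) :
    ∏ i ∈ s, p i ∉ vanishingIdeal ℂ (imageClosure H) := by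
  classical
  intro h
  obtain ⟨i, hi, hpi⟩ := (Ideal.IsPrime.prod_mem_iff (p := vanishingIdeal ℂ (imageClosure H))).1 h
  exact hp i hi hpi

/-- Irreducibility of the image closure: finitely many functions that do not vanish identically
on it are simultaneously nonzero at some point of the image. -/
theorem exists_toFun_forall_eval_ne_zero {ι : Type*} {s : Set ι} (hs : s.Finite)
    {p : ι → MvPolynomial (Fin n) ℂ}
    (hp : ∀ i ∈ s, p i ∉ vanishingIdeal ℂ (imageClosure H)) :
    ∃ x, ∀ i ∈ s, eval (toFun H x) (p i) ≠ 0 := by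
  obtain ⟨x, hx⟩ := exists_toFun_eval_ne_zero (prod_notMem_vanishingIdeal hs.toFinset
    (fun i hi => hp i (hs.mem_toFinset.1 hi)))
  rw [map_prod] at hx
  exact ⟨x, fun i hi => Finset.prod_ne_zero_iff.1 hx i (hs.mem_toFinset.2 hi)⟩

section Basic

theorem polyMap_ext {F G : PolyMap n} (h : ∀ x, toFun F x = toFun G x) : F = G := by
  ext1 i
  refine MvPolynomial.funext fun x => ?_
  exact congrFun (h x) i

theorem toFun_comp (F G : PolyMap n) (x : Fin n → ℂ) :
    toFun (comp F G) x = toFun F (toFun G x) := by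
  ext i
  exact eval_bind G x (F i)

theorem toFun_ident_add (H : PolyMap n) (x : Fin n → ℂ) :
    toFun (ident n + H) x = x + toFun H x := by
  ext i; simp [toFun, ident]

theorem toFun_ident_sub (H : PolyMap n) (x : Fin n → ℂ) :
    toFun (ident n - H) x = x - toFun H x := by
  ext i; simp [toFun, ident]

theorem toFun_ident (x : Fin n → ℂ) : toFun (ident n) x = x := by
  ext i; simp [toFun, ident]

/-- The inverse relation is the case $t=1$. Iteration gives all natural $t$, and a polynomial in $t$
that is constant on $\mathbb N$ is constant. -/
theorem toFun_add_smul (hqt : IsQuasiTranslation H) (x : Fin n → ℂ) (t : ℂ) :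
    toFun H (x + t • toFun H x) = toFun H x := by
  have h1 : ∀ y, toFun H (y + toFun H y) = toFun H y := fun y => by
    have := congrArg (fun F => toFun F y) hqt.1
    simp only [toFun_comp, toFun_ident_add, toFun_ident_sub, toFun_ident] at this
    rw [sub_eq_iff_eq_add] at this
    exact (add_left_cancel this).symm
  have h2 : ∀ k : ℕ, toFun H (x + (k : ℂ) • toFun H x) = toFun H x := by
    intro k
    induction k with
    | zero => simp
    | succ k ih =>
      have := h1 (x + (k : ℂ) • toFun H x)
      rw [ih] at this
      push_cast
      rwa [add_smul, one_smul, ← add_assoc]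
  ext i
  have h3 : eval (x + t • toFun H x) (H i - C (eval x (H i))) = 0 := by
    refine eval_line_eq_zero ?_ t
    refine (Set.infinite_range_of_injective (Nat.cast_injective (R := ℂ))).mono ?_
    rintro _ ⟨k, rfl⟩
    have := congrFun (h2 k) i
    simp only [toFun] at this
    simpa [sub_eq_zero] using this
  simpa [sub_eq_zero, toFun] using h3

theorem isQuasiTranslation_of_toFun (h : ∀ x (t : ℂ), toFun H (x + t • toFun H x) = toFun H x) :
    IsQuasiTranslation H := by
  constructor <;> refine polyMap_ext fun x => ?_
  · have := h x 1
    rw [one_smul] at this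
    simp [toFun_comp, toFun_ident_add, toFun_ident_sub, toFun_ident, this]
  · have := h x (-1)
    rw [neg_one_smul, ← sub_eq_add_neg] at this
    simp [toFun_comp, toFun_ident_add, toFun_ident_sub, toFun_ident, this]

end Basic

/-- `x + H` is a quasi-translation, homogeneous of positive degree `d`. -/
structure IsHQT (H : PolyMap n) (d : ℕ) : Prop where
  hom : ∀ i, (H i).IsHomogeneous d
  pos : 0 < d
  qt : IsQuasiTranslation H

theorem rkJ_eq_zero_of_degree_zero (h : ∀ i, (H i).IsHomogeneous 0) : rkJ H = 0 := by
  have : jacobian H = 0 := by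
    ext i j : 2
    have := (totalDegree_zero_iff_isHomogeneous _).2 (h i)
    rw [totalDegree_eq_zero_iff_eq_C] at this
    simp only [jacobian, Matrix.of_apply, Matrix.zero_apply]
    rw [this, pderiv_C]
  rw [rkJ, this]
  simp [Matrix.rank_zero]

theorem exists_isHQT (hH : PolyMap.IsHomogeneous H) (hqt : IsQuasiTranslation H)
    (hr : rkJ H ≠ 0) : ∃ d, IsHQT H d := by
  obtain ⟨d, hd⟩ := hH
  refine ⟨d, hd, Nat.pos_of_ne_zero ?_, hqt⟩
  rintro rfl
  exact hr (rkJ_eq_zero_of_degree_zero hd)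

namespace IsHQT

variable {d : ℕ}

theorem toFun_smul (h : IsHQT H d) (c : ℂ) (x : Fin n → ℂ) :
    toFun H (c • x) = c ^ d • toFun H x := by
  ext i
  exact eval_smul_of_isHomogeneous (h.hom i) c x

theorem toFun_zero (h : IsHQT H d) : toFun H 0 = 0 := by
  have := h.toFun_smul 0 0
  rwa [zero_smul, zero_pow h.pos.ne', zero_smul] at this

theorem mem_V_iff {x : Fin n → ℂ} : x ∈ V H ↔ toFun H x = 0 := by
  simp [V, toFun, funext_iff]

theorem smul_mem_V (h : IsHQT H d) (c : ℂ) {x : Fin n → ℂ} (hx : x ∈ V H) : c • x ∈ V H := by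
  rw [mem_V_iff] at hx ⊢
  rw [h.toFun_smul, hx, smul_zero]

/-- Put $t=1/s$ in $H(x+tH(x))=H(x)$: homogeneity gives $H(H(x)+sx)=s^dH(x)$ for $s\ne0$, hence for
$s=0$ as well, where the right side vanishes because $d>0$. -/
theorem toFun_mem_V (h : IsHQT H d) (x : Fin n → ℂ) : toFun H x ∈ V H := by
  intro i
  have h1 : lineRestrict (toFun H x) x (H i) =
      Polynomial.X ^ d * Polynomial.C (eval x (H i)) := by
    refine Polynomial.eq_of_infinite_eval_eq _ _
      ((Set.finite_singleton (0 : ℂ)).infinite_compl.mono fun s hs => ?_)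
    have hs' : s ≠ 0 := hs
    have h2 : toFun H x + s • x = s • (x + s⁻¹ • toFun H x) := by
      rw [smul_add, smul_inv_smul₀ hs', add_comm]
    have h3 := congrFun (toFun_add_smul h.qt x s⁻¹) i
    simp only [toFun] at h3
    simp only [Set.mem_ofPred_eq, eval_lineRestrict, h2, eval_smul_of_isHomogeneous (h.hom i),
      Polynomial.eval_mul, Polynomial.eval_pow, Polynomial.eval_X, Polynomial.eval_C]
    congr 1
  have h2 := congrArg (Polynomial.eval 0) h1
  rw [eval_lineRestrict, zero_smul, add_zero] at h2
  rw [h2]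
  simp [h.pos.ne']

theorem imageClosure_subset_V (h : IsHQT H d) : imageClosure H ⊆ V H := fun _ hw i =>
  eval_eq_zero_of_mem (fun x => h.toFun_mem_V x i) hw

theorem smul_mem_imageClosure (h : IsHQT H d) (c : ℂ) {w : Fin n → ℂ}
    (hw : w ∈ imageClosure H) : c • w ∈ imageClosure H := by
  rw [mem_imageClosure']
  intro f hf
  -- Scaling the argument by `u` scales the value by `u ^ d`, so `c` is written as a `d`-th power.
  obtain ⟨u, hu⟩ := IsAlgClosed.exists_pow_nat_eq c h.pos
  let g : MvPolynomial (Fin n) ℂ := bind₁ (fun i => C c * X i) f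
  have hg : ∀ x, eval x g = eval (c • x) f := fun x => by
    rw [eval_bind]; congr 2; ext i; simp [toFun]
  rw [← hg]
  refine eval_eq_zero_of_mem (fun x => ?_) hw
  rw [hg, ← hu, ← h.toFun_smul]
  exact hf _

end IsHQT

end

/-! ### Homogeneous cores of primes; joined points. -/

section

open PolyMap

section Core

theorem isWeightedHomogeneous_rename {σ τ : Type*} {w : τ → ℕ} {e : σ → τ} {p : MvPolynomial σ ℂ}
    {k : ℕ} (hp : IsWeightedHomogeneous (w ∘ e) p k) : IsWeightedHomogeneous w (rename e p) k := by
  rw [p.as_sum, map_sum]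
  refine IsWeightedHomogeneous.sum _ _ _ fun m hm => ?_
  rw [rename_monomial]
  refine isWeightedHomogeneous_monomial _ _ _ ?_
  rw [← hp (mem_support_iff.1 hm), Finsupp.weight_apply, Finsupp.weight_apply,
    Finsupp.sum_mapDomain_index (by simp) (by intros; rw [add_smul])]
  rfl

theorem isWeightedHomogeneous_zero_weight {σ : Type*} (p : MvPolynomial σ ℂ) :
    IsWeightedHomogeneous (fun _ => 0 : σ → ℕ) p 0 := by
  intro m _
  simp [Finsupp.weight_apply]

/-- The prime ideal generated by the weighted homogeneous elements of a prime ideal. -/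
theorem exists_homogeneous_prime_le {σ : Type*} (w : σ → ℕ) (P : Ideal (MvPolynomial σ ℂ))
    [hP : P.IsPrime] : ∃ P' : Ideal (MvPolynomial σ ℂ), P'.IsPrime ∧ P' ≤ P ∧
      (∀ f ∈ P, ∀ k, IsWeightedHomogeneous w f k → f ∈ P') ∧
      ∀ f ∈ P', ∀ k, weightedHomogeneousComponent w k f ∈ P' := by
  let := weightedGradedAlgebra ℂ w
  refine ⟨(P.homogeneousCore (weightedHomogeneousSubmodule ℂ w)).toIdeal, hP.homogeneousCore,
    Ideal.toIdeal_homogeneousCore_le _ _, fun f hf k hk =>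
      Ideal.mem_homogeneousCore_of_homogeneous_of_mem ⟨k, hk⟩ hf, fun f hf k => ?_⟩
  exact weightedHomogeneousComponent_mem_of_mem ℂ w
    (P.homogeneousCore (weightedHomogeneousSubmodule ℂ w)).isHomogeneous hf k

/-- The component of weight zero is a nonzero constant. This shows that passing from a fibre over a
nonzero value to its cone gains a dimension. -/
theorem sub_C_notMem_of_homogeneous {σ : Type*} {w : σ → ℕ} {P : Ideal (MvPolynomial σ ℂ)}
    [hP : P.IsPrime] (h : ∀ f ∈ P, ∀ k, weightedHomogeneousComponent w k f ∈ P)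
    {f : MvPolynomial σ ℂ} {d : ℕ} (hf : IsWeightedHomogeneous w f d) (hd : 0 < d) {c : ℂ}
    (hc : c ≠ 0) : f - C c ∉ P := by
  intro hmem
  have h1 := h _ hmem 0
  rw [map_sub, hf.weightedHomogeneousComponent_ne 0 hd.ne,
    (isWeightedHomogeneous_C w c).weightedHomogeneousComponent_same, zero_sub,
    Ideal.neg_mem_iff] at h1
  refine hP.ne_top (Ideal.eq_top_of_isUnit_mem _ h1 ?_)
  exact (isUnit_iff_ne_zero.2 hc).map C

end Core

variable {n : ℕ} {H : PolyMap n} {d : ℕ}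

/-- On the closure of the set where `H` is a nonzero multiple of `q`, the map `H` is invariant
under translation by `q`. -/
theorem toFun_add_smul_of_mem_zeroLocus (hqt : IsQuasiTranslation H) {σ : Type*} [Finite σ]
    (e : Fin n → σ) {P : Ideal (MvPolynomial σ ℂ)} [hP : P.IsPrime] {q : Fin n → ℂ}
    (hQ : ∀ i j, rename e (C (q i) * H j - C (q j) * H i) ∈ P) {i₀ : Fin n}
    (hi₀ : rename e (H i₀) ∉ P) (hq : q i₀ ≠ 0) {x : σ → ℂ} (hx : x ∈ zeroLocus ℂ P) (t : ℂ) :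
    toFun H (x ∘ e + t • q) = toFun H (x ∘ e) := by
  ext i
  -- It is enough to prove membership after multiplying by `H i₀`. Where `H i₀` is nonzero, `H`
  -- takes a value `μ • q` with `μ ≠ 0`, so translation by `t • q` is translation by `t / μ` times
  -- that value.
  have hmem : rename e (translate (t • q) (H i) - H i) ∈ P := by
    refine (hP.mem_or_mem ?_).resolve_left hi₀
    rw [← IsPrime.vanishingIdeal_zeroLocus (K := ℂ) P, mem_vanishingIdeal_iff]
    intro y hy
    rw [aeval_eq_eval, map_mul, eval_rename, eval_rename, map_sub, eval_translate]
    by_cases h0 : eval (y ∘ e) (H i₀) = 0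
    · rw [h0, zero_mul]
    · set μ := eval (y ∘ e) (H i₀) / q i₀ with hμ
      have hμ0 : μ ≠ 0 := div_ne_zero h0 hq
      have h1 : toFun H (y ∘ e) = μ • q := by
        ext j
        have := hy _ (hQ i₀ j)
        rw [aeval_eq_eval, eval_rename] at this
        simp only [map_sub, map_mul, eval_C] at this
        simp only [toFun, Pi.smul_apply, smul_eq_mul, hμ]
        field_simp
        linear_combination this
      have h2 := congrFun (toFun_add_smul hqt (y ∘ e) (t / μ)) i
      rw [h1, smul_smul, div_mul_cancel₀ _ hμ0, ← h1] at h2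
      simp only [toFun] at h2
      rw [h2, sub_self, mul_zero]
  have := hx _ hmem
  rw [aeval_eq_eval, eval_rename, map_sub, eval_translate, sub_eq_zero] at this
  exact this

section Joined

/-- The span of `c` and `q` is contained in `V(H)`. -/
def Joined (H : PolyMap n) (c q : Fin n → ℂ) : Prop := ∀ s t : ℂ, s • c + t • q ∈ V H

theorem Joined.symm {c q : Fin n → ℂ} (h : Joined H c q) : Joined H q c := fun s t => by
  rw [add_comm]; exact h t s

/-- Scaling the line covers all $sc+tq$ with $t\ne0$; the case $t=0$ follows because $V(H)$ is
closed. -/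
theorem IsHQT.joined_of_line (h : IsHQT H d) {c q : Fin n → ℂ}
    (hc : ∀ s : ℂ, q + s • c ∈ V H) : Joined H c q := by
  have h1 : ∀ s t : ℂ, t ≠ 0 → s • c + t • q ∈ V H := fun s t ht => by
    have := h.smul_mem_V t (hc (s / t))
    rwa [smul_add, smul_smul, mul_div_cancel₀ _ ht, add_comm] at this
  intro s t i
  exact eval_line_eq_zero_of_ne (t₀ := 0) (fun t ht => h1 s t ht i) t

theorem Joined.line {c q : Fin n → ℂ} (h : Joined H c q) (s : ℂ) : q + s • c ∈ V H := by
  have := h s 1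
  rwa [one_smul, add_comm] at this

theorem IsGNPlane.joined {L : Submodule ℂ (Fin n → ℂ)} (hL : IsGNPlane H L) {c q : Fin n → ℂ}
    (hc : c ∈ L) (hq : q ∈ L) : Joined H c q := fun s t =>
  hL.2 (L.add_mem (L.smul_mem s hc) (L.smul_mem t hq))

theorem Joined.isGNPlane {c q : Fin n → ℂ} (h : Joined H c q)
    (hli : LinearIndependent ℂ ![c, q]) : IsGNPlane H (Submodule.span ℂ {c, q}) := by
  constructor
  · have := finrank_span_eq_card hli
    rwa [Matrix.range_cons, Matrix.range_cons, Matrix.range_empty, Set.union_empty,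
      Set.singleton_union, Fintype.card_fin] at this
  · intro x hx
    obtain ⟨s, t, rfl⟩ := Submodule.mem_span_pair.1 hx
    exact h s t

theorem linearIndependent_pair {c q : Fin n → ℂ} (hq : q ≠ 0)
    (hc : c ∉ Submodule.span ℂ {q}) : LinearIndependent ℂ ![c, q] := by
  rw [LinearIndependent.pair_symm_iff, LinearIndependent.pair_iff' hq]
  intro a ha
  exact hc (Submodule.mem_span_singleton.2 ⟨a, ha⟩)

/-- `H(x + q)` as a polynomial in `x` with coefficients polynomial in `q`. -/
def shiftForm {σ : Type*} (p : MvPolynomial σ ℂ) : MvPolynomial σ (MvPolynomial σ ℂ) :=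
  aeval (fun i => X i + C (X i)) p

theorem eval_map_shiftForm {σ : Type*} (p : MvPolynomial σ ℂ) (c q : σ → ℂ) :
    eval c (map (eval q) (shiftForm p)) = eval (c + q) p := by
  induction p using MvPolynomial.induction_on with
  | C a => simp [shiftForm, MvPolynomial.algebraMap_apply]
  | add p r hp hr => simp [shiftForm, ← hp, ← hr]
  | mul_X p i hp =>
    rw [map_mul, eval_X, ← hp]
    simp [shiftForm]

/-- The coefficients of the powers of $s$ in $H_i(q+sc)$ are forms in $c$ with coefficients
polynomial in $q$. Homogeneity in $c$ is what makes elimination applicable to partners. -/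
theorem exists_forms_line (H : PolyMap n) : ∃ (D : ℕ)
    (F : Fin n × Fin D → MvPolynomial (Fin n) (MvPolynomial (Fin n) ℂ)),
    (∀ i, (F i).IsHomogeneous i.2) ∧
    ∀ c q : Fin n → ℂ, (∀ i, eval c (map (eval q) (F i)) = 0) ↔ ∀ s : ℂ, q + s • c ∈ V H := by
  let D := ∑ i, (shiftForm (H i)).totalDegree + 1
  have hD : ∀ i, (shiftForm (H i)).totalDegree < D := fun i =>
    Nat.lt_succ_of_le (Finset.single_le_sum (f := fun i => (shiftForm (H i)).totalDegree)
      (fun _ _ => Nat.zero_le _) (Finset.mem_univ i))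
  refine ⟨D, fun i => homogeneousComponent i.2 (shiftForm (H i.1)),
    fun i => homogeneousComponent_isHomogeneous _ _, fun c q => ?_⟩
  have key : ∀ (i : Fin n) (s : ℂ), eval (q + s • c) (H i) =
      ∑ j ∈ Finset.range D, s ^ j *
        eval c (map (eval q) (homogeneousComponent j (shiftForm (H i)))) := by
    intro i s
    rw [add_comm, ← eval_map_shiftForm]
    conv_lhs => rw [← sum_homogeneousComponent (shiftForm (H i))]
    rw [map_sum, map_sum, Finset.sum_congr rfl fun j _ => eval_smul_of_isHomogeneous
      ((homogeneousComponent_isHomogeneous j (shiftForm (H i))).map (eval q)) s c]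
    refine Finset.sum_subset (Finset.range_subset_range.2 (hD i)) fun j _ hj => ?_
    rw [homogeneousComponent_eq_zero _ _ (by simpa using hj)]
    simp
  constructor
  · intro h s i
    rw [key]
    refine Finset.sum_eq_zero fun j hj => ?_
    rw [h (i, ⟨j, Finset.mem_range.1 hj⟩), mul_zero]
  · rintro h ⟨i, j⟩
    let p : Polynomial ℂ := ∑ j ∈ Finset.range D, Polynomial.monomial j
      (eval c (map (eval q) (homogeneousComponent j (shiftForm (H i)))))
    have hp : p = 0 := by
      refine Polynomial.funext fun s => ?_
      rw [Polynomial.eval_finsetSum, Polynomial.eval_zero, ← h s i, key]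
      exact Finset.sum_congr rfl fun j _ => by rw [Polynomial.eval_monomial, mul_comm]
    have := congrArg (fun p => Polynomial.coeff p j) hp
    simpa [p, Polynomial.finsetSum_coeff, Polynomial.coeff_monomial] using this

/-- The points `q` for which some nonzero zero `c` of a given system of forms satisfies
`q + ℂc ⊆ V(H)` form a closed set. -/
theorem exists_eval_ne_zero_of_forall_line {κ : Type*} [Fintype κ]
    {l : κ → MvPolynomial (Fin n) ℂ} {e : κ → ℕ} (hl : ∀ k, (l k).IsHomogeneous (e k))
    {q₀ : Fin n → ℂ}
    (h : ∀ c : Fin n → ℂ, (∀ k, eval c (l k) = 0) → (∀ s : ℂ, q₀ + s • c ∈ V H) → c = 0) :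
    ∃ g : MvPolynomial (Fin n) ℂ, eval q₀ g ≠ 0 ∧ ∀ q, eval q g ≠ 0 → ∀ c : Fin n → ℂ,
      (∀ k, eval c (l k) = 0) → (∀ s : ℂ, q + s • c ∈ V H) → c = 0 := by
  obtain ⟨D, F, hF, hFV⟩ := exists_forms_line H
  have hC : ∀ (q : Fin n → ℂ), (eval q).comp (C : ℂ →+* MvPolynomial (Fin n) ℂ) = RingHom.id ℂ :=
    fun q => by ext; simp
  obtain ⟨g, hg, hgq⟩ := exists_eval_ne_zero_of_only_trivial_zero
    (F := Sum.elim F fun k => map C (l k)) (d := Sum.elim (fun i => (i.2 : ℕ)) e) (q₀ := q₀)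
    (by rintro (i | k); exacts [hF i, (hl k).map C])
    (fun c hc => h c (fun k => by simpa [map_map, hC, map_id] using hc (Sum.inr k))
      ((hFV c q₀).1 fun i => hc (Sum.inl i)))
  refine ⟨g, hg, fun q hq c hc hcV => hgq q hq c ?_⟩
  rintro (i | k)
  · exact (hFV c q).2 hcV i
  · simpa [map_map, hC, map_id] using hc k

end Joined

end

/-! ### Common partners of two points of the image closure. -/

section

open PolyMap

variable {n : ℕ} {H : PolyMap n} {d : ℕ}

section CommonPartner

/-- A homogeneous ideal meeting a linear subspace of codimension `k` only in the origin has
dimension at most `k`. -/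
theorem ringKrullDim_quotient_le_of_zeroLocus_subset {σ : Type*} [Finite σ]
    {I : Ideal (MvPolynomial σ ℂ)} (hI : ∀ f ∈ I, ∀ k, homogeneousComponent k f ∈ I)
    {κ : Type*} [Fintype κ] {l : κ → MvPolynomial σ ℂ} (hl : ∀ j, (l j).IsHomogeneous 1)
    (h : ∀ c ∈ zeroLocus ℂ I, (∀ j, eval c (l j) = 0) → c = 0) :
    ringKrullDim (MvPolynomial σ ℂ ⧸ I) ≤ Fintype.card κ := by
  have hker : RingHom.ker (Ideal.Quotient.mkₐ ℂ I) = I := by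
    ext f
    rw [RingHom.mem_ker, Ideal.Quotient.mkₐ_eq_mk, Ideal.Quotient.eq_zero_iff_mem]
  exact ringKrullDim_le_of_zeroLocus_ker_subset (π := Ideal.Quotient.mkₐ ℂ I)
    (Ideal.Quotient.mkₐ_surjective ℂ I) (by
      rw [hker]
      intro k f hf
      have := hI f hf k
      rwa [← decomposition.decompose'_apply] at this) hl (by rwa [hker])

/-- If the conditions `l = 0` and `q + ℂc ⊆ V(H)` on `c` have a nonzero solution for all `q` in
the image of `H`, then they do so for all `q` in its closure. -/
theorem exists_line_of_mem_imageClosure {κ : Type*} [Fintype κ]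
    {l : κ → MvPolynomial (Fin n) ℂ} {e : κ → ℕ} (hl : ∀ k, (l k).IsHomogeneous (e k))
    (h : ∀ x, ∃ c : Fin n → ℂ, c ≠ 0 ∧ (∀ k, eval c (l k) = 0) ∧ ∀ s : ℂ, toFun H x + s • c ∈ V H)
    {q : Fin n → ℂ} (hq : q ∈ imageClosure H) :
    ∃ c : Fin n → ℂ, c ≠ 0 ∧ (∀ k, eval c (l k) = 0) ∧ ∀ s : ℂ, q + s • c ∈ V H := by
  by_contra hcon
  push Not at hcon
  obtain ⟨g, hg, hgq⟩ := exists_eval_ne_zero_of_forall_line (H := H) hl (q₀ := q)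
    fun c hc hcV => by
      by_contra hc0
      obtain ⟨s, hs⟩ := hcon c hc0 hc
      exact hs (hcV s)
  obtain ⟨x, hx⟩ := exists_toFun_eval_ne_zero (notMem_vanishingIdeal hq hg)
  obtain ⟨c, hc0, hc, hcV⟩ := h x
  exact hc0 (hgq _ hx c hc hcV)

theorem isIntegral_adjoin_rename {σ τ κ κ' ι : Type*} {e : σ → τ} {z : κ → MvPolynomial σ ℂ}
    {z' : κ' → MvPolynomial τ ℂ} {G : ι → MvPolynomial σ ℂ}
    (hz : ∀ j, ∃ j', rename e (z j) = z' j')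
    (hint : ∀ f ∈ Algebra.adjoin ℂ (Set.range G), IsIntegral (Algebra.adjoin ℂ (Set.range z)) f)
    {f : MvPolynomial σ ℂ} (hf : f ∈ Algebra.adjoin ℂ (Set.range G)) :
    IsIntegral (Algebra.adjoin ℂ (Set.range z')) (rename e f) := by
  have hle : (Algebra.adjoin ℂ (Set.range z)).map (rename e) ≤
      Algebra.adjoin ℂ (Set.range z') := by
    rw [AlgHom.map_adjoin, Algebra.adjoin_le_iff]
    rintro _ ⟨_, ⟨j, rfl⟩, rfl⟩
    obtain ⟨j', hj'⟩ := hz j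
    exact Algebra.subset_adjoin ⟨j', hj'.symm⟩
  let φ : Algebra.adjoin ℂ (Set.range z) →+* Algebra.adjoin ℂ (Set.range z') :=
    (((rename e).comp (Algebra.adjoin ℂ (Set.range z)).val).codRestrict
      (Algebra.adjoin ℂ (Set.range z')) fun x => hle ⟨x, x.2, rfl⟩ :
      Algebra.adjoin ℂ (Set.range z) →ₐ[ℂ] Algebra.adjoin ℂ (Set.range z'))
  exact (hint f hf).map_of_comp_eq φ (rename e : MvPolynomial σ ℂ →ₐ[ℂ] _).toRingHom rfl

/-- The pair of copies of `H` on $\mathbb C^n\times\mathbb C^n$ has a large fibre over `(q, q')`.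
Its cone meets the diagonal away from the origin, and a diagonal point gives the partner. -/
theorem exists_line_pair_of_linearIndependent (h : IsHQT H d) (hr : 2 * rkJ H ≤ n + 1)
    {a a' : Fin n → ℂ} (hli : LinearIndependent ℂ ![toFun H a, toFun H a']) :
    ∃ c : Fin n → ℂ, c ≠ 0 ∧ (∀ s : ℂ, toFun H a + s • c ∈ V H) ∧
      ∀ s : ℂ, toFun H a' + s • c ∈ V H := by
  obtain ⟨z, -, hz, hint⟩ := exists_noether_normalization H
  set q := toFun H a with hqd
  set q' := toFun H a' with hqd'
  have hq : q ≠ 0 := hli.ne_zero 0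
  have hq' : q' ≠ 0 := hli.ne_zero 1
  obtain ⟨i₀, hi₀⟩ := Function.ne_iff.1 hq
  obtain ⟨j₀, hj₀⟩ := Function.ne_iff.1 hq'
  let G : Fin n ⊕ Fin n → MvPolynomial (Fin n ⊕ Fin n) ℂ :=
    Sum.elim (fun i => rename Sum.inl (H i)) (fun i => rename Sum.inr (H i))
  let z' : Fin (rkJ H) ⊕ Fin (rkJ H) → MvPolynomial (Fin n ⊕ Fin n) ℂ :=
    Sum.elim (fun i => rename Sum.inl (z i)) (fun i => rename Sum.inr (z i))
  have hmap : ∀ (e : Fin n → Fin n ⊕ Fin n), (∀ i, ∃ i', rename e (H i) = G i') →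
      ∀ f ∈ Algebra.adjoin ℂ (Set.range H), rename e f ∈ Algebra.adjoin ℂ (Set.range G) := by
    intro e he f hf
    have : rename e f ∈ (Algebra.adjoin ℂ (Set.range H)).map (rename e) := ⟨f, hf, rfl⟩
    rw [AlgHom.map_adjoin] at this
    refine Algebra.adjoin_mono ?_ this
    rintro _ ⟨_, ⟨i, rfl⟩, rfl⟩
    obtain ⟨i', hi'⟩ := he i
    exact ⟨i', hi'.symm⟩
  have hz' : ∀ j, z' j ∈ Algebra.adjoin ℂ (Set.range G) := by
    rintro (j | j)
    · exact hmap Sum.inl (fun i => ⟨Sum.inl i, rfl⟩) _ (hz j)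
    · exact hmap Sum.inr (fun i => ⟨Sum.inr i, rfl⟩) _ (hz j)
  have hint' : ∀ f ∈ Algebra.adjoin ℂ (Set.range G),
      IsIntegral (Algebra.adjoin ℂ (Set.range z')) f := by
    intro f hf
    induction hf using Algebra.adjoin_induction with
    | mem x hx =>
      obtain ⟨i | i, rfl⟩ := hx
      · exact isIntegral_adjoin_rename (z' := z') (fun j => ⟨Sum.inl j, rfl⟩) hint
          (Algebra.subset_adjoin ⟨i, rfl⟩)
      · exact isIntegral_adjoin_rename (z' := z') (fun j => ⟨Sum.inr j, rfl⟩) hint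
          (Algebra.subset_adjoin ⟨i, rfl⟩)
    | algebraMap r =>
      exact isIntegral_algebraMap (R := Algebra.adjoin ℂ (Set.range z')) (x := algebraMap ℂ _ r)
    | add x y _ _ hx hy => exact hx.add hy
    | mul x y _ _ hx hy => exact hx.mul hy
  have hrn : rkJ H ≤ n := by omega
  obtain ⟨P₁, hP₁, hG, hdim⟩ := exists_prime_fibre_ringKrullDim_ge hz' hint' (Sum.elim a a')
    (m := 2 * n - 2 * rkJ H) (by simp; omega)
  have hl : ∀ i, rename Sum.inl (H i) - C (q i) ∈ P₁ := fun i => by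
    have := hG (Sum.inl i)
    simpa [G, eval_rename, Sum.elim_comp_inl, hqd, toFun] using this
  have hr' : ∀ i, rename Sum.inr (H i) - C (q' i) ∈ P₁ := fun i => by
    have := hG (Sum.inr i)
    simpa [G, eval_rename, Sum.elim_comp_inr, hqd', toFun] using this
  have hQ : ∀ i j, rename Sum.inl (C (q i) * H j - C (q j) * H i) ∈ P₁ := fun i j => by
    have := P₁.sub_mem (P₁.mul_mem_left (C (q i)) (hl j)) (P₁.mul_mem_left (C (q j)) (hl i))
    convert this using 1
    simp only [map_sub, map_mul, rename_C]; ring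
  have hQ' : ∀ i j, rename Sum.inr (C (q' i) * H j - C (q' j) * H i) ∈ P₁ := fun i j => by
    have := P₁.sub_mem (P₁.mul_mem_left (C (q' i)) (hr' j)) (P₁.mul_mem_left (C (q' j)) (hr' i))
    convert this using 1
    simp only [map_sub, map_mul, rename_C]; ring
  have hhom : ∀ (p : Fin n → ℂ) i j, (C (p i) * H j - C (p j) * H i).IsHomogeneous d :=
    fun p i j => ((h.hom j).C_mul _).sub ((h.hom i).C_mul _)
  have hnot : ∀ (e : Fin n → Fin n ⊕ Fin n) (p : Fin n → ℂ) (i : Fin n), p i ≠ 0 →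
      rename e (H i) - C (p i) ∈ P₁ → rename e (H i) ∉ P₁ := fun e p i hp hm hm' => by
    have := P₁.sub_mem hm' hm
    rw [sub_sub_cancel] at this
    exact hP₁.ne_top (Ideal.eq_top_of_isUnit_mem _ this ((isUnit_iff_ne_zero.2 hp).map C))
  -- The three cores are for the degree in the left variables, in the right variables, and in all of
  -- them. Each of the first two is strictly smaller, because `H i₀ - C (q i₀)` and `H j₀ - C (q'
  -- j₀)` cannot lie in a homogeneous proper ideal; this gains two dimensions. The last one provides
  -- the grading needed for the linear section.
  obtain ⟨P₂, hP₂, hP₂₁, hmem₂, hcomp₂⟩ := exists_homogeneous_prime_le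
    (Sum.elim 1 0 : Fin n ⊕ Fin n → ℕ) P₁
  obtain ⟨P₃, hP₃, hP₃₂, hmem₃, hcomp₃⟩ := exists_homogeneous_prime_le
    (Sum.elim 0 1 : Fin n ⊕ Fin n → ℕ) P₂
  obtain ⟨P₄, hP₄, hP₄₃, hmem₄, hcomp₄⟩ := exists_homogeneous_prime_le
    (1 : Fin n ⊕ Fin n → ℕ) P₃
  have hl₁ : ∀ {p : MvPolynomial (Fin n) ℂ} {k : ℕ}, p.IsHomogeneous k →
      IsWeightedHomogeneous (Sum.elim 1 0 : Fin n ⊕ Fin n → ℕ) (rename Sum.inl p) k :=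
    fun hp => isWeightedHomogeneous_rename hp
  have hr₁ : ∀ p : MvPolynomial (Fin n) ℂ,
      IsWeightedHomogeneous (Sum.elim 1 0 : Fin n ⊕ Fin n → ℕ) (rename Sum.inr p) 0 :=
    fun p => isWeightedHomogeneous_rename (isWeightedHomogeneous_zero_weight p)
  have hr₂ : ∀ {p : MvPolynomial (Fin n) ℂ} {k : ℕ}, p.IsHomogeneous k →
      IsWeightedHomogeneous (Sum.elim 0 1 : Fin n ⊕ Fin n → ℕ) (rename Sum.inr p) k :=
    fun hp => isWeightedHomogeneous_rename hp
  have hl₂ : ∀ p : MvPolynomial (Fin n) ℂ,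
      IsWeightedHomogeneous (Sum.elim 0 1 : Fin n ⊕ Fin n → ℕ) (rename Sum.inl p) 0 :=
    fun p => isWeightedHomogeneous_rename (isWeightedHomogeneous_zero_weight p)
  have hlt₂ : P₂ < P₁ := lt_of_le_of_ne hP₂₁ fun he =>
    sub_C_notMem_of_homogeneous hcomp₂ (hl₁ (h.hom i₀)) h.pos hi₀ (he ▸ hl i₀)
  have hr'₂ : rename Sum.inr (H j₀) - C (q' j₀) ∈ P₂ := by
    have := hmem₂ (rename Sum.inr (H j₀ - C (q' j₀)))
      (by rw [map_sub, rename_C]; exact hr' j₀) 0 (hr₁ _)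
    rwa [map_sub, rename_C] at this
  have hlt₃ : P₃ < P₂ := lt_of_le_of_ne hP₃₂ fun he =>
    sub_C_notMem_of_homogeneous hcomp₃ (hr₂ (h.hom j₀)) h.pos hj₀ (he ▸ hr'₂)
  have hQ₄ : ∀ i j, rename Sum.inl (C (q i) * H j - C (q j) * H i) ∈ P₄ := fun i j =>
    hmem₄ _ (hmem₃ _ (hmem₂ _ (hQ i j) d (hl₁ (hhom q i j))) 0 (hl₂ _)) d
      ((hhom q i j).rename_isHomogeneous)
  have hQ'₄ : ∀ i j, rename Sum.inr (C (q' i) * H j - C (q' j) * H i) ∈ P₄ := fun i j =>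
    hmem₄ _ (hmem₃ _ (hmem₂ _ (hQ' i j) 0 (hr₁ _)) d (hr₂ (hhom q' i j))) d
      ((hhom q' i j).rename_isHomogeneous)
  have hle : P₄ ≤ P₁ := hP₄₃.trans (hP₃₂.trans hP₂₁)
  have hi₀' : rename Sum.inl (H i₀) ∉ P₄ := fun hm => hnot _ q _ hi₀ (hl i₀) (hle hm)
  have hj₀' : rename Sum.inr (H j₀) ∉ P₄ := fun hm => hnot _ q' _ hj₀ (hr' j₀) (hle hm)
  have hdim₄ : ((n + 1 : ℕ) : WithBot ℕ∞) ≤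
      ringKrullDim (MvPolynomial (Fin n ⊕ Fin n) ℂ ⧸ P₄) := by
    have h3 := ringKrullDim_quotient_succ_le hlt₃ (ringKrullDim_quotient_succ_le hlt₂ hdim)
    refine le_trans ?_ (h3.trans (ringKrullDim_le_of_surjective (Ideal.Quotient.factor hP₄₃)
      (Ideal.Quotient.factor_surjective hP₄₃)))
    exact_mod_cast (by omega : n + 1 ≤ 2 * n - 2 * rkJ H + 1 + 1)
  -- The diagonal is cut out by `n` linear forms, and the cone has dimension at least `n + 1`.
  obtain ⟨c, hc0, hc⟩ : ∃ c : Fin n → ℂ, c ≠ 0 ∧ Sum.elim c c ∈ zeroLocus ℂ P₄ := by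
    by_contra hcon
    push Not at hcon
    have := ringKrullDim_quotient_le_of_zeroLocus_subset hcomp₄
      (l := fun i : Fin n => X (Sum.inl i) - X (Sum.inr i))
      (fun i => (isHomogeneous_X _ _).sub (isHomogeneous_X _ _)) (by
        intro c hc hlc
        have he : c = Sum.elim (c ∘ Sum.inl) (c ∘ Sum.inl) := by
          ext (i | i)
          · rfl
          · have := hlc i
            simp only [map_sub, eval_X, sub_eq_zero] at this
            exact this.symm
        have h0 : c ∘ Sum.inl = 0 := by
          by_contra hne
          exact hcon _ hne (he ▸ hc)
        rw [he, h0]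
        ext (i | i) <;> rfl)
    have := hdim₄.trans this
    rw [Fintype.card_fin] at this
    have : n + 1 ≤ n := by exact_mod_cast this
    omega
  have e1 := fun t : ℂ => toFun_add_smul_of_mem_zeroLocus h.qt Sum.inl hQ₄ hi₀' hi₀ hc t
  have e2 := fun t : ℂ => toFun_add_smul_of_mem_zeroLocus h.qt Sum.inr hQ'₄ hj₀' hj₀ hc t
  simp only [Sum.elim_comp_inl, Sum.elim_comp_inr] at e1 e2
  have hprop : ∀ i, q i₀ * toFun H c i = q i * toFun H c i₀ := fun i => by
    have := hc _ (hQ₄ i₀ i)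
    rw [aeval_eq_eval, eval_rename, Sum.elim_comp_inl] at this
    simpa [sub_eq_zero, toFun] using this
  have hprop' : ∀ i, q' j₀ * toFun H c i = q' i * toFun H c j₀ := fun i => by
    have := hc _ (hQ'₄ j₀ i)
    rw [aeval_eq_eval, eval_rename, Sum.elim_comp_inr] at this
    simpa [sub_eq_zero, toFun] using this
  -- The value at `c` is a multiple of both `q` and `q'`, which are independent.
  have hHc : toFun H c = 0 := by
    have h5 : toFun H c = (toFun H c i₀ / q i₀) • q := by
      ext i
      have := hprop i
      have hi₀ : q i₀ ≠ 0 := hi₀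
      simp only [Pi.smul_apply, smul_eq_mul]
      field_simp
      linear_combination this
    have h6 : toFun H c = (toFun H c j₀ / q' j₀) • q' := by
      ext i
      have := hprop' i
      have hj₀ : q' j₀ ≠ 0 := hj₀
      simp only [Pi.smul_apply, smul_eq_mul]
      field_simp
      linear_combination this
    have h7 := LinearIndependent.pair_iff.1 hli (toFun H c i₀ / q i₀) (-(toFun H c j₀ / q' j₀))
      (by rw [neg_smul, ← h5, ← h6, add_neg_cancel])
    rw [h5, h7.1, zero_smul]
  refine ⟨c, hc0, fun s => ?_, fun s => ?_⟩
  · refine (h.joined_of_line fun t => ?_).symm.line s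
    rw [IsHQT.mem_V_iff, e1, hHc]
  · refine (h.joined_of_line fun t => ?_).symm.line s
    rw [IsHQT.mem_V_iff, e2, hHc]

/-- When the rank is at most half of `n + 1`, any two points of the image closure have a common
partner. -/
theorem exists_joined_pair (h : IsHQT H d) (hr : 2 * rkJ H ≤ n + 1)
    (hW : ∃ w ∈ imageClosure H, w ≠ 0) {q q' : Fin n → ℂ} (hq : q ∈ imageClosure H)
    (hq' : q' ∈ imageClosure H) : ∃ c : Fin n → ℂ, c ≠ 0 ∧ Joined H c q ∧ Joined H c q' := by
  have key : ∀ x x', ∃ c : Fin n → ℂ, c ≠ 0 ∧ (∀ s : ℂ, toFun H x + s • c ∈ V H) ∧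
      ∀ s : ℂ, toFun H x' + s • c ∈ V H := by
    intro x x'
    by_cases hli : LinearIndependent ℂ ![toFun H x, toFun H x']
    · exact exists_line_pair_of_linearIndependent h hr hli
    by_cases h0 : toFun H x = 0
    · by_cases h0' : toFun H x' = 0
      · obtain ⟨w, hw, hw0⟩ := hW
        refine ⟨w, hw0, fun s => ?_, fun s => ?_⟩
        · rw [h0, zero_add]; exact h.smul_mem_V s (h.imageClosure_subset_V hw)
        · rw [h0', zero_add]; exact h.smul_mem_V s (h.imageClosure_subset_V hw)
      · refine ⟨toFun H x', h0', fun s => ?_, fun s => ?_⟩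
        · rw [h0, zero_add]; exact h.smul_mem_V s (h.toFun_mem_V x')
        · have := h.smul_mem_V (1 + s) (h.toFun_mem_V x')
          rwa [add_smul, one_smul] at this
    · rw [LinearIndependent.pair_iff' h0] at hli
      push Not at hli
      obtain ⟨b, hb⟩ := hli
      refine ⟨toFun H x, h0, fun s => ?_, fun s => ?_⟩
      · have := h.smul_mem_V (1 + s) (h.toFun_mem_V x)
        rwa [add_smul, one_smul] at this
      · rw [← hb, ← add_smul]
        exact h.smul_mem_V _ (h.toFun_mem_V x)
  obtain ⟨D, F, hF, hFV⟩ := exists_forms_line H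
  have hline : ∀ p : Fin n → ℂ, ∀ c, (∀ k, eval c (map (eval p) (F k)) = 0) ↔
      ∀ s : ℂ, p + s • c ∈ V H := fun p c => hFV c p
  -- The closure is reached one argument at a time; the condition for the other point is carried
  -- along as the system `l`.
  have step : ∀ x, ∃ c : Fin n → ℂ, c ≠ 0 ∧ (∀ s : ℂ, toFun H x + s • c ∈ V H) ∧
      ∀ s : ℂ, q + s • c ∈ V H := by
    intro x
    obtain ⟨c, hc, h1, h2⟩ := exists_line_of_mem_imageClosure
      (l := fun k => map (eval (toFun H x)) (F k)) (fun k => (hF k).map _)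
      (fun x' => by
        obtain ⟨c, hc, h1, h2⟩ := key x x'
        exact ⟨c, hc, (hline _ c).2 h1, h2⟩) hq
    exact ⟨c, hc, (hline _ c).1 h1, h2⟩
  obtain ⟨c, hc, h1, h2⟩ := exists_line_of_mem_imageClosure
    (l := fun k => map (eval q) (F k)) (fun k => (hF k).map _)
    (fun x => by
      obtain ⟨c, hc, h1, h2⟩ := step x
      exact ⟨c, hc, (hline _ c).2 h2, h1⟩) hq'
  exact ⟨c, hc, h.joined_of_line ((hline _ c).1 h1), h.joined_of_line h2⟩

end CommonPartner

end

/-! ### Linear subspaces: ideals, dimension, comparison with the image closure. -/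

section

open PolyMap

variable {n : ℕ}

section LinearSubspaces

/-- The linear form in `ℂ[x]` given by a linear functional on `ℂⁿ`. -/
def linForm (f : Module.Dual ℂ (Fin n → ℂ)) : MvPolynomial (Fin n) ℂ :=
  ∑ i, C (f (Pi.single i 1)) * X i

theorem eval_linForm (f : Module.Dual ℂ (Fin n → ℂ)) (x : Fin n → ℂ) :
    eval x (linForm f) = f x := by
  conv_rhs => rw [pi_eq_sum_univ' x]
  simp [linForm, map_sum, mul_comm]

theorem linForm_isHomogeneous (f : Module.Dual ℂ (Fin n → ℂ)) : (linForm f).IsHomogeneous 1 :=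
  IsHomogeneous.sum _ _ _ fun i _ => (isHomogeneous_X _ i).C_mul _

variable {k : ℕ}

/-- Restriction of polynomials along a linear parametrization `b`. -/
def paramRestrict (b : Fin k → Fin n → ℂ) : MvPolynomial (Fin n) ℂ →ₐ[ℂ] MvPolynomial (Fin k) ℂ :=
  aeval fun i => ∑ j, C (b j i) * X j

theorem eval_paramRestrict (b : Fin k → Fin n → ℂ) (y : Fin k → ℂ) (p : MvPolynomial (Fin n) ℂ) :
    eval y (paramRestrict b p) = eval (∑ j, y j • b j) p := by
  induction p using MvPolynomial.induction_on with
  | C c => simp [paramRestrict]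
  | add p q hp hq => simp [hp, hq]
  | mul_X p i hp => simp [hp]; simp [paramRestrict, mul_comm]

variable (L : Submodule ℂ (Fin n → ℂ))

/-- A basis identifies the coordinate ring of `L` with a polynomial ring, which yields both
primality and dimension. -/
theorem exists_paramRestrict :
    ∃ b : Fin (Module.finrank ℂ L) → Fin n → ℂ, Function.Surjective (paramRestrict b) ∧
      RingHom.ker (paramRestrict b) = vanishingIdeal ℂ (L : Set (Fin n → ℂ)) := by
  let B := Module.finBasis ℂ L
  refine ⟨fun j => B j, fun p => ?_, ?_⟩
  · choose g hg using fun j => LinearMap.exists_extend (B.coord j)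
    refine ⟨aeval (fun j => linForm (g j)) p, ?_⟩
    have : (paramRestrict fun j => (B j : Fin n → ℂ)).comp (aeval fun j => linForm (g j)) =
        AlgHom.id ℂ _ := by
      ext1 j
      refine MvPolynomial.funext fun y => ?_
      simp only [AlgHom.comp_apply, aeval_X, eval_paramRestrict, eval_linForm, AlgHom.id_apply,
        eval_X]
      have h1 : ∀ v : L, g j v = B.coord j v := fun v => LinearMap.congr_fun (hg j) v
      rw [map_sum, Finset.sum_eq_single j]
      · rw [map_smul, h1]; simp
      · intro m _ hm
        rw [map_smul, h1]; simp [hm]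
      · simp
    exact DFunLike.congr_fun this p
  · ext p
    rw [RingHom.mem_ker, mem_vanishingIdeal_iff]
    constructor
    · intro h x hx
      have h1 := B.sum_repr ⟨x, hx⟩
      have h2 : ∑ j, B.repr ⟨x, hx⟩ j • (B j : Fin n → ℂ) = x := by
        have h2 := congrArg L.subtype h1
        rw [map_sum] at h2
        exact h2
      rw [aeval_eq_eval, ← h2, ← eval_paramRestrict (fun j => (B j : Fin n → ℂ)), h, map_zero]
    · intro h
      refine MvPolynomial.funext fun y => ?_
      rw [eval_paramRestrict, map_zero]
      have := h (∑ j, y j • (B j : Fin n → ℂ))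
        (L.sum_mem fun j _ => L.smul_mem _ (B j).2)
      rwa [aeval_eq_eval] at this

instance isPrime_vanishingIdeal_submodule :
    (vanishingIdeal ℂ (L : Set (Fin n → ℂ))).IsPrime := by
  obtain ⟨b, -, hb⟩ := exists_paramRestrict L
  rw [← hb]; exact RingHom.ker_isPrime _

theorem algDim_submodule :
    algDim (L : Set (Fin n → ℂ)) = ((Module.finrank ℂ L : ℕ) : WithBot ℕ∞) := by
  obtain ⟨b, hs, hb⟩ := exists_paramRestrict L
  rw [algDim, ← hb, ringKrullDim_eq_of_ringEquiv
    (Ideal.quotientKerAlgEquivOfSurjective hs).toRingEquiv, ringKrullDim_mvPolynomial_complex,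
    Nat.card_eq_fintype_card, Fintype.card_fin]
  rfl

variable {L}

theorem exists_linForm_of_notMem {x : Fin n → ℂ} (hx : x ∉ L) :
    ∃ f : Module.Dual ℂ (Fin n → ℂ), f x ≠ 0 ∧ ∀ v ∈ L, f v = 0 := by
  obtain ⟨f, hf, hfL⟩ := Submodule.exists_le_ker_of_notMem hx
  exact ⟨f, hf, fun v hv => hfL hv⟩

theorem linForm_mem_vanishingIdeal {f : Module.Dual ℂ (Fin n → ℂ)} {S : Set (Fin n → ℂ)} :
    linForm f ∈ vanishingIdeal ℂ S ↔ ∀ v ∈ S, f v = 0 := by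
  simp only [mem_vanishingIdeal_iff, aeval_eq_eval, eval_linForm]

theorem mem_of_forall_eval_eq_zero {x : Fin n → ℂ}
    (h : ∀ f ∈ vanishingIdeal ℂ (L : Set (Fin n → ℂ)), eval x f = 0) : x ∈ L := by
  by_contra hx
  obtain ⟨f, hf, hfL⟩ := exists_linForm_of_notMem hx
  exact hf (by rw [← eval_linForm]; exact h _ (linForm_mem_vanishingIdeal.2 hfL))

theorem subset_of_vanishingIdeal_le {S : Set (Fin n → ℂ)}
    (h : vanishingIdeal ℂ (L : Set (Fin n → ℂ)) ≤ vanishingIdeal ℂ S) : S ⊆ L := fun x hx =>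
  mem_of_forall_eval_eq_zero fun f hf => by
    have := h hf x hx
    rwa [aeval_eq_eval] at this

theorem vanishingIdeal_submodule_lt {L' : Submodule ℂ (Fin n → ℂ)} (h : L' < L) :
    vanishingIdeal ℂ (L : Set (Fin n → ℂ)) < vanishingIdeal ℂ (L' : Set (Fin n → ℂ)) :=
  lt_of_le_of_ne (vanishingIdeal_anti_mono h.le) fun he =>
    h.not_ge (subset_of_vanishingIdeal_le (L := L') (S := L) fun f hf => by rwa [he])

theorem vanishingIdeal_span_singleton_lt {p : Fin n → ℂ} (hp : p ≠ 0) :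
    vanishingIdeal ℂ (Submodule.span ℂ {p} : Set (Fin n → ℂ)) <
    vanishingIdeal ℂ {(0 : Fin n → ℂ)} := by
  have := vanishingIdeal_submodule_lt
    (bot_lt_iff_ne_bot.2 (mt Submodule.span_singleton_eq_bot.1 hp))
  rwa [Submodule.bot_coe] at this

end LinearSubspaces

section Dimensions

theorem algDim_mono {S T : Set (Fin n → ℂ)} (h : S ⊆ T) : algDim S ≤ algDim T :=
  ringKrullDim_le_of_surjective (Ideal.Quotient.factor (vanishingIdeal_anti_mono h))
    (Ideal.Quotient.factor_surjective _)

/-- An irreducible closed set has larger dimension than its proper irreducible subsets. -/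
theorem vanishingIdeal_eq_of_algDim_le {S T : Set (Fin n → ℂ)} [(vanishingIdeal ℂ S).IsPrime]
    [(vanishingIdeal ℂ T).IsPrime] (h : S ⊆ T) {k : ℕ} (hT : algDim T ≤ (k : WithBot ℕ∞))
    (hS : (k : WithBot ℕ∞) ≤ algDim S) : vanishingIdeal ℂ S = vanishingIdeal ℂ T := by
  by_contra hne
  have := (ringKrullDim_quotient_succ_le
    (lt_of_le_of_ne (vanishingIdeal_anti_mono h) (Ne.symm hne)) hS).trans hT
  have : k + 1 ≤ k := by exact_mod_cast this
  omega

variable {H : PolyMap n} {L : Submodule ℂ (Fin n → ℂ)}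

theorem rkJ_le_finrank (h : imageClosure H ⊆ L) : rkJ H ≤ Module.finrank ℂ L := by
  have := algDim_mono h
  rw [algDim_imageClosure, algDim_submodule] at this
  exact_mod_cast this

theorem finrank_le_rkJ (h : (L : Set (Fin n → ℂ)) ⊆ imageClosure H) :
    Module.finrank ℂ L ≤ rkJ H := by
  have := algDim_mono h
  rw [algDim_imageClosure, algDim_submodule] at this
  exact_mod_cast this

theorem imageClosure_eq_of_subset (h : (L : Set (Fin n → ℂ)) ⊆ imageClosure H)
    (hr : rkJ H ≤ Module.finrank ℂ L) : (L : Set (Fin n → ℂ)) = imageClosure H := by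
  refine h.antisymm (subset_of_vanishingIdeal_le ?_)
  rw [vanishingIdeal_eq_of_algDim_le h (algDim_imageClosure H).le
    (by rw [algDim_submodule]; exact_mod_cast hr)]

theorem eq_imageClosure_of_subset (h : imageClosure H ⊆ L) (hr : Module.finrank ℂ L ≤ rkJ H) :
    imageClosure H = L := by
  refine h.antisymm fun x hx => mem_imageClosure.2 fun f hf => ?_
  rw [vanishingIdeal_eq_of_algDim_le h (algDim_submodule L).le
    (by rw [algDim_imageClosure]; exact_mod_cast hr)] at hf
  have := hf x hx
  rwa [aeval_eq_eval] at this

theorem imageClosure_subset_submodule (h : ∀ x, toFun H x ∈ L) : imageClosure H ⊆ L :=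
  subset_of_vanishingIdeal_le ((vanishingIdeal_anti_mono (by rintro _ ⟨x, rfl⟩; exact h x)).trans
    (vanishingIdeal_imageClosure H).ge)

/-- A zero-dimensional domain is a field, so the ideal is maximal and the Nullstellensatz provides
the point. -/
theorem exists_imageClosure_subset_singleton (hr : rkJ H = 0) :
    ∃ p : Fin n → ℂ, imageClosure H ⊆ {p} := by
  have h1 := algDim_imageClosure H
  rw [hr, algDim] at h1
  have h2 : Ring.KrullDimLE 0 (MvPolynomial (Fin n) ℂ ⧸ vanishingIdeal ℂ (imageClosure H)) :=
    Ring.krullDimLE_iff.2 h1.le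
  have h3 : (vanishingIdeal ℂ (imageClosure H)).IsMaximal :=
    Ideal.Quotient.maximal_of_isField _ (Ring.KrullDimLE.isField_of_isDomain)
  obtain ⟨p, hp⟩ := (isMaximal_iff_eq_vanishingIdeal_singleton (K := ℂ)).1 h3
  refine ⟨p, fun w hw => ?_⟩
  ext i
  have hi : X i - C (p i) ∈ vanishingIdeal ℂ (imageClosure H) := by
    rw [hp, mem_vanishingIdeal_singleton]; simp
  have := hi w hw
  rw [aeval_eq_eval] at this
  simpa [sub_eq_zero] using this

/-- An image closure of dimension at most one spans at most a line. -/
theorem exists_imageClosure_subset_span (hH : PolyMap.IsHomogeneous H)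
    (hqt : IsQuasiTranslation H) (hr : rkJ H ≤ 1) :
    ∃ p : Fin n → ℂ, imageClosure H ⊆ Submodule.span ℂ {p} := by
  by_cases h0 : rkJ H = 0
  · obtain ⟨p, hp⟩ := exists_imageClosure_subset_singleton h0
    exact ⟨p, hp.trans Submodule.subset_span⟩
  · obtain ⟨d, h⟩ := exists_isHQT hH hqt h0
    by_cases hw : ∃ w ∈ imageClosure H, w ≠ 0
    · obtain ⟨w, hw, hw0⟩ := hw
      refine ⟨w, (imageClosure_eq_of_subset ?_ (by rwa [finrank_span_singleton hw0])).ge⟩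
      intro x hx
      obtain ⟨c, rfl⟩ := Submodule.mem_span_singleton.1 hx
      exact h.smul_mem_imageClosure c hw
    · push Not at hw
      exact ⟨0, fun x hx => by rw [hw x hx]; exact Submodule.zero_mem _⟩

theorem exists_ne_zero_of_rkJ (hr : rkJ H ≠ 0) : ∃ w ∈ imageClosure H, w ≠ 0 := by
  by_contra hcon
  push Not at hcon
  have := rkJ_le_finrank (H := H) (L := (⊥ : Submodule ℂ (Fin n → ℂ)))
    fun x hx => by simp [hcon x hx]
  rw [finrank_bot] at this
  omega

end Dimensions

end

/-! ### Removing common factors. -/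

section

open PolyMap

section Factors

variable {σ : Type*}

/-- The grading of a polynomial by degree, as a homomorphism to univariate polynomials. -/
def gradingHom (σ : Type*) : MvPolynomial σ ℂ →ₐ[ℂ] Polynomial (MvPolynomial σ ℂ) :=
  aeval fun i => Polynomial.C (X i) * Polynomial.X

theorem gradingHom_of_isHomogeneous {p : MvPolynomial σ ℂ} {d : ℕ} (hp : p.IsHomogeneous d) :
    gradingHom σ p = Polynomial.C p * Polynomial.X ^ d := by
  conv_lhs => rw [p.as_sum]
  conv_rhs => rw [p.as_sum]
  rw [map_sum, map_sum, Finset.sum_mul]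
  refine Finset.sum_congr rfl fun m hm => ?_
  have hd : m.degree = d := by
    by_contra hne
    exact mem_support_iff.1 hm (hp.coeff_eq_zero hne)
  rw [gradingHom, aeval_monomial, monomial_eq, map_mul]
  simp only [mul_pow, Finsupp.prod, Finset.prod_mul_distrib, Finset.prod_pow_eq_pow_sum, map_prod,
    map_pow]
  rw [← hd, Finsupp.degree_apply, mul_assoc, Polynomial.algebraMap_apply, algebraMap_eq]

theorem coeff_gradingHom (p : MvPolynomial σ ℂ) (k : ℕ) :
    (gradingHom σ p).coeff k = homogeneousComponent k p := by
  conv_lhs => rw [← sum_homogeneousComponent p]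
  rw [map_sum, Polynomial.finsetSum_coeff, Finset.sum_congr rfl fun j _ => by
    rw [gradingHom_of_isHomogeneous (homogeneousComponent_isHomogeneous j p),
      Polynomial.coeff_C_mul_X_pow]]
  rw [Finset.sum_ite_eq]
  split_ifs with h
  · rfl
  · rw [homogeneousComponent_eq_zero _ _ (by simpa using h)]

theorem isHomogeneous_of_homogeneousComponent {p : MvPolynomial σ ℂ} {d : ℕ}
    (h : ∀ k ≠ d, homogeneousComponent k p = 0) : p.IsHomogeneous d := by
  rw [← sum_homogeneousComponent p]
  refine IsHomogeneous.sum _ _ _ fun k _ => ?_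
  by_cases hk : k = d
  · rw [hk]; exact homogeneousComponent_isHomogeneous d p
  · rw [h k hk]; exact isHomogeneous_zero _ _ _

/-- Lowest and highest degrees are both additive. They coincide for the product, hence for each
factor. -/
theorem isHomogeneous_of_mul {f g : MvPolynomial σ ℂ} {d : ℕ} (h : (f * g).IsHomogeneous d)
    (h0 : f * g ≠ 0) : ∃ k l, k + l = d ∧ f.IsHomogeneous k ∧ g.IsHomogeneous l := by
  have hφ : gradingHom σ f * gradingHom σ g = Polynomial.C (f * g) * Polynomial.X ^ d := by
    rw [← map_mul, gradingHom_of_isHomogeneous h]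
  have hne : Polynomial.C (f * g) * Polynomial.X ^ d ≠ 0 :=
    mul_ne_zero (Polynomial.C_ne_zero.2 h0) (pow_ne_zero _ Polynomial.X_ne_zero)
  rw [← hφ] at hne
  have hf := left_ne_zero_of_mul hne
  have hg := right_ne_zero_of_mul hne
  have h1 := congrArg Polynomial.natDegree hφ
  have h2 := congrArg Polynomial.natTrailingDegree hφ
  rw [Polynomial.natDegree_mul hf hg, Polynomial.natDegree_C_mul_X_pow _ _ h0] at h1
  rw [Polynomial.natTrailingDegree_mul hf hg, Polynomial.C_mul_X_pow_eq_monomial,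
    Polynomial.natTrailingDegree_monomial h0] at h2
  have h3 := Polynomial.natTrailingDegree_le_natDegree (gradingHom σ f)
  have h4 := Polynomial.natTrailingDegree_le_natDegree (gradingHom σ g)
  have aux : ∀ p : MvPolynomial σ ℂ,
      (gradingHom σ p).natTrailingDegree = (gradingHom σ p).natDegree →
      p.IsHomogeneous (gradingHom σ p).natDegree := by
    intro p hp
    refine isHomogeneous_of_homogeneousComponent fun k hk => ?_
    rw [← coeff_gradingHom]
    rcases lt_or_gt_of_ne hk with hk | hk
    · exact Polynomial.coeff_eq_zero_of_lt_natTrailingDegree (hp ▸ hk)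
    · exact Polynomial.coeff_eq_zero_of_natDegree_lt hk
  exact ⟨_, _, h1, aux f (by omega), aux g (by omega)⟩

theorem exists_gcd_eq_one {ι : Type*} [Fintype ι] [Nonempty ι] [Finite σ]
    (f : ι → MvPolynomial σ ℂ) : ∃ (g : MvPolynomial σ ℂ) (f' : ι → MvPolynomial σ ℂ),
      (∀ i, f i = g * f' i) ∧ ∀ p, (∀ i, p ∣ f' i) → IsUnit p := by
  classical
  let : StrongNormalizationMonoid (MvPolynomial σ ℂ) :=
    UniqueFactorizationMonoid.strongNormalizationMonoid
  let := UniqueFactorizationMonoid.toNormalizedGCDMonoid (MvPolynomial σ ℂ)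
  obtain ⟨f', hf', h1⟩ := Finset.extract_gcd (s := Finset.univ) f Finset.univ_nonempty
  refine ⟨_, f', fun i => hf' i (Finset.mem_univ i), fun p hp => ?_⟩
  refine isUnit_of_dvd_one ?_
  rw [← h1]
  exact Finset.dvd_gcd fun i _ => hp i

end Factors

variable {n d : ℕ} {H : PolyMap n}

/-- `H` has no common factor: its zero locus has codimension at least two. -/
def IsPrimitive (H : PolyMap n) : Prop :=
  ∀ P : Ideal (MvPolynomial (Fin n) ℂ), P.IsPrime → (∀ i, H i ∈ P) → 2 ≤ P.height

/-- A height-one prime of a factorial ring is principal, and its generator would divide every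
component. -/
theorem isPrimitive_of_forall_dvd (h0 : H ≠ 0) (h : ∀ p, (∀ i, p ∣ H i) → IsUnit p) :
    IsPrimitive H := by
  intro P hP hHP
  by_contra hlt
  have hb : P ≠ ⊥ := by
    rintro rfl
    exact h0 (_root_.funext fun i => hHP i)
  have h1 : P.height = 1 := by
    refine le_antisymm (Order.le_of_lt_add_one (by rw [one_add_one_eq_two]; exact not_le.1 hlt)) ?_
    rwa [Order.one_le_iff_ne_zero, Ne, Ideal.height_eq_zero_iff_eq_bot]
  obtain ⟨p, hp⟩ := UniqueFactorizationMonoid.isPrincipal_of_height_eq_one h1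
  have hu := h p fun i => Ideal.mem_span_singleton.1 (by
    have := hHP i
    rw [hp] at this
    exact this)
  refine hP.ne_top (Ideal.eq_top_of_isUnit_mem _ ?_ hu)
  rw [hp]; exact Submodule.mem_span_singleton_self p

theorem isQuasiTranslation_of_mul (hqt : IsQuasiTranslation H) {g : MvPolynomial (Fin n) ℂ}
    (hg : g ≠ 0) {H' : PolyMap n} (hH' : ∀ i, H i = g * H' i) : IsQuasiTranslation H' := by
  refine isQuasiTranslation_of_toFun fun x t => ?_
  ext i
  have hfun : ∀ x, toFun H x = eval x g • toFun H' x := fun x => by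
    ext i; simp [toFun, hH']
  -- The factor `H i` restricts attention to points where it is nonzero. There `g * H' i` is a
  -- nonzero constant along the line, so both factors are units in one variable, hence constant.
  have key : (bind₁ (fun j => X j + C t * H' j) (H' i) - H' i) * H i = 0 := by
    refine MvPolynomial.funext fun x => ?_
    rw [map_mul, map_sub, eval_bind, map_zero]
    have hx : toFun (fun j => X j + C t * H' j) x = x + t • toFun H' x := by
      ext j; simp [toFun]
    rw [hx]
    by_cases h0 : eval x (H i) = 0
    · rw [h0, mul_zero]
    · have h1 : lineRestrict x (toFun H x) g * lineRestrict x (toFun H x) (H' i) =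
          Polynomial.C (eval x (H i)) := by
        refine Polynomial.funext fun s => ?_
        rw [Polynomial.eval_mul, eval_lineRestrict, eval_lineRestrict, ← map_mul, ← hH',
          Polynomial.eval_C]
        exact congrFun (toFun_add_smul hqt x s) i
      have h2 : IsUnit (lineRestrict x (toFun H x) (H' i)) := by
        refine isUnit_of_mul_isUnit_right (x := lineRestrict x (toFun H x) g) ?_
        rw [h1]; exact (isUnit_iff_ne_zero.2 h0).map Polynomial.C
      obtain ⟨c, -, hc⟩ := Polynomial.isUnit_iff.1 h2
      have h3 : ∀ s : ℂ, eval (x + s • toFun H x) (H' i) = c := fun s => by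
        rw [← eval_lineRestrict, ← hc, Polynomial.eval_C]
      have hgx : eval x g ≠ 0 := fun hz => h0 (by rw [hH', map_mul, hz, zero_mul])
      have h4 := h3 (t / eval x g)
      rw [hfun, smul_smul, div_mul_cancel₀ _ hgx] at h4
      have h5 := h3 0
      rw [zero_smul, add_zero] at h5
      rw [h4, h5, sub_self, zero_mul]
  rcases mul_eq_zero.1 key with h | h
  · have := congrArg (eval x) h
    rw [map_sub, eval_bind, map_zero, sub_eq_zero] at this
    have hx : toFun (fun j => X j + C t * H' j) x = x + t • toFun H' x := by
      ext j; simp [toFun]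
    rw [hx] at this
    exact this
  · have : H' i = 0 := (mul_eq_zero.1 ((hH' i).symm.trans h)).resolve_left hg
    simp [toFun, this]

/-- Removing the common factor of a homogeneous quasi-translation of rank at least two. -/
theorem IsHQT.exists_isPrimitive (h : IsHQT H d) (hr : 2 ≤ rkJ H) :
    ∃ (H' : PolyMap n) (d' : ℕ), IsHQT H' d' ∧ imageClosure H' = imageClosure H ∧
      V H' ⊆ V H ∧ IsPrimitive H' := by
  have hH0 : ∃ i, H i ≠ 0 := by
    obtain ⟨w, hw, hw0⟩ := exists_ne_zero_of_rkJ (H := H) (by omega)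
    by_contra hcon
    push Not at hcon
    have := imageClosure_subset_submodule (H := H) (L := ⊥) (fun x => by
      rw [Submodule.mem_bot]; ext i; simp [toFun, hcon i]) hw
    exact hw0 (by simpa using this)
  obtain ⟨i₀, hi₀⟩ := hH0
  have : Nonempty (Fin n) := ⟨i₀⟩
  obtain ⟨g, H', hH', hdvd⟩ := exists_gcd_eq_one H
  have hg : g ≠ 0 := by rintro rfl; exact hi₀ (by rw [hH', zero_mul])
  have hfun : ∀ x, toFun H x = eval x g • toFun H' x := fun x => by
    ext i; simp [toFun, hH']
  obtain ⟨k, l, hkl, hgk, -⟩ := isHomogeneous_of_mul (hH' i₀ ▸ h.hom i₀) (hH' i₀ ▸ hi₀)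
  have hom' : ∀ i, (H' i).IsHomogeneous l := by
    intro i
    by_cases h0 : H' i = 0
    · rw [h0]; exact isHomogeneous_zero _ _ _
    · have hm := mul_ne_zero hg h0
      obtain ⟨k', l', hkl', hgk', hl'⟩ := isHomogeneous_of_mul (hH' i ▸ h.hom i) hm
      have : k' = k := hgk'.inj_right hgk hg
      have : l' = l := by omega
      rwa [← this]
  have hqt' := isQuasiTranslation_of_mul h.qt hg hH'
  -- If `H'` were constant, the image of `H` would lie on a line, against the rank.
  have hl : 0 < l := by
    by_contra hl0
    obtain rfl : l = 0 := by omega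
    have := rkJ_le_finrank (H := H) (L := Submodule.span ℂ {toFun H' 0})
      (imageClosure_subset_submodule fun x => by
        rw [hfun]
        refine Submodule.smul_mem _ _ (Submodule.mem_span_singleton.2 ⟨1, ?_⟩)
        ext i
        have h1 := (totalDegree_zero_iff_isHomogeneous _).2 (hom' i)
        rw [totalDegree_eq_zero_iff_eq_C] at h1
        simp only [toFun, Pi.smul_apply, one_smul]
        rw [h1, eval_C, eval_C])
    have h2 := finrank_span_le_card (R := ℂ) ({toFun H' 0} : Set (Fin n → ℂ))
    simp at h2
    omega
  have h' : IsHQT H' l := ⟨hom', hl, hqt'⟩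
  refine ⟨H', l, h', ?_, fun x hx i => by rw [hH', map_mul, hx i, mul_zero],
    isPrimitive_of_forall_dvd ?_ hdvd⟩
  · have hI : vanishingIdeal ℂ (imageClosure H') = vanishingIdeal ℂ (imageClosure H) := by
      ext f
      constructor
      · intro hf
        rw [mem_vanishingIdeal_imageClosure]
        intro x
        rw [hfun]
        exact mem_imageClosure.1
          (h'.smul_mem_imageClosure _ (toFun_mem_imageClosure H' x)) f hf
      · intro hf
        rw [mem_vanishingIdeal_imageClosure]
        have : bind₁ H' f * g = 0 := by
          refine MvPolynomial.funext fun x => ?_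
          rw [map_mul, eval_bind, map_zero]
          by_cases h0 : eval x g = 0
          · rw [h0, mul_zero]
          · have h1 : toFun H' x = (eval x g)⁻¹ • toFun H x := by
              rw [hfun, inv_smul_smul₀ h0]
            rw [h1, mem_imageClosure.1 (h.smul_mem_imageClosure _
              (toFun_mem_imageClosure H x)) f hf, zero_mul]
        intro x
        rw [← eval_bind, (mul_eq_zero.1 this).resolve_right hg, map_zero]
    ext w
    rw [mem_imageClosure, mem_imageClosure, hI]
  · rintro rfl
    exact hi₀ (by rw [hH']; simp)

theorem rkJ_eq_of_imageClosure_eq {H' : PolyMap n} (h : imageClosure H' = imageClosure H) :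
    rkJ H' = rkJ H := by
  have h1 := algDim_imageClosure H'
  rw [h, algDim_imageClosure] at h1
  exact_mod_cast h1.symm

end

/-! ### Rank two. -/

section

open PolyMap

variable {n d : ℕ} {H : PolyMap n}

theorem mem_of_forall_zeroLocus {σ : Type*} [Finite σ] {P : Ideal (MvPolynomial σ ℂ)}
    [P.IsPrime] {f : MvPolynomial σ ℂ} (h : ∀ x ∈ zeroLocus ℂ P, eval x f = 0) : f ∈ P := by
  rw [← IsPrime.vanishingIdeal_zeroLocus (K := ℂ) P, mem_vanishingIdeal_iff]
  intro x hx
  rw [aeval_eq_eval]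
  exact h x hx

theorem eval_eq_zero_of_mem_zeroLocus {σ : Type*} {P : Ideal (MvPolynomial σ ℂ)}
    {f : MvPolynomial σ ℂ} (hf : f ∈ P) {x : σ → ℂ} (hx : x ∈ zeroLocus ℂ P) : eval x f = 0 := by
  have := hx f hf
  rwa [aeval_eq_eval] at this

theorem exists_mem_zeroLocus_eval_ne_zero {σ : Type*} [Finite σ] {P : Ideal (MvPolynomial σ ℂ)}
    [P.IsPrime] {f : MvPolynomial σ ℂ} (h : f ∉ P) : ∃ x ∈ zeroLocus ℂ P, eval x f ≠ 0 := by
  by_contra hcon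
  push Not at hcon
  exact h (mem_of_forall_zeroLocus hcon)

/-- A minimal prime of `(H)` all of whose translates by multiples of `q` vanish in `V(H)` is
stable under translation by `q`. -/
theorem add_smul_mem_zeroLocus_of_minimalPrimes {P : Ideal (MvPolynomial (Fin n) ℂ)}
    (hP : P ∈ (Ideal.span (Set.range H)).minimalPrimes) {q : Fin n → ℂ}
    (hq : ∀ x ∈ zeroLocus ℂ P, ∀ t : ℂ, x + t • q ∈ V H) {x : Fin n → ℂ}
    (hx : x ∈ zeroLocus ℂ P) (t : ℂ) : x + t • q ∈ zeroLocus ℂ P := by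
  have hPp := hP.isPrime
  -- `J` is the ideal of the union of all translates of the zero set of `P`. It is prime, contains
  -- `H` and lies below `P`, so minimality gives `J = P`.
  let J : Ideal (MvPolynomial (Fin n) ℂ) := ⨅ t : ℂ, P.comap (translate (t • q))
  have hmemJ : ∀ f, f ∈ J ↔ ∀ t : ℂ, translate (t • q) f ∈ P := fun f => by
    simp [J]
  have hJP : J ≤ P := fun f hf => by
    have h0 := (hmemJ f).1 hf 0
    refine mem_of_forall_zeroLocus fun y hy => ?_
    have := eval_eq_zero_of_mem_zeroLocus h0 hy
    rwa [eval_translate, zero_smul, add_zero] at this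
  have hJ : J.IsPrime := by
    refine Ideal.isPrime_iff.2 ⟨fun htop => hPp.ne_top (top_le_iff.1 (htop ▸ hJP)), ?_⟩
    intro u v huv
    by_contra hcon
    push Not at hcon
    rw [hmemJ, hmemJ] at hcon
    push Not at hcon
    obtain ⟨⟨t₁, h₁⟩, ⟨t₂, h₂⟩⟩ := hcon
    obtain ⟨y₁, hy₁, hu⟩ := exists_mem_zeroLocus_eval_ne_zero h₁
    obtain ⟨y₂, hy₂, hv⟩ := exists_mem_zeroLocus_eval_ne_zero h₂
    rw [eval_translate] at hu hv
    -- One parameter must serve both functions: two nonzero polynomials in one variable have a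
    -- common non-root.
    have : ∃ t : ℂ, eval (y₁ + t • q) u ≠ 0 ∧ eval (y₂ + t • q) v ≠ 0 := by
      have hne : lineRestrict y₁ q u * lineRestrict y₂ q v ≠ 0 := by
        refine mul_ne_zero (fun h0 => hu ?_) (fun h0 => hv ?_)
        · rw [← eval_lineRestrict, h0, Polynomial.eval_zero]
        · rw [← eval_lineRestrict, h0, Polynomial.eval_zero]
      by_contra hall
      push Not at hall
      refine hne (Polynomial.funext fun t => ?_)
      rw [Polynomial.eval_mul, eval_lineRestrict, eval_lineRestrict, Polynomial.eval_zero,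
        mul_eq_zero]
      by_cases h0 : eval (y₁ + t • q) u = 0
      · exact Or.inl h0
      · exact Or.inr (hall t h0)
    obtain ⟨s, hs₁, hs₂⟩ := this
    have := (hmemJ _).1 huv s
    rw [map_mul] at this
    rcases hPp.mem_or_mem this with h | h
    · exact hs₁ (by rw [← eval_translate]; exact eval_eq_zero_of_mem_zeroLocus h hy₁)
    · exact hs₂ (by rw [← eval_translate]; exact eval_eq_zero_of_mem_zeroLocus h hy₂)
  have hHJ : Ideal.span (Set.range H) ≤ J := by
    rw [Ideal.span_le]
    rintro _ ⟨i, rfl⟩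
    refine (hmemJ _).2 fun t => mem_of_forall_zeroLocus fun y hy => ?_
    rw [eval_translate]
    exact hq y hy t i
  have hPJ : P ≤ J := hP.2 ⟨hJ, hHJ⟩ hJP
  intro f hf
  rw [aeval_eq_eval, ← eval_translate]
  exact eval_eq_zero_of_mem_zeroLocus ((hmemJ f).1 (hPJ hf) t) hx

/-- A fibre prime over `toFun H a` has height at most two, so its cone has height at most one and is
principal. Cutting the cone with `H i₀ = 0` gives a prime `Q` through the origin of height at most
two. It contains all of `H`, since `H` is proportional to `toFun H a` on the cone, and primitivity
makes it minimal over `(H)`. -/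
theorem IsPrimitive.exists_minimalPrime (hp : IsPrimitive H) (h : IsHQT H d) (hr : rkJ H = 2)
    {a : Fin n → ℂ} (ha : toFun H a ≠ 0) :
    ∃ P ∈ (Ideal.span (Set.range H)).minimalPrimes, 0 ∈ zeroLocus ℂ P ∧
      ∀ x ∈ zeroLocus ℂ P, x + toFun H a ∈ V H := by
  obtain ⟨z, -, hz, hint⟩ := exists_noether_normalization H
  obtain ⟨P₁, hP₁, hG, hht⟩ := exists_prime_fibre_height_le hz hint a
  rw [Fintype.card_fin, hr] at hht
  set q := toFun H a with hqd
  obtain ⟨i₀, hi₀⟩ := Function.ne_iff.1 ha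
  replace hi₀ : q i₀ ≠ 0 := hi₀
  obtain ⟨P, hP, hPP₁, hmem, hcomp⟩ := exists_homogeneous_prime_le (1 : Fin n → ℕ) P₁
  have hlt : P < P₁ := lt_of_le_of_ne hPP₁ fun he =>
    sub_C_notMem_of_homogeneous hcomp (h.hom i₀) h.pos hi₀ (he ▸ hG i₀)
  have hht₁ : P.height ≤ 1 := by
    have h1 := (Ideal.height_add_one_le_of_lt_of_isPrime hlt).trans hht
    exact (ENat.add_le_add_iff_right ENat.one_ne_top).1 (h1.trans (by norm_num))
  obtain ⟨p, hp'⟩ : ∃ p, P = Ideal.span {p} := by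
    rcases hht₁.lt_or_eq with h1 | h1
    · refine ⟨0, ?_⟩
      rw [Ideal.span_singleton_zero]
      exact Ideal.height_eq_zero_iff_eq_bot.1 (Order.lt_one_iff.1 h1)
    · obtain ⟨p, hp⟩ := UniqueFactorizationMonoid.isPrincipal_of_height_eq_one h1
      exact ⟨p, hp⟩
  have hQ : ∀ i j, C (q i) * H j - C (q j) * H i ∈ P := fun i j => by
    refine hmem _ ?_ d (((h.hom j).C_mul _).sub ((h.hom i).C_mul _))
    have := P₁.sub_mem (P₁.mul_mem_left (C (q i)) (hG j)) (P₁.mul_mem_left (C (q j)) (hG i))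
    convert this using 1
    simp only [hqd, toFun]; ring
  have hHi : H i₀ ∉ P := fun hm => by
    have := P₁.sub_mem (hPP₁ hm) (hG i₀)
    rw [sub_sub_cancel] at this
    exact hP₁.ne_top (Ideal.eq_top_of_isUnit_mem _ this ((isUnit_iff_ne_zero.2 hi₀).map C))
  have hP0 : P ≤ vanishingIdeal ℂ {0} := fun f hf => by
    rw [mem_vanishingIdeal_singleton]
    by_contra hne
    have h0 := hcomp f hf 0
    have h1 : weightedHomogeneousComponent (1 : Fin n → ℕ) 0 f = C (coeff 0 f) :=
      homogeneousComponent_zero f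
    rw [h1] at h0
    rw [← constantCoeff_eq, ← eval_zero] at h0
    exact hP.ne_top (Ideal.eq_top_of_isUnit_mem _ h0 ((isUnit_iff_ne_zero.2 hne).map C))
  have hle : Ideal.span ({p, H i₀} : Set (MvPolynomial (Fin n) ℂ)) ≤
      vanishingIdeal ℂ {(0 : Fin n → ℂ)} := by
    rw [Ideal.span_insert, ← hp']
    refine sup_le hP0 ?_
    rw [Ideal.span_singleton_le_iff_mem, mem_vanishingIdeal_singleton]
    exact congrFun h.toFun_zero i₀
  obtain ⟨Q, hQmin, hQ0⟩ := Ideal.exists_minimalPrimes_le hle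
  have hQp := hQmin.isPrime
  have hPQ : P ≤ Q := by
    rw [hp', Ideal.span_singleton_le_iff_mem]
    exact hQmin.1.2 (Ideal.subset_span (by simp))
  have hHiQ : H i₀ ∈ Q := hQmin.1.2 (Ideal.subset_span (by simp))
  have hHQ : ∀ j, H j ∈ Q := fun j => by
    have h1 := Q.add_mem (hPQ (hQ i₀ j)) (Q.mul_mem_left (C (q j)) hHiQ)
    rw [sub_add_cancel] at h1
    refine (hQp.mem_or_mem h1).resolve_left fun h2 => ?_
    exact hQp.ne_top (Ideal.eq_top_of_isUnit_mem _ h2 ((isUnit_iff_ne_zero.2 hi₀).map C))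
  have hQht : Q.height ≤ 2 := by
    refine (Ideal.height_le_card_of_mem_minimalPrimes_span (Set.toFinite _) hQmin).trans ?_
    exact_mod_cast (Set.ncard_insert_le _ _).trans (by rw [Set.ncard_singleton])
  refine ⟨Q, ⟨⟨hQp, ?_⟩, fun Q' hQ' hQ'Q => ?_⟩, ?_, fun x hx => ?_⟩
  · rw [Ideal.span_le]; rintro _ ⟨j, rfl⟩; exact hHQ j
  · have hQ'p := hQ'.1
    by_contra hne
    have hlt' : Q' < Q := lt_of_le_not_ge hQ'Q hne
    have h1 := hp Q' hQ'p fun i => hQ'.2 (Ideal.subset_span ⟨i, rfl⟩)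
    have h2 := (Ideal.height_add_one_le_of_lt_of_isPrime hlt').trans hQht
    have h3 := (add_le_add_left h1 1).trans h2
    norm_num at h3
  · intro f hf
    rw [aeval_eq_eval]
    exact mem_vanishingIdeal_singleton.1 (hQ0 hf)
  · have := toFun_add_smul_of_mem_zeroLocus h.qt (P := P) id
      (fun i j => by rw [rename_id_apply]; exact hQ i j) (by rw [rename_id_apply]; exact hHi) hi₀
      (zeroLocus_anti_mono hPQ hx) 1
    simp only [Function.comp_id, one_smul] at this
    rw [IsHQT.mem_V_iff, this]
    ext i
    exact eval_eq_zero_of_mem_zeroLocus (hHQ i) hx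

/-- In rank two, the linear span of the image lies in the zero set. -/
theorem IsPrimitive.span_subset_V (hp : IsPrimitive H) (h : IsHQT H d) (hr : rkJ H = 2) :
    (Submodule.span ℂ (imageClosure H) : Set (Fin n → ℂ)) ⊆ V H := by
  let M := {P ∈ (Ideal.span (Set.range H)).minimalPrimes | 0 ∈ zeroLocus ℂ P}
  have hM : M.Finite := (Ideal.finite_minimalPrimes_of_isNoetherianRing _ _).subset
    fun P hP => hP.1
  obtain ⟨a₀, ha₀⟩ : ∃ a, toFun H a ≠ 0 := by
    by_contra hcon
    push Not at hcon
    have := rkJ_le_finrank (imageClosure_subset_submodule (H := H) (L := ⊥) fun x => by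
      rw [hcon x]; exact Submodule.zero_mem _)
    rw [finrank_bot] at this
    omega
  -- There are finitely many candidates and $W$ is irreducible. If each failed for some `q`, all
  -- would fail at a single point of the image, against `IsPrimitive.exists_minimalPrime` (the value
  -- zero being trivial).
  obtain ⟨P, hPM, hPW⟩ : ∃ P ∈ M, ∀ q ∈ imageClosure H, ∀ x ∈ zeroLocus ℂ P, x + q ∈ V H := by
    by_contra hcon
    push Not at hcon
    have hch : ∀ P : Ideal (MvPolynomial (Fin n) ℂ), ∃ (x : Fin n → ℂ) (i : Fin n), P ∈ M →
        x ∈ zeroLocus ℂ P ∧ translate x (H i) ∉ vanishingIdeal ℂ (imageClosure H) := by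
      intro P
      by_cases hP : P ∈ M
      · obtain ⟨q, hq, x, hx, hV⟩ := hcon P hP
        simp only [V, Set.mem_ofPred_eq, not_forall] at hV
        obtain ⟨i, hi⟩ := hV
        refine ⟨x, i, fun _ => ⟨hx, notMem_vanishingIdeal hq ?_⟩⟩
        rwa [eval_translate, add_comm]
      · obtain ⟨i₀, -⟩ := Function.ne_iff.1 ha₀
        exact ⟨0, i₀, fun h => absurd h hP⟩
    choose x i hxi using hch
    obtain ⟨a, ha⟩ := exists_toFun_forall_eval_ne_zero (H := H) hM
      (p := fun P => translate (x P) (H (i P))) fun P hP => (hxi P hP).2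
    have key : ∀ P ∈ M, x P + toFun H a ∉ V H := fun P hP hV => by
      refine ha P hP ?_
      rw [eval_translate, add_comm]
      exact hV (i P)
    by_cases ha0 : toFun H a = 0
    · obtain ⟨P, hP, hP0, -⟩ := hp.exists_minimalPrime h hr ha₀
      refine key P ⟨hP, hP0⟩ ?_
      rw [ha0, add_zero]
      exact fun i => eval_eq_zero_of_mem_zeroLocus (hP.1.2 (Ideal.subset_span ⟨i, rfl⟩))
        (hxi P ⟨hP, hP0⟩).1
    · obtain ⟨P, hP, hP0, hPV⟩ := hp.exists_minimalPrime h hr ha0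
      exact key P ⟨hP, hP0⟩ (hPV _ (hxi P ⟨hP, hP0⟩).1)
  have hstab : ∀ q ∈ imageClosure H, ∀ x ∈ zeroLocus ℂ P, ∀ t : ℂ, x + t • q ∈ zeroLocus ℂ P :=
    fun q hq x hx t => add_smul_mem_zeroLocus_of_minimalPrimes hPM.1
      (fun y hy s => hPW _ (h.smul_mem_imageClosure s hq) y hy) hx t
  intro v hv
  -- Stability under translations passes to linear combinations; applied at the origin it puts the
  -- whole span inside the component.
  have : ∀ x ∈ zeroLocus ℂ P, ∀ t : ℂ, x + t • v ∈ zeroLocus ℂ P := by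
    induction hv using Submodule.span_induction with
    | mem q hq => exact hstab q hq
    | zero => intro x hx t; rwa [smul_zero, add_zero]
    | add u w _ _ hu hw =>
      intro x hx t
      rw [smul_add, ← add_assoc]
      exact hw _ (hu x hx t) t
    | smul c u _ hu =>
      intro x hx t
      rw [smul_smul]
      exact hu x hx _
  have hv' := this 0 hPM.2 1
  rw [one_smul, zero_add] at hv'
  exact fun i => eval_eq_zero_of_mem_zeroLocus (hPM.1.1.2 (Ideal.subset_span ⟨i, rfl⟩)) hv'

theorem IsHQT.span_subset_V (h : IsHQT H d) (hr : rkJ H = 2) :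
    (Submodule.span ℂ (imageClosure H) : Set (Fin n → ℂ)) ⊆ V H := by
  obtain ⟨H', d', h', hW, hV, hp⟩ := h.exists_isPrimitive hr.ge
  rw [← hW]
  exact (hp.span_subset_V h' ((rkJ_eq_of_imageClosure_eq hW).trans hr)).trans hV

end

/-! ### Components of $V(H)$; the implications (1)⇒(2)⇒(3). -/

section

open PolyMap

section Subspaces

variable {E : Type*} [AddCommGroup E] [Module ℂ E]

theorem exists_submodule_finrank_eq [FiniteDimensional ℂ E] {A B : Submodule ℂ E} (hAB : A ≤ B)
    {k : ℕ}     (hA : Module.finrank ℂ A ≤ k) (hB : k ≤ Module.finrank ℂ B) :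
    ∃ C : Submodule ℂ E, A ≤ C ∧ C ≤ B ∧ Module.finrank ℂ C = k := by
  induction k, hA using Nat.le_induction with
  | base => exact ⟨A, le_rfl, hAB, rfl⟩
  | succ k _ ih =>
    obtain ⟨C, hAC, hCB, hC⟩ := ih (by omega)
    have hlt : C < B := lt_of_le_of_ne hCB fun he => by rw [← he] at hB; omega
    obtain ⟨v, hvB, hvC⟩ := SetLike.exists_of_lt hlt
    refine ⟨C ⊔ Submodule.span ℂ {v}, hAC.trans le_sup_left,
      sup_le hCB (by rwa [Submodule.span_singleton_le_iff_mem]), ?_⟩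
    rw [Submodule.finrank_sup_span_singleton hvC, hC]

theorem exists_mem_notMem_span {B : Submodule ℂ E} (hB : 2 ≤ Module.finrank ℂ B) (c : E) :
    ∃ v ∈ B, v ∉ Submodule.span ℂ {c} := by
  by_contra hcon
  push Not at hcon
  have h1 := Submodule.finrank_mono (s := B) (t := Submodule.span ℂ {c}) hcon
  have h2 := finrank_span_le_card (R := ℂ) ({c} : Set E)
  simp at h2
  omega

end Subspaces

variable {n d : ℕ} {H : PolyMap n}

theorem exists_isGNPlane_of_mem {L : Submodule ℂ (Fin n → ℂ)} (hL : 2 ≤ Module.finrank ℂ L)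
    (hV : (L : Set (Fin n → ℂ)) ⊆ V H) {c q : Fin n → ℂ} (hc : c ∈ L) (hq : q ∈ L) :
    ∃ M, IsGNPlane H M ∧ c ∈ M ∧ q ∈ M := by
  have h1 := finrank_span_le_card (R := ℂ) ({c, q} : Set (Fin n → ℂ))
  have h2 : ({c, q} : Set (Fin n → ℂ)).toFinset.card ≤ 2 := by
    rw [Set.toFinset_insert, Set.toFinset_singleton]; exact Finset.card_le_two
  obtain ⟨M, hcM, hML, hM⟩ := exists_submodule_finrank_eq
    (A := Submodule.span ℂ {c, q}) (B := L) (k := 2)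
    (Submodule.span_le.2 (by rintro x (rfl | rfl); exacts [hc, hq])) (h1.trans h2) hL
  exact ⟨M, ⟨hM, fun x hx => hV (hML hx)⟩, hcM (Submodule.subset_span (by simp)),
    hcM (Submodule.subset_span (by simp))⟩

/-- Otherwise any nonzero point of $W$ would share a plane inside `L` with every other point of $W$.
-/
theorem NoCommonPartnerCond.not_subset_V (h3 : NoCommonPartnerCond H) (hr : 2 ≤ rkJ H)
    {L : Submodule ℂ (Fin n → ℂ)} (hW : imageClosure H ⊆ L) : ¬ (L : Set (Fin n → ℂ)) ⊆ V H := by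
  intro hV
  obtain ⟨c, hc, hc0⟩ := exists_ne_zero_of_rkJ (H := H) (by omega)
  exact h3.2 ⟨c, hV (hW hc), hc0, fun q hq =>
    exists_isGNPlane_of_mem (hr.trans (rkJ_le_finrank hW)) hV (hW hc) (hW hq)⟩

section Components

/-- Near a generic point of a component of a closed set, the set agrees with the component. -/
theorem exists_notMem_of_minimalPrimes {S : Set (Fin n → ℂ)} {P : Ideal (MvPolynomial (Fin n) ℂ)}
    (hP : P ∈ (vanishingIdeal ℂ S).minimalPrimes) :
    ∃ f ∉ P, ∀ x ∈ S, eval x f ≠ 0 → x ∈ zeroLocus ℂ P := by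
  classical
  have hPp := hP.isPrime
  have hfin := Ideal.finite_minimalPrimes_of_isNoetherianRing (MvPolynomial (Fin n) ℂ)
    (vanishingIdeal ℂ S)
  let s := hfin.toFinset.erase P
  have hnot : ¬ s.inf id ≤ P := fun hle => by
    obtain ⟨Q, hQs, hQP⟩ := (Ideal.IsPrime.inf_le' hPp).1 hle
    have hQ := (hfin.mem_toFinset).1 (Finset.mem_of_mem_erase hQs)
    exact Finset.ne_of_mem_erase hQs (le_antisymm hQP (hP.2 hQ.1 hQP))
  obtain ⟨f, hf, hfP⟩ := SetLike.not_le_iff_exists.1 hnot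
  refine ⟨f, hfP, fun x hx hfx g hg => ?_⟩
  have hrad : f * g ∈ (vanishingIdeal ℂ S).radical := by
    rw [← Ideal.sInf_minimalPrimes, Ideal.mem_sInf]
    intro Q hQ
    by_cases hQP : Q = P
    · exact hQP ▸ P.mul_mem_left f hg
    · exact Q.mul_mem_right g ((Finset.inf_le (f := id)
        (Finset.mem_erase.2 ⟨hQP, hfin.mem_toFinset.2 hQ⟩)) hf)
  obtain ⟨m, hm⟩ := hrad
  have := hm x hx
  rw [aeval_eq_eval, map_pow, map_mul] at this
  rw [aeval_eq_eval]
  exact (mul_eq_zero.1 (eq_zero_of_pow_eq_zero this)).resolve_left hfx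

theorem mem_minimalPrimes_of_forall_lt {I P : Ideal (MvPolynomial (Fin n) ℂ)} [hP : P.IsPrime]
    (hI : I ≤ P) (h : ∀ Q : Ideal (MvPolynomial (Fin n) ℂ), Q.IsPrime → I ≤ Q → ¬ Q < P) :
    P ∈ I.minimalPrimes :=
  ⟨⟨hP, hI⟩, fun Q hQ hQP => by
    by_contra hne
    exact h Q hQ.1 hQ.2 (lt_of_le_not_ge hQP hne)⟩

theorem mem_imageClosure_iff_zeroLocus {w : Fin n → ℂ} :
    w ∈ imageClosure H ↔ w ∈ zeroLocus ℂ (vanishingIdeal ℂ (imageClosure H)) := by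
  rw [mem_imageClosure, mem_zeroLocus_iff]
  simp only [aeval_eq_eval]

/-- If `V(H)` has the dimension of the image closure, then they agree near a generic point. -/
theorem exists_eval_ne_zero_imp_mem (h : IsHQT H d)
    (hdim : algDim (V H) = (rkJ H : WithBot ℕ∞)) :
    ∃ f ∉ vanishingIdeal ℂ (imageClosure H), ∀ x ∈ V H, eval x f ≠ 0 → x ∈ imageClosure H := by
  have hmin : vanishingIdeal ℂ (imageClosure H) ∈ (vanishingIdeal ℂ (V H)).minimalPrimes := by
    refine mem_minimalPrimes_of_forall_lt (vanishingIdeal_anti_mono h.imageClosure_subset_V)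
      fun Q hQ hVQ hlt => ?_
    have h1 := ringKrullDim_quotient_succ_le hlt (algDim_imageClosure H).ge
    have h2 := h1.trans ((ringKrullDim_le_of_surjective (Ideal.Quotient.factor hVQ)
      (Ideal.Quotient.factor_surjective hVQ)).trans hdim.le)
    have : rkJ H + 1 ≤ rkJ H := by exact_mod_cast h2
    omega
  obtain ⟨f, hf, hfV⟩ := exists_notMem_of_minimalPrimes hmin
  exact ⟨f, hf, fun x hx hfx => mem_imageClosure_iff_zeroLocus.2 (hfV x hx hfx)⟩

/-- `L` is irreducible, so a nonempty open part of it inside the closed set $W$ suffices. -/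
theorem subset_imageClosure_of_eval_ne_zero {f : MvPolynomial (Fin n) ℂ}
    {L : Submodule ℂ (Fin n → ℂ)} (hf : ∀ x ∈ L, eval x f ≠ 0 → x ∈ imageClosure H)
    {w : Fin n → ℂ} (hw : w ∈ L) (hfw : eval w f ≠ 0) :
    (L : Set (Fin n → ℂ)) ⊆ imageClosure H := by
  intro x hx
  rw [mem_imageClosure]
  intro g hg
  have hfg : f * g ∈ vanishingIdeal ℂ (L : Set (Fin n → ℂ)) := by
    intro y hy
    rw [aeval_eq_eval, map_mul]
    by_cases h0 : eval y f = 0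
    · rw [h0, zero_mul]
    · rw [mem_imageClosure.1 (hf y hy h0) g hg, mul_zero]
  have := ((isPrime_vanishingIdeal_submodule L).mem_or_mem hfg).resolve_left fun hfL =>
    hfw (by have := hfL w hw; rwa [aeval_eq_eval] at this)
  have := this x hx
  rwa [aeval_eq_eval] at this

/-- If finitely many subspaces cover a dense open part of the image, then one of them contains
the image closure. -/
theorem exists_imageClosure_subset {S : Set (Submodule ℂ (Fin n → ℂ))} (hS : S.Finite)
    {f : MvPolynomial (Fin n) ℂ} (hf : f ∉ vanishingIdeal ℂ (imageClosure H))
    (h : ∀ x, eval (toFun H x) f ≠ 0 → ∃ L ∈ S, toFun H x ∈ L) :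
    ∃ L ∈ S, imageClosure H ⊆ L := by
  by_contra hcon
  push Not at hcon
  have hch : ∀ L : Submodule ℂ (Fin n → ℂ), ∃ l : MvPolynomial (Fin n) ℂ, L ∈ S →
      l ∉ vanishingIdeal ℂ (imageClosure H) ∧ ∀ x ∈ L, eval x l = 0 := by
    intro L
    by_cases hL : L ∈ S
    · obtain ⟨w, hw, hwL⟩ := Set.not_subset.1 (hcon L hL)
      obtain ⟨l, hlw, hlL⟩ := exists_linForm_of_notMem hwL
      exact ⟨linForm l, fun _ => ⟨fun hm => hlw (linForm_mem_vanishingIdeal.1 hm w hw),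
        fun x hx => by rw [eval_linForm, hlL x hx]⟩⟩
    · exact ⟨0, fun h => absurd h hL⟩
  choose l hl using hch
  obtain ⟨x, hx⟩ := exists_toFun_forall_eval_ne_zero (H := H) (s := insert none (some '' S))
    ((hS.image _).insert _) (p := fun o => o.elim f l) (by
      rintro _ (rfl | ⟨L, hL, rfl⟩)
      · exact hf
      · exact (hl L hL).1)
  obtain ⟨L, hL, hxL⟩ := h x (hx none (Set.mem_insert _ _))
  exact hx (some L) (Set.mem_insert_of_mem _ ⟨L, hL, rfl⟩) ((hl L hL).2 _ hxL)

end Components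

theorem exists_coord_notMem (hr : rkJ H ≠ 0) :
    ∃ i, (X i : MvPolynomial (Fin n) ℂ) ∉ vanishingIdeal ℂ (imageClosure H) := by
  obtain ⟨w, hw, hw0⟩ := exists_ne_zero_of_rkJ hr
  obtain ⟨i, hi⟩ := Function.ne_iff.1 hw0
  exact ⟨i, notMem_vanishingIdeal hw (by rw [eval_X]; exact hi)⟩

theorem NoApexCond.finitePlanesInClosureCond (hH : PolyMap.IsHomogeneous H)
    (hqt : IsQuasiTranslation H) (h1 : NoApexCond H) : FinitePlanesInClosureCond H := by
  obtain ⟨hdim, hr3, hapex⟩ := h1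
  refine ⟨hdim, ?_, ?_⟩
  · rintro ⟨L, hL, hLW⟩
    obtain ⟨v, hv, hv0⟩ := exists_mem_notMem_span (B := L) hL.ge 0
    refine hapex ⟨v, by rintro rfl; exact hv0 (Submodule.zero_mem _), fun l c hc => ?_⟩
    rw [← hLW] at hc ⊢
    exact L.add_mem (L.smul_mem _ hc) (L.smul_mem _ hv)
  · rintro ⟨p, hpW, hp0, hinf⟩
    have hr : rkJ H ≠ 0 := by
      obtain ⟨L, hL, -, hLW⟩ := hinf.nonempty
      have := finrank_le_rkJ hLW
      rw [hL.1] at this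
      omega
    obtain ⟨d, h⟩ := exists_isHQT hH hqt hr
    refine hapex ⟨p, hp0, fun l c hc => ?_⟩
    suffices key : ∀ c ∈ imageClosure H, ∀ t : ℂ, c + t • p ∈ imageClosure H from
      key _ (h.smul_mem_imageClosure _ hc) l
    by_contra hcon
    push Not at hcon
    obtain ⟨c, hc, t, ht⟩ := hcon
    rw [mem_imageClosure] at ht
    push Not at ht
    obtain ⟨g, hg, hgt⟩ := ht
    -- The planes of $W$ through `p` are stable under translation by `t • p`, so they lie in the
    -- zero set of `I`. This is a proper closed subset of $W$, of dimension at most two as the rank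
    -- is at most three; each plane is thus one of its finitely many components.
    set I := vanishingIdeal ℂ (imageClosure H) ⊔ Ideal.span {translate (t • p) g}
    have hgI : translate (t • p) g ∉ vanishingIdeal ℂ (imageClosure H) :=
      notMem_vanishingIdeal hc (by rwa [eval_translate])
    refine hinf (Set.Finite.of_finite_image (f := fun L : Submodule ℂ (Fin n → ℂ) =>
      vanishingIdeal ℂ (L : Set (Fin n → ℂ)))
      ((Ideal.finite_minimalPrimes_of_isNoetherianRing _ I).subset ?_) ?_)
    · rintro _ ⟨L, ⟨hL, hpL, hLW⟩, rfl⟩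
      refine mem_minimalPrimes_of_forall_lt (sup_le (vanishingIdeal_anti_mono hLW) ?_)
        fun Q hQ hIQ hlt => ?_
      · rw [Ideal.span_singleton_le_iff_mem]
        intro x hx
        rw [aeval_eq_eval, eval_translate]
        exact mem_imageClosure.1 (hLW (L.add_mem hx (L.smul_mem t hpL))) g hg
      · have hWQ : vanishingIdeal ℂ (imageClosure H) < Q :=
          lt_of_le_of_ne (le_sup_left.trans hIQ) fun he => hgI (he ▸ hIQ
            (Ideal.mem_sup_right (Ideal.mem_span_singleton_self _)))
        have h2 : ((2 : ℕ) : WithBot ℕ∞) ≤ algDim (L : Set (Fin n → ℂ)) := by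
          rw [algDim_submodule, hL.1]
        have h4 := (ringKrullDim_quotient_succ_le hWQ
          (ringKrullDim_quotient_succ_le hlt h2)).trans (algDim_imageClosure H).le
        have : 2 + 1 + 1 ≤ rkJ H := by exact_mod_cast h4
        omega
    · intro L _ L' _ he
      have he' : vanishingIdeal ℂ (L : Set (Fin n → ℂ)) = vanishingIdeal ℂ (L' : Set (Fin n → ℂ)) :=
        he
      exact le_antisymm (subset_of_vanishingIdeal_le (L := L') he'.ge)
        (subset_of_vanishingIdeal_le (L := L) he'.le)

/-- Below rank two, $V(H)$ is too small for GN-planes. Otherwise GN-planes through a generic point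
of $W$ lie in $W$, so (2) makes them finite in number. A point `c` sharing planes with all of $W$
would itself lie in $W$; its finitely many planes in $W$ would cover a dense part of $W$, so $W$
would be one of them. -/
theorem FinitePlanesInClosureCond.noCommonPartnerCond (hH : PolyMap.IsHomogeneous H)
    (hqt : IsQuasiTranslation H) (h2 : FinitePlanesInClosureCond H) : NoCommonPartnerCond H := by
  obtain ⟨hdim, hlin, hfin⟩ := h2
  rcases Nat.lt_or_ge (rkJ H) 2 with hr | hr
  · have hno : ∀ L, ¬ IsGNPlane H L := fun L hL => by
      have := algDim_mono hL.2
      rw [algDim_submodule, hL.1, hdim] at this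
      have : 2 ≤ rkJ H := by exact_mod_cast this
      omega
    refine ⟨⟨_, toFun_mem_imageClosure H 0, ?_⟩, ?_⟩
    · exact Set.Finite.subset Set.finite_empty fun L hL => hno L hL.1
    · rintro ⟨c, -, -, hc⟩
      obtain ⟨L, hL, -⟩ := hc _ (toFun_mem_imageClosure H 0)
      exact hno L hL
  · obtain ⟨d, h⟩ := exists_isHQT hH hqt (by omega)
    obtain ⟨f, hf, hfV⟩ := exists_eval_ne_zero_imp_mem h hdim
    have hsub : ∀ {L q}, IsGNPlane H L → q ∈ L → eval q f ≠ 0 →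
        (L : Set (Fin n → ℂ)) ⊆ imageClosure H := fun hL hq hfq =>
      subset_imageClosure_of_eval_ne_zero (fun x hx => hfV x (hL.2 hx)) hq hfq
    push Not at hfin
    constructor
    · obtain ⟨i, hi⟩ := exists_coord_notMem (H := H) (by omega)
      obtain ⟨x, hx⟩ := exists_toFun_eval_ne_zero (H := H) (f := f * X i)
        fun hm => (Ideal.IsPrime.mem_or_mem inferInstance hm).elim hf hi
      rw [map_mul, eval_X] at hx
      refine ⟨toFun H x, toFun_mem_imageClosure H x,
        (hfin _ (toFun_mem_imageClosure H x) fun h0 => ?_).subset fun L hL => ?_⟩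
      · exact right_ne_zero_of_mul hx (congrFun h0 i)
      · exact ⟨hL.1, hL.2, hsub hL.1 hL.2 (left_ne_zero_of_mul hx)⟩
    · rintro ⟨c, -, hc0, hc⟩
      have hcW : c ∈ imageClosure H := by
        obtain ⟨x, hx⟩ := exists_toFun_eval_ne_zero hf
        obtain ⟨L, hL, hcL, hqL⟩ := hc _ (toFun_mem_imageClosure H x)
        exact hsub hL hqL hx hcL
      obtain ⟨L, ⟨hL, -, hLW⟩, hWL⟩ := exists_imageClosure_subset (hfin c hcW hc0) hf
        fun x hx => by
          obtain ⟨L, hL, hcL, hqL⟩ := hc _ (toFun_mem_imageClosure H x)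
          exact ⟨L, ⟨hL, hcL, hsub hL hqL hx⟩, hqL⟩
      exact hlin ⟨L, hL.1, hLW.antisymm hWL⟩

end

/-! ### Finiteness of planes at generic points; hubs. -/

section

open PolyMap

section Krull

/-- Krull's height theorem for two elements modulo a prime, at the top of a chain of length
three. -/
theorem exists_prime_lt_of_chain {A : Type*} [CommRing A] [IsNoetherianRing A]
    {P P₁ P₂ m : Ideal A} [P.IsPrime] [P₁.IsPrime] [P₂.IsPrime] [m.IsPrime] (h₁ : P < P₁)
    (h₂ : P₁ < P₂) (h₃ : P₂ < m) {a b : A} (ha : a ∈ m) (hb : b ∈ m) :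
    ∃ Q : Ideal A, Q.IsPrime ∧ P ≤ Q ∧ Q < m ∧ a ∈ Q ∧ b ∈ Q := by
  have hle : P ⊔ Ideal.span {a, b} ≤ m := by
    refine sup_le (h₁.trans (h₂.trans h₃)).le ?_
    rw [Ideal.span_le]
    rintro x (rfl | rfl)
    exacts [ha, hb]
  obtain ⟨Q, hQ, hQm⟩ := Ideal.exists_minimalPrimes_le hle
  have hPQ : P ≤ Q := le_sup_left.trans hQ.1.2
  have hab : Ideal.span {a, b} ≤ Q := le_sup_right.trans hQ.1.2
  refine ⟨Q, hQ.isPrime, hPQ, lt_of_le_of_ne hQm ?_, hab (Ideal.subset_span (by simp)),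
    hab (Ideal.subset_span (by simp))⟩
  -- If `Q` were `m`, Krull's theorem modulo `P` would bound its height by two, while the given
  -- chain has length three.
  rintro rfl
  let φ := Ideal.Quotient.mk P
  have hmap : ∀ {I : Ideal A}, P ≤ I → (I.map φ).comap φ = I := fun {I} hI => by
    rw [Ideal.comap_map_of_surjective' φ Ideal.Quotient.mk_surjective, Ideal.mk_ker,
      sup_eq_left.2 hI]
  have hlt : ∀ {I J : Ideal A}, P ≤ I → I < J → I.map φ < J.map φ := fun {I J} hI hIJ =>
    lt_of_le_of_ne (Ideal.map_mono hIJ.le) fun he => hIJ.ne (by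
      rw [← hmap hI, ← hmap (hI.trans hIJ.le), he])
  have : (P.map φ).IsPrime := Ideal.isPrime_map_quotientMk_of_isPrime le_rfl
  have : (P₁.map φ).IsPrime := Ideal.isPrime_map_quotientMk_of_isPrime h₁.le
  have : (P₂.map φ).IsPrime := Ideal.isPrime_map_quotientMk_of_isPrime (h₁.trans h₂).le
  have : (Q.map φ).IsPrime := Ideal.isPrime_map_quotientMk_of_isPrime hPQ
  have hmin : Q.map φ ∈ (Ideal.span {φ a, φ b}).minimalPrimes := by
    have := Ideal.minimalPrimes_map_of_surjective
      (Ideal.Quotient.mk_surjective (I := P)) (Ideal.span {a, b})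
    rw [Ideal.mk_ker, Ideal.map_span, Set.image_pair, sup_comm] at this
    rw [this]
    exact ⟨Q, hQ, rfl⟩
  have hk := Ideal.height_le_card_of_mem_minimalPrimes_span (Set.toFinite _) hmin
  have hcard : ({φ a, φ b} : Set (A ⧸ P)).ncard ≤ 2 :=
    (Set.ncard_insert_le _ _).trans (by rw [Set.ncard_singleton])
  have e1 := Ideal.height_add_one_le_of_lt_of_isPrime (hlt le_rfl h₁)
  have e2 := Ideal.height_add_one_le_of_lt_of_isPrime (hlt h₁.le h₂)
  have e3 := Ideal.height_add_one_le_of_lt_of_isPrime (hlt (h₁.trans h₂).le h₃)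
  have : (3 : ℕ∞) ≤ 2 := calc
    (3 : ℕ∞) = 0 + 1 + 1 + 1 := by norm_num
    _ ≤ (P.map φ).height + 1 + 1 + 1 := by gcongr; exact zero_le
    _ ≤ (P₁.map φ).height + 1 + 1 := by gcongr
    _ ≤ (P₂.map φ).height + 1 := by gcongr
    _ ≤ (Q.map φ).height := e3
    _ ≤ _ := hk
    _ ≤ 2 := by exact_mod_cast hcard
  exact absurd this (by decide)

end Krull

section Forms

variable {n : ℕ}

/-- A subspace is cut out by finitely many linear forms. -/
theorem exists_linForms (L : Submodule ℂ (Fin n → ℂ)) :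
    ∃ (k : ℕ) (f : Fin k → Module.Dual ℂ (Fin n → ℂ)), ∀ x, x ∈ L ↔ ∀ j, f j x = 0 := by
  let B := Module.finBasis ℂ ((Fin n → ℂ) ⧸ L)
  refine ⟨_, fun j => (B.coord j).comp L.mkQ, fun x => ?_⟩
  rw [← Submodule.Quotient.mk_eq_zero, ← B.forall_coord_eq_zero_iff]
  rfl

/-- Finitely many planes and a point outside the origin are missed by a common subspace of
codimension two. -/
theorem exists_dual_pair {S : Set (Submodule ℂ (Fin n → ℂ))} (hS : S.Finite)
    (h2 : ∀ L ∈ S, Module.finrank ℂ L = 2) :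
    ∃ f g : Module.Dual ℂ (Fin n → ℂ), ∀ L ∈ S, ∀ c ∈ L, f c = 0 → g c = 0 → c = 0 := by
  have := hS.to_subtype
  have hb : ∀ L : S, ∃ u v : Fin n → ℂ, LinearIndependent ℂ ![u, v] ∧
      (L : Submodule ℂ (Fin n → ℂ)) = Submodule.span ℂ {u, v} := by
    intro L
    have hL := h2 L L.2
    obtain ⟨u, hu, hu0⟩ := exists_mem_notMem_span hL.ge 0
    rw [Submodule.span_zero_singleton, Submodule.mem_bot] at hu0
    obtain ⟨v, hv, hvu⟩ := exists_mem_notMem_span hL.ge u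
    have hli : LinearIndependent ℂ ![u, v] :=
      LinearIndependent.pair_symm_iff.1 (linearIndependent_pair hu0 hvu)
    refine ⟨u, v, hli, (Submodule.eq_of_le_of_finrank_eq (Submodule.span_le.2 ?_) ?_).symm⟩
    · rintro x (rfl | rfl)
      exacts [hu, hv]
    · have := finrank_span_eq_card hli
      rw [Matrix.range_cons, Matrix.range_cons, Matrix.range_empty, Set.union_empty,
        Set.singleton_union, Fintype.card_fin] at this
      rw [this, hL]
  choose u v hli hL using hb
  obtain ⟨f, hf⟩ := Module.exists_dual_forall_apply_ne_zero (K := ℂ) u fun L => (hli L).ne_zero 0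
  -- `f (u L) • v L - f (v L) • u L` spans the kernel of `f` on `L`.
  obtain ⟨g, hg⟩ := Module.exists_dual_forall_apply_ne_zero (K := ℂ)
    (fun L => f (u L) • v L - f (v L) • u L) fun L h0 => by
      have := (LinearIndependent.pair_iff.1 (hli L)) (-f (v L)) (f (u L)) (by
        rw [neg_smul, neg_add_eq_sub]; exact h0)
      exact hf L this.2
  refine ⟨f, g, fun L hLS c hc hfc hgc => ?_⟩
  have hc : c ∈ ((⟨L, hLS⟩ : S) : Submodule ℂ (Fin n → ℂ)) := hc
  rw [hL ⟨L, hLS⟩] at hc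
  obtain ⟨a, b, rfl⟩ := Submodule.mem_span_pair.1 hc
  set u := u ⟨L, hLS⟩
  set v := v ⟨L, hLS⟩
  have hfu : f u ≠ 0 := hf ⟨L, hLS⟩
  have hg' : g (f u • v - f v • u) ≠ 0 := hg ⟨L, hLS⟩
  simp only [map_add, map_smul, map_sub, smul_eq_mul] at hfc hgc hg'
  have hb : b = 0 := by
    have : b * (f u * g v - f v * g u) = 0 := by
      linear_combination f u * hgc - g u * hfc
    exact (mul_eq_zero.1 this).resolve_right hg'
  have ha : a = 0 := by
    rw [hb, zero_mul, add_zero] at hfc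
    exact (mul_eq_zero.1 hfc).resolve_right hfu
  rw [ha, hb]; simp

end Forms

variable {n d : ℕ} {H : PolyMap n}

/-- The GN-planes through `p`. -/
def planesThrough (H : PolyMap n) (p : Fin n → ℂ) : Set (Submodule ℂ (Fin n → ℂ)) :=
  {L | IsGNPlane H L ∧ p ∈ L}

/-- The GN-plane `L` contains a nonzero partner of every point of the image closure. -/
def IsHub (H : PolyMap n) (L : Submodule ℂ (Fin n → ℂ)) : Prop :=
  IsGNPlane H L ∧ ∀ q ∈ imageClosure H, ∃ c ∈ L, c ≠ 0 ∧ Joined H c q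

theorem exists_imageClosure_notMem_span (hr : 2 ≤ rkJ H) (c : Fin n → ℂ) :
    ∃ q ∈ imageClosure H, q ∉ Submodule.span ℂ {c} := by
  by_contra hcon
  push Not at hcon
  have h1 := hr.trans (rkJ_le_finrank (H := H) (L := Submodule.span ℂ {c}) hcon)
  have h2 := finrank_span_le_card (R := ℂ) ({c} : Set (Fin n → ℂ))
  simp at h2
  omega

/-- Without a common partner in GN-planes there is none at all. -/
theorem NoCommonPartnerCond.exists_not_joined (h3 : NoCommonPartnerCond H) (hr : 2 ≤ rkJ H)
    {c : Fin n → ℂ} (hc : c ≠ 0) : ∃ q ∈ imageClosure H, ¬ Joined H c q := by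
  by_contra hcon
  push Not at hcon
  have hplane : ∀ q ∈ imageClosure H, q ∉ Submodule.span ℂ {c} →
      ∃ L, IsGNPlane H L ∧ c ∈ L ∧ q ∈ L := fun q hq hqc =>
    ⟨_, (hcon q hq).isGNPlane (LinearIndependent.pair_symm_iff.1 (linearIndependent_pair hc hqc)),
      Submodule.subset_span (by simp), Submodule.subset_span (by simp)⟩
  obtain ⟨q₀, hq₀, hqc₀⟩ := exists_imageClosure_notMem_span hr c
  refine h3.2 ⟨c, ?_, hc, fun q hq => ?_⟩
  · have := hcon q₀ hq₀ 1 0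
    rwa [one_smul, zero_smul, add_zero] at this
  · by_cases hqc : q ∈ Submodule.span ℂ {c}
    · obtain ⟨L, hL, hcL, -⟩ := hplane q₀ hq₀ hqc₀
      exact ⟨L, hL, hcL, (Submodule.span_singleton_le_iff_mem _ _).2 hcL hqc⟩
    · exact hplane q hq hqc

/-- Nonemptiness is needed only for `c` on the line of `p`, which determines no plane of its own. -/
theorem Joined.exists_planesThrough {c p : Fin n → ℂ} (hp : p ≠ 0) (hj : Joined H c p)
    (hne : (planesThrough H p).Nonempty) : ∃ L ∈ planesThrough H p, c ∈ L := by
  by_cases hc : c ∈ Submodule.span ℂ {p}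
  · obtain ⟨L, hL⟩ := hne
    exact ⟨L, hL, (Submodule.span_singleton_le_iff_mem _ _).2 hL.2 hc⟩
  · exact ⟨_, ⟨hj.isGNPlane (linearIndependent_pair hp hc), Submodule.subset_span (by simp)⟩,
      Submodule.subset_span (by simp)⟩

theorem exists_eval_ne_zero_of_forall_mem {L : Submodule ℂ (Fin n → ℂ)} {q₀ : Fin n → ℂ}
    (h : ∀ c ∈ L, (∀ s : ℂ, q₀ + s • c ∈ V H) → c = 0) :
    ∃ g : MvPolynomial (Fin n) ℂ, eval q₀ g ≠ 0 ∧ ∀ q, eval q g ≠ 0 → ∀ c ∈ L,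
      (∀ s : ℂ, q + s • c ∈ V H) → c = 0 := by
  obtain ⟨k, f, hf⟩ := exists_linForms L
  obtain ⟨g, hg, hgq⟩ := exists_eval_ne_zero_of_forall_line (H := H)
    (l := fun j => linForm (f j)) (fun j => linForm_isHomogeneous (f j)) (q₀ := q₀)
    (fun c hc => h c ((hf c).2 fun j => by rw [← eval_linForm]; exact hc j))
  exact ⟨g, hg, fun q hq c hc => hgq q hq c fun j => by rw [eval_linForm]; exact (hf c).1 hc j⟩

/-- Without planes through `p`, its partners are multiples of `p`. The common partner of `p` and any
`q` is then such a multiple, so `p` is joined to all of $W$. -/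
theorem exists_planesThrough_nonempty (h : IsHQT H d) (hr : 2 ≤ rkJ H) (hn : 2 * rkJ H ≤ n + 1)
    (h3 : NoCommonPartnerCond H) {p : Fin n → ℂ} (hpW : p ∈ imageClosure H) (hp : p ≠ 0) :
    (planesThrough H p).Nonempty := by
  by_contra hemp
  rw [Set.not_nonempty_iff_eq_empty, Set.eq_empty_iff_forall_notMem] at hemp
  have hspan : ∀ c, Joined H c p → c ∈ Submodule.span ℂ {p} := fun c hj => by
    by_contra hc
    exact hemp _ ⟨hj.isGNPlane (linearIndependent_pair hp hc), Submodule.subset_span (by simp)⟩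
  obtain ⟨q, hq, hqj⟩ := h3.exists_not_joined hr hp
  obtain ⟨c, hc0, hcp, hcq⟩ := exists_joined_pair h hn (exists_ne_zero_of_rkJ (by omega)) hpW hq
  obtain ⟨a, rfl⟩ := Submodule.mem_span_singleton.1 (hspan c hcp)
  have ha : a ≠ 0 := by rintro rfl; exact hc0 (zero_smul _ _)
  refine hqj fun s t => ?_
  have := hcq (s * a⁻¹) t
  rwa [smul_smul, inv_mul_cancel_right₀ ha] at this

/-- One of finitely many GN-planes through a point is a hub. -/
theorem exists_isHub (h : IsHQT H d) (hr : 2 ≤ rkJ H) (hn : 2 * rkJ H ≤ n + 1)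
    (h3 : NoCommonPartnerCond H) {p : Fin n → ℂ} (hpW : p ∈ imageClosure H) (hp : p ≠ 0)
    (hfin : (planesThrough H p).Finite) : ∃ L ∈ planesThrough H p, IsHub H L := by
  have hW := exists_ne_zero_of_rkJ (H := H) (by omega)
  have hne := exists_planesThrough_nonempty h hr hn h3 hpW hp
  by_contra hcon
  push Not at hcon
  have hch : ∀ L : Submodule ℂ (Fin n → ℂ), ∃ g : MvPolynomial (Fin n) ℂ,
      L ∈ planesThrough H p → g ∉ vanishingIdeal ℂ (imageClosure H) ∧ ∀ q, eval q g ≠ 0 →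
        ∀ c ∈ L, (∀ s : ℂ, q + s • c ∈ V H) → c = 0 := by
    intro L
    by_cases hL : L ∈ planesThrough H p
    · have hhub := hcon L hL
      simp only [IsHub, hL.1, true_and, not_forall, not_exists, not_and] at hhub
      obtain ⟨q, hq, hqc⟩ := hhub
      obtain ⟨g, hg, hgq⟩ := exists_eval_ne_zero_of_forall_mem (H := H) (L := L) (q₀ := q)
        fun c hc hl => by
          by_contra hc0
          exact hqc c hc hc0 (h.joined_of_line hl)
      exact ⟨g, fun _ => ⟨notMem_vanishingIdeal hq hg, hgq⟩⟩
    · exact ⟨0, fun hL' => absurd hL' hL⟩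
  choose g hg using hch
  obtain ⟨x, hx⟩ := exists_toFun_forall_eval_ne_zero hfin fun L hL => (hg L hL).1
  -- The generic point has no nonzero partner in any plane through `p`, yet its common partner with
  -- `p` lies in one of them.
  obtain ⟨c, hc0, hcp, hcq⟩ := exists_joined_pair h hn hW hpW (toFun_mem_imageClosure H x)
  obtain ⟨L, hL, hcL⟩ := hcp.exists_planesThrough hp hne
  exact hc0 ((hg L hL).2 _ (hx L hL) c hcL hcq.line)

/-- Lying in only finitely many GN-planes is a generic property. -/
theorem exists_eval_ne_zero_finite (h : IsHQT H d) (hr : 2 ≤ rkJ H) (hn : 2 * rkJ H ≤ n + 1)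
    (h3 : NoCommonPartnerCond H) :
    ∃ g ∉ vanishingIdeal ℂ (imageClosure H), ∀ q, eval q g ≠ 0 →
      q ≠ 0 ∧ (planesThrough H q).Finite := by
  obtain ⟨p, hpW, hp, hfin⟩ : ∃ p ∈ imageClosure H, p ≠ 0 ∧ (planesThrough H p).Finite := by
    obtain ⟨p, hpW, hfin⟩ := h3.1
    by_cases hp : p = 0
    · obtain ⟨w, hw, hw0⟩ := exists_ne_zero_of_rkJ (H := H) (by omega)
      refine ⟨w, hw, hw0, hfin.subset fun L hL => ⟨hL.1, ?_⟩⟩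
      rw [hp]; exact L.zero_mem
    · exact ⟨p, hpW, hp, hfin⟩
  have hne := exists_planesThrough_nonempty h hr hn h3 hpW hp
  -- The partners of `p` fill finitely many planes, which two linear forms meet only in the origin.
  -- By elimination the same two forms exclude nonzero partners for generic `q`.
  obtain ⟨f₁, f₂, hf⟩ := exists_dual_pair hfin fun L hL => hL.1.1
  let N : Submodule ℂ (Fin n → ℂ) := LinearMap.ker f₁ ⊓ LinearMap.ker f₂
  obtain ⟨g, hgp, hg⟩ := exists_eval_ne_zero_of_forall_mem (H := H) (L := N) (q₀ := p)
    fun c hc hl => by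
      obtain ⟨L, hL, hcL⟩ := (h.joined_of_line hl).exists_planesThrough hp hne
      exact hf L hL c hcL hc.1 hc.2
  obtain ⟨i, hi⟩ := Function.ne_iff.1 hp
  refine ⟨g * X i, notMem_vanishingIdeal hpW (by
    rw [map_mul, eval_X]; exact mul_ne_zero hgp hi), fun q hq => ?_⟩
  rw [map_mul, eval_X] at hq
  have hq0 : q ≠ 0 := fun h0 => right_ne_zero_of_mul hq (congrFun h0 i)
  refine ⟨hq0, ?_⟩
  by_contra hinf
  let U : Set (Fin n → ℂ) := {c | ∀ s : ℂ, q + s • c ∈ V H}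
  -- Infinitely many planes cannot all be components of the set `U` of partners of `q`. One of them
  -- is therefore properly inside an irreducible subset of dimension at least three, where two
  -- linear forms leave a nonzero point.
  obtain ⟨L, hL, hmin⟩ : ∃ L ∈ planesThrough H q,
      vanishingIdeal ℂ (L : Set (Fin n → ℂ)) ∉ (vanishingIdeal ℂ U).minimalPrimes := by
    by_contra hcon
    push Not at hcon
    refine hinf (Set.Finite.of_finite_image (f := fun L : Submodule ℂ (Fin n → ℂ) =>
      vanishingIdeal ℂ (L : Set (Fin n → ℂ)))
      ((Ideal.finite_minimalPrimes_of_isNoetherianRing _ _).subset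
        (by rintro _ ⟨L, hL, rfl⟩; exact hcon L hL)) ?_)
    intro L _ L' _ he
    have he' : vanishingIdeal ℂ (L : Set (Fin n → ℂ)) = vanishingIdeal ℂ (L' : Set (Fin n → ℂ)) :=
      he
    exact le_antisymm (subset_of_vanishingIdeal_le (L := L') he'.ge)
      (subset_of_vanishingIdeal_le (L := L) he'.le)
  have hLU : (L : Set (Fin n → ℂ)) ⊆ U := fun c hc s => (IsGNPlane.joined hL.1 hc hL.2).line s
  obtain ⟨P, hP, hUP, hPL⟩ : ∃ P : Ideal (MvPolynomial (Fin n) ℂ), P.IsPrime ∧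
      vanishingIdeal ℂ U ≤ P ∧ P < vanishingIdeal ℂ (L : Set (Fin n → ℂ)) := by
    by_contra hcon
    push Not at hcon
    exact hmin (mem_minimalPrimes_of_forall_lt (vanishingIdeal_anti_mono hLU) hcon)
  have hlt : vanishingIdeal ℂ (L : Set (Fin n → ℂ)) <
      vanishingIdeal ℂ (Submodule.span ℂ {q} : Set (Fin n → ℂ)) := by
    refine vanishingIdeal_submodule_lt (lt_of_le_of_ne
      ((Submodule.span_singleton_le_iff_mem _ _).2 hL.2) fun he => ?_)
    have h1 := hL.1.1
    rw [← he, finrank_span_singleton hq0] at h1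
    omega
  obtain ⟨Q, hQ, hPQ, hQm, h₁, h₂⟩ := exists_prime_lt_of_chain hPL hlt
    (vanishingIdeal_span_singleton_lt hq0)
    (a := linForm f₁) (b := linForm f₂) (by rw [mem_vanishingIdeal_singleton, eval_linForm,
      map_zero]) (by rw [mem_vanishingIdeal_singleton, eval_linForm, map_zero])
  have hsub : ¬ zeroLocus ℂ Q ⊆ {0} := fun hs =>
    hQm.ne (eq_vanishingIdeal_singleton_of_zeroLocus_subset hs)
  obtain ⟨c, hcQ, hc0⟩ := Set.not_subset.1 hsub
  refine hc0 (hg q (left_ne_zero_of_mul hq) c ⟨?_, ?_⟩ ?_)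
  · have := eval_eq_zero_of_mem_zeroLocus h₁ hcQ
    rwa [eval_linForm] at this
  · have := eval_eq_zero_of_mem_zeroLocus h₂ hcQ
    rwa [eval_linForm] at this
  · obtain ⟨D, F, -, hF⟩ := exists_forms_line H
    rw [← hF]
    intro k
    refine eval_eq_zero_of_mem_zeroLocus (hPQ (hUP ?_)) hcQ
    intro y hy
    rw [aeval_eq_eval]
    exact (hF y q).2 hy k

end

/-! ### Very general points; the implications (3)⇒(4)⇒(5) and (1)⇒(5). -/

section

open PolyMap

section Baire

variable {n : ℕ}

theorem dense_eval_ne_zero {p : MvPolynomial (Fin n) ℂ} (hp : p ≠ 0) :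
    Dense {x : Fin n → ℂ | eval x p ≠ 0} := by
  intro x
  obtain ⟨y, hy⟩ : ∃ y, eval y p ≠ 0 := by
    by_contra hcon
    push Not at hcon
    exact hp (MvPolynomial.funext fun y => by rw [hcon y, map_zero])
  let γ : ℂ → Fin n → ℂ := fun t => x + t • (y - x)
  have hγ : Continuous γ := by fun_prop
  have hne : lineRestrict x (y - x) p ≠ 0 := fun h0 => hy (by
    have := eval_lineRestrict x (y - x) p 1
    rwa [h0, Polynomial.eval_zero, one_smul, add_sub_cancel, eq_comm] at this)
  have hd : Dense {t : ℂ | (lineRestrict x (y - x) p).IsRoot t}ᶜ :=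
    (Set.Finite.countable (Polynomial.finite_setOfPred_isRoot hne)).dense_compl ℂ
  have h0 : γ 0 = x := by simp [γ]
  rw [← h0]
  refine closure_mono ?_ (hγ.range_subset_closure_image_dense hd ⟨0, rfl⟩)
  rintro _ ⟨t, ht, rfl⟩
  rw [Set.mem_compl_iff, Set.mem_ofPred_eq, Polynomial.IsRoot, eval_lineRestrict] at ht
  exact ht

/-- Countably many nonzero polynomials have a common nonzero point. -/
theorem exists_forall_eval_ne_zero {ι : Type*} [Countable ι] {p : ι → MvPolynomial (Fin n) ℂ}
    (hp : ∀ i, p i ≠ 0) : ∃ x, ∀ i, eval x (p i) ≠ 0 := by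
  have := dense_iInter_of_isOpen (f := fun i => {x : Fin n → ℂ | eval x (p i) ≠ 0})
    (fun i => isOpen_ne_fun (MvPolynomial.continuous_eval (p i)) continuous_const)
    fun i => dense_eval_ne_zero (hp i)
  obtain ⟨x, hx⟩ := this.nonempty
  exact ⟨x, fun i => Set.mem_iInter.1 hx i⟩

theorem exists_toFun_forall_eval_ne_zero_of_countable {H : PolyMap n} {ι : Type*} [Countable ι]
    {p : ι → MvPolynomial (Fin n) ℂ} (hp : ∀ i, p i ∉ vanishingIdeal ℂ (imageClosure H)) :
    ∃ x, ∀ i, eval (toFun H x) (p i) ≠ 0 := by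
  obtain ⟨x, hx⟩ := exists_forall_eval_ne_zero (p := fun i => bind₁ H (p i)) fun i h0 => by
    obtain ⟨x, hx⟩ := exists_toFun_eval_ne_zero (hp i)
    rw [← eval_bind, h0, map_zero] at hx
    exact hx rfl
  exact ⟨x, fun i => by rw [← eval_bind]; exact hx i⟩

end Baire

variable {n d : ℕ} {H : PolyMap n}

theorem Joined.of_smul {c q : Fin n → ℂ} {a : ℂ} (ha : a ≠ 0) (h : Joined H (a • c) q) :
    Joined H c q := fun s t => by
  have := h (s * a⁻¹) t
  rwa [smul_smul, inv_mul_cancel_right₀ ha] at this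

/-- Distinct planes meet in at most a line, and its generator fails to be joined to some point of
$W$, hence to a generic one. -/
theorem exists_eval_ne_zero_not_joined (h : IsHQT H d) (hr : 2 ≤ rkJ H)
    (h3 : NoCommonPartnerCond H) {L L' : Submodule ℂ (Fin n → ℂ)}
    (hL : Module.finrank ℂ L = 2) (hL' : Module.finrank ℂ L' = 2) (hne : L ≠ L') :
    ∃ g ∉ vanishingIdeal ℂ (imageClosure H), ∀ q, eval q g ≠ 0 →
      ∀ c ∈ L, c ∈ L' → c ≠ 0 → ¬ Joined H c q := by
  by_cases hbot : L ⊓ L' = ⊥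
  · refine ⟨1, fun h1 => (inferInstance :
      (vanishingIdeal ℂ (imageClosure H)).IsPrime).ne_top ((Ideal.eq_top_iff_one _).2 h1),
      fun q _ c hc hc' hc0 => absurd ?_ hc0⟩
    have : c ∈ L ⊓ L' := ⟨hc, hc'⟩
    rwa [hbot, Submodule.mem_bot] at this
  · obtain ⟨u, hu, hu0⟩ := Submodule.exists_mem_ne_zero_of_ne_bot hbot
    obtain ⟨q₀, hq₀, hj⟩ := h3.exists_not_joined hr hu0
    obtain ⟨s, hs⟩ : ∃ s : ℂ, q₀ + s • u ∉ V H := by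
      by_contra hcon
      push Not at hcon
      exact hj (h.joined_of_line hcon)
    simp only [V, Set.mem_ofPred_eq, not_forall] at hs
    obtain ⟨i, hi⟩ := hs
    refine ⟨translate (s • u) (H i), notMem_vanishingIdeal hq₀ (by rwa [eval_translate]),
      fun q hq c hc hc' hc0 hcq => hq ?_⟩
    have hlt : L ⊓ L' < L := lt_of_le_of_ne inf_le_left fun he =>
      hne (Submodule.eq_of_le_of_finrank_eq (inf_eq_left.1 he) (hL.trans hL'.symm))
    have h1 := Submodule.finrank_lt_finrank_of_lt hlt
    have h2 := Submodule.eq_of_le_of_finrank_le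
      ((Submodule.span_singleton_le_iff_mem u (L ⊓ L')).2 hu)
      (by rw [finrank_span_singleton hu0]; omega)
    have h3 : c ∈ L ⊓ L' := ⟨hc, hc'⟩
    rw [← h2] at h3
    obtain ⟨a, rfl⟩ := Submodule.mem_span_singleton.1 h3
    rw [eval_translate]
    exact (hcq.of_smul (by rintro rfl; exact hc0 (zero_smul _ _))).line s i

theorem exists_hubs_span (h : IsHQT H d) (hr : 2 ≤ rkJ H) (hn : 2 * rkJ H ≤ n + 1)
    (h3 : NoCommonPartnerCond H) {f : MvPolynomial (Fin n) ℂ}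
    (hf : f ∉ vanishingIdeal ℂ (imageClosure H)) :
    ∃ L L' : Submodule ℂ (Fin n → ℂ), L ≠ L' ∧ IsGNPlane H L ∧ IsGNPlane H L' ∧
      (∃ w ∈ L, eval w f ≠ 0) ∧ (∃ w ∈ L', eval w f ≠ 0) ∧
      imageClosure H ⊆ (L ⊔ L' : Submodule ℂ (Fin n → ℂ)) := by
  obtain ⟨g, hg, hgfin⟩ := exists_eval_ne_zero_finite h hr hn h3
  let S : Set (Submodule ℂ (Fin n → ℂ)) := {L | IsHub H L ∧ ∃ w ∈ L, eval w f ≠ 0}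
  -- A generic point of $W$ lies on a hub from `S`; finitely many would force $W$ into a single
  -- GN-plane.
  have hS : S.Infinite := by
    intro hfin
    obtain ⟨L, hL, hWL⟩ := exists_imageClosure_subset hfin (f := f * g)
      (fun hm => (Ideal.IsPrime.mem_or_mem inferInstance hm).elim hf hg) fun x hx => by
        rw [map_mul] at hx
        obtain ⟨h0, hfin⟩ := hgfin _ (right_ne_zero_of_mul hx)
        obtain ⟨L, hL, hub⟩ := exists_isHub h hr hn h3 (toFun_mem_imageClosure H x) h0 hfin
        exact ⟨L, ⟨hub, _, hL.2, left_ne_zero_of_mul hx⟩, hL.2⟩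
    exact h3.not_subset_V hr hWL hL.1.1.2
  -- The number of planes through `q` is not known before `q` is chosen, so the conditions for all
  -- pairs from an infinite sequence of hubs are imposed at once, by Baire.
  let e := hS.natEmbedding
  have hsep : ∀ ij : ℕ × ℕ, ∃ p ∉ vanishingIdeal ℂ (imageClosure H), ∀ q, eval q p ≠ 0 →
      (q ∈ (e ij.1 : Submodule ℂ (Fin n → ℂ)) ⊔ (e ij.2 : Submodule ℂ (Fin n → ℂ)) →
        imageClosure H ⊆ ((e ij.1 ⊔ e ij.2 : Submodule ℂ (Fin n → ℂ)) : Set (Fin n → ℂ))) ∧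
      (ij.1 ≠ ij.2 → ∀ c ∈ (e ij.1 : Submodule ℂ (Fin n → ℂ)),
        c ∈ (e ij.2 : Submodule ℂ (Fin n → ℂ)) → c ≠ 0 → ¬ Joined H c q) := by
    rintro ⟨i, j⟩
    obtain ⟨a, ha, haq⟩ : ∃ a ∉ vanishingIdeal ℂ (imageClosure H), ∀ q, eval q a ≠ 0 →
        (q ∈ (e i : Submodule ℂ (Fin n → ℂ)) ⊔ (e j : Submodule ℂ (Fin n → ℂ)) →
        imageClosure H ⊆ ((e i ⊔ e j : Submodule ℂ (Fin n → ℂ)) : Set (Fin n → ℂ))) := by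
      by_cases hW : imageClosure H ⊆ ((e i ⊔ e j : Submodule ℂ (Fin n → ℂ)) : Set (Fin n → ℂ))
      · exact ⟨g, hg, fun _ _ _ => hW⟩
      · obtain ⟨w, hw, hwL⟩ := Set.not_subset.1 hW
        obtain ⟨l, hlw, hl⟩ := exists_linForm_of_notMem hwL
        exact ⟨linForm l, notMem_vanishingIdeal hw (by rwa [eval_linForm]),
          fun q hq hqL => absurd (by rw [eval_linForm, hl q hqL]) hq⟩
    by_cases hij : i = j
    · exact ⟨a, ha, fun q hq => ⟨haq q hq, fun hne => absurd hij hne⟩⟩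
    · obtain ⟨b, hb, hbq⟩ := exists_eval_ne_zero_not_joined h hr h3 (e i).2.1.1.1 (e j).2.1.1.1
        fun he => hij (e.injective (Subtype.ext he))
      refine ⟨a * b, fun hm => (Ideal.IsPrime.mem_or_mem inferInstance hm).elim ha hb,
        fun q hq => ?_⟩
      rw [map_mul] at hq
      exact ⟨haq q (left_ne_zero_of_mul hq), fun _ => hbq q (right_ne_zero_of_mul hq)⟩
  choose p hp hpq using hsep
  obtain ⟨x, hx⟩ := exists_toFun_forall_eval_ne_zero_of_countable (H := H)
    (p := fun o : Option (ℕ × ℕ) => o.elim g p) (by rintro (_ | ij); exacts [hg, hp ij])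
  set q := toFun H x
  have hqW : q ∈ imageClosure H := toFun_mem_imageClosure H x
  obtain ⟨hq0, hqfin⟩ := hgfin q (hx none)
  have hne := exists_planesThrough_nonempty h hr hn h3 hqW hq0
  have hc : ∀ i, ∃ c ∈ (e i : Submodule ℂ (Fin n → ℂ)), c ≠ 0 ∧ Joined H c q ∧
      ∃ M ∈ planesThrough H q, c ∈ M := fun i => by
    obtain ⟨c, hc, hc0, hj⟩ := (e i).2.1.2 q hqW
    exact ⟨c, hc, hc0, hj, hj.exists_planesThrough hq0 hne⟩
  choose c hcL hc0 hcq M hM hcM using hc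
  have := hqfin.to_subtype
  -- Pigeonhole: two hubs contain partners of `q` in the same plane through `q`. Genericity makes
  -- the partners independent, so they span that plane and `q` lies in the sum of the hubs.
  obtain ⟨i, j, hij, hMij⟩ := Finite.exists_ne_map_eq_of_infinite
    fun i => (⟨M i, hM i⟩ : planesThrough H q)
  have hMij' : M i = M j := congrArg Subtype.val hMij
  have hcs : c j ∉ Submodule.span ℂ {c i} := fun hmem =>
    (hpq (i, j) q (hx (some (i, j)))).2 hij (c j)
      ((Submodule.span_singleton_le_iff_mem _ _).2 (hcL i) hmem) (hcL j) (hc0 j) (hcq j)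
  have hli := linearIndependent_pair (hc0 i) hcs
  have hspan : Submodule.span ℂ {c j, c i} = M i := by
    refine Submodule.eq_of_le_of_finrank_eq (Submodule.span_le.2 ?_) ?_
    · rintro y (rfl | rfl)
      exacts [hMij' ▸ hcM j, hcM i]
    · have := finrank_span_eq_card hli
      rw [Matrix.range_cons, Matrix.range_cons, Matrix.range_empty, Set.union_empty,
        Set.singleton_union, Fintype.card_fin] at this
      rw [this, (hM i).1.1]
  refine ⟨e i, e j, fun he => hij (e.injective (Subtype.ext he)), (e i).2.1.1, (e j).2.1.1,
    (e i).2.2, (e j).2.2, (hpq (i, j) q (hx (some (i, j)))).1 ?_⟩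
  have hqM : q ∈ Submodule.span ℂ {c j, c i} := hspan ▸ (hM i).2
  refine Submodule.span_le.2 ?_ hqM
  rintro y (rfl | rfl)
  exacts [Submodule.mem_sup_right (hcL j), Submodule.mem_sup_left (hcL i)]

theorem NoCommonPartnerCond.rkJ_ne_two (h3 : NoCommonPartnerCond H) (h : IsHQT H d) :
    rkJ H ≠ 2 := fun hr =>
  h3.not_subset_V hr.ge Submodule.subset_span (h.span_subset_V hr)

theorem NoCommonPartnerCond.ne_imageClosure (h3 : NoCommonPartnerCond H) (h : IsHQT H d)
    (hr : 2 ≤ rkJ H) (L : Submodule ℂ (Fin n → ℂ)) : imageClosure H ≠ L := fun he =>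
  h3.not_subset_V hr he.le (he ▸ h.imageClosure_subset_V)

theorem NoCommonPartnerCond.spanOfTwoPlanesCond (hH : PolyMap.IsHomogeneous H)
    (hqt : IsQuasiTranslation H) (hn : 2 * rkJ H ≤ n + 1) (h3 : NoCommonPartnerCond H) :
    SpanOfTwoPlanesCond H := by
  rcases Nat.lt_or_ge (rkJ H) 2 with hr | hr
  · exact Or.inl (by omega)
  right
  obtain ⟨d, h⟩ := exists_isHQT hH hqt (by omega)
  set S := Submodule.span ℂ (imageClosure H) with hSdef
  have hWS : imageClosure H ⊆ S := Submodule.subset_span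
  have hr2 := h3.rkJ_ne_two h
  have hrS : rkJ H < Module.finrank ℂ S := by
    by_contra hcon
    exact h3.ne_imageClosure h hr S (eq_imageClosure_of_subset hWS (by omega))
  have hle4 : ∀ {L L' : Submodule ℂ (Fin n → ℂ)}, IsGNPlane H L → IsGNPlane H L' →
      imageClosure H ⊆ (L ⊔ L' : Submodule ℂ (Fin n → ℂ)) →
      Module.finrank ℂ S = 4 ∧ S = L ⊔ L' := fun {L L'} hL hL' hW => by
    have h1 := Submodule.finrank_add_le_finrank_add_finrank L L'
    rw [hL.1, hL'.1] at h1
    have hSL : S ≤ L ⊔ L' := Submodule.span_le.2 hW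
    have h2 := Submodule.finrank_mono hSL
    exact ⟨by omega, Submodule.eq_of_le_of_finrank_le hSL (by omega)⟩
  obtain ⟨g, hg, -⟩ := exists_eval_ne_zero_finite h hr hn h3
  -- This first pair of hubs serves only to find the dimension of `S`; any function not vanishing on
  -- $W$ would do in place of `g`.
  obtain ⟨L₀, L₀', -, hL₀, hL₀', -, -, hW₀⟩ := exists_hubs_span h hr hn h3 hg
  obtain ⟨hS4, -⟩ := hle4 hL₀ hL₀' hW₀
  have hSV : ¬ (S : Set (Fin n → ℂ)) ⊆ V H := h3.not_subset_V hr hWS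
  -- In the four-dimensional `S`, an irreducible closed set strictly larger than $W$ can only be `S`
  -- itself, which is not inside $V(H)$. So $W$ is a component of the intersection, and hubs through
  -- its generic points lie in $W$.
  have hmin : vanishingIdeal ℂ (imageClosure H) ∈
      (vanishingIdeal ℂ (V H ∩ S)).minimalPrimes := by
    refine mem_minimalPrimes_of_forall_lt (vanishingIdeal_anti_mono
      (Set.subset_inter h.imageClosure_subset_V hWS)) fun Q hQ hVQ hlt => ?_
    have h1 := ringKrullDim_quotient_succ_le hlt (algDim_imageClosure H).ge
    have hSQ : vanishingIdeal ℂ (S : Set (Fin n → ℂ)) ≤ Q :=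
      (vanishingIdeal_anti_mono Set.inter_subset_right).trans hVQ
    have hQS : vanishingIdeal ℂ (S : Set (Fin n → ℂ)) = Q := by
      by_contra hne
      have h2 := (ringKrullDim_quotient_succ_le (lt_of_le_of_ne hSQ hne) h1).trans
        (algDim_submodule S).le
      have : rkJ H + 1 + 1 ≤ Module.finrank ℂ S := by exact_mod_cast h2
      omega
    refine hSV fun x hx i => ?_
    have hi : H i ∈ vanishingIdeal ℂ (S : Set (Fin n → ℂ)) := hQS ▸ hVQ (fun y hy => by
      rw [aeval_eq_eval]; exact hy.1 i)
    have := hi x hx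
    rwa [aeval_eq_eval] at this
  obtain ⟨f, hf, hfV⟩ := exists_notMem_of_minimalPrimes hmin
  obtain ⟨L, L', hne, hL, hL', ⟨w, hw, hfw⟩, ⟨w', hw', hfw'⟩, hW⟩ := exists_hubs_span h hr hn h3 hf
  obtain ⟨-, hSL⟩ := hle4 hL hL' hW
  have hsub : ∀ {M : Submodule ℂ (Fin n → ℂ)}, IsGNPlane H M → M ≤ S →
      ∀ {w}, w ∈ M → eval w f ≠ 0 → (M : Set (Fin n → ℂ)) ⊆ imageClosure H :=
    fun hM hMS _ hw hfw => subset_imageClosure_of_eval_ne_zero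
      (fun x hx hfx => mem_imageClosure_iff_zeroLocus.2 (hfV x ⟨hM.2 hx, hMS hx⟩ hfx)) hw hfw
  exact ⟨L, L', hne, hL, hL', hsub hL (hSL ▸ le_sup_left) hw hfw,
    hsub hL' (hSL ▸ le_sup_right) hw' hfw', hW.ssubset_of_ne (h3.ne_imageClosure h hr _)⟩

theorem exists_fourDim {L : Submodule ℂ (Fin n → ℂ)} (hn : 4 ≤ n) (hL : Module.finrank ℂ L ≤ 4)
    (hW : imageClosure H ⊆ L) (hr : rkJ H ≤ 3) : FourDimCond H := by
  obtain ⟨M, hLM, -, hM⟩ := exists_submodule_finrank_eq (le_top : L ≤ ⊤) hL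
    (by rw [finrank_top, Module.finrank_fin_fun]; exact hn)
  have hWM : imageClosure H ⊆ M := hW.trans hLM
  refine ⟨⟨M, hM, hWM.ssubset_of_ne fun he => ?_⟩, hr⟩
  have := finrank_le_rkJ he.ge
  omega

theorem SpanOfTwoPlanesCond.fourDimCond (hH : PolyMap.IsHomogeneous H)
    (hqt : IsQuasiTranslation H) (hn : 4 ≤ n) (h4 : SpanOfTwoPlanesCond H) : FourDimCond H := by
  rcases h4 with hr | ⟨L, L', -, hL, hL', -, -, hW⟩
  · obtain ⟨p, hp⟩ := exists_imageClosure_subset_span hH hqt hr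
    have h2 := finrank_span_le_card (R := ℂ) ({p} : Set (Fin n → ℂ))
    simp at h2
    exact exists_fourDim hn (by omega) hp (by omega)
  · have h1 := Submodule.finrank_add_le_finrank_add_finrank L L'
    rw [hL.1, hL'.1] at h1
    refine exists_fourDim hn h1 hW.subset ?_
    by_contra hcon
    exact hW.ne (eq_imageClosure_of_subset hW.subset (by omega))

/-- In rank zero, $W$ lies in one point: a nonzero point is an apex, while zero means $H=0$ and
$\dim V(H)=n>0$. In rank one, $W$ is a line through the origin and all its nonzero points are
apexes. -/
theorem NoApexCond.two_le_rkJ (hn1 : 1 ≤ n) (hH : PolyMap.IsHomogeneous H)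
    (hqt : IsQuasiTranslation H) (h1 : NoApexCond H) : 2 ≤ rkJ H := by
  obtain ⟨hdim, -, hapex⟩ := h1
  by_contra hr
  by_cases hr0 : rkJ H = 0
  · obtain ⟨p, hp⟩ := exists_imageClosure_subset_singleton hr0
    by_cases hp0 : p = 0
    · have hV : ((⊤ : Submodule ℂ (Fin n → ℂ)) : Set (Fin n → ℂ)) ⊆ V H := fun x _ => by
        rw [IsHQT.mem_V_iff, ← hp0]
        exact hp (toFun_mem_imageClosure H x)
      have := algDim_mono hV
      rw [algDim_submodule, hdim, hr0, finrank_top, Module.finrank_fin_fun] at this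
      have : n ≤ 0 := by exact_mod_cast this
      omega
    · refine hapex ⟨p, hp0, fun l c hc => ?_⟩
      rw [← (hp hc : c = p), ← add_smul, sub_add_cancel, one_smul]
      exact hc
  · obtain ⟨p, hp⟩ := exists_imageClosure_subset_span hH hqt (by omega)
    obtain ⟨d, h⟩ := exists_isHQT hH hqt hr0
    obtain ⟨w, hw, hw0⟩ := exists_ne_zero_of_rkJ hr0
    refine hapex ⟨w, hw0, fun l c hc => ?_⟩
    obtain ⟨b, hb⟩ := Submodule.mem_span_singleton.1 (hp hw)
    obtain ⟨a, ha⟩ := Submodule.mem_span_singleton.1 (hp hc)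
    have hb0 : b ≠ 0 := by rintro rfl; exact hw0 (by rw [← hb, zero_smul])
    have : (1 - l) • c + l • w = ((1 - l) * a * b⁻¹ + l) • w := by
      rw [← ha, ← hb, smul_smul, smul_smul, smul_smul, ← add_smul]
      congr 1
      field_simp
    rw [this]
    exact h.smul_mem_imageClosure _ hw

theorem NoApexCond.fourDimCond (hn1 : 1 ≤ n) (hH : PolyMap.IsHomogeneous H)
    (hqt : IsQuasiTranslation H) (hn : 2 * rkJ H ≤ n + 1) (h1 : NoApexCond H) :
    FourDimCond H := by
  have h3 := (h1.finitePlanesInClosureCond hH hqt).noCommonPartnerCond hH hqt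
  have h4 := h3.spanOfTwoPlanesCond hH hqt hn
  refine h4.fourDimCond hH hqt ?_
  have hr := h1.two_le_rkJ hn1 hH hqt
  obtain ⟨d, h⟩ := exists_isHQT hH hqt (by omega)
  have hr2 := h3.rkJ_ne_two h
  rcases h4 with hr1 | ⟨L, L', -, hL, hL', -, -, hW⟩
  · omega
  -- For `n < 4` the span of the two planes has dimension at most three, which is at most the rank,
  -- so $W$ could not be properly contained in it.
  · by_contra hn4
    have h5 := Submodule.finrank_le (L ⊔ L')
    rw [Module.finrank_fin_fun] at h5
    exact hW.ne (eq_imageClosure_of_subset hW.subset (by omega))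

end

/-! ### Dimension five. -/

section

open PolyMap

theorem exists_prime_of_le_ringKrullDim_quotient {A : Type*} [CommRing A] {I : Ideal A} {k : ℕ}
    (hk : (k : WithBot ℕ∞) ≤ ringKrullDim (A ⧸ I)) :
    ∃ P : Ideal A, P.IsPrime ∧ I ≤ P ∧ (k : WithBot ℕ∞) ≤ ringKrullDim (A ⧸ P) := by
  rw [ringKrullDim_quotient] at hk
  obtain ⟨l, hl⟩ := Order.le_krullDim_iff.1 hk
  refine ⟨l.head.1.asIdeal, l.head.1.isPrime, l.head.2, ?_⟩
  rw [ringKrullDim_quotient]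
  refine Order.le_krullDim_iff.2 ⟨⟨l.length, fun i => ⟨(l i).1, ?_⟩, fun i => l.step i⟩, hl⟩
  exact (l.head_le i : l.head ≤ l i)

theorem le_of_not_succ_le {x : WithBot ℕ∞} {k : ℕ}
    (h : ¬ ((k + 1 : ℕ) : WithBot ℕ∞) ≤ x) : x ≤ (k : WithBot ℕ∞) := by
  induction x using WithBot.recBotCoe with
  | bot => exact bot_le
  | coe m =>
    have hm : m < (k : ℕ∞) + 1 := by
      by_contra hcon
      exact h (WithBot.coe_le_coe.2 (by exact_mod_cast not_lt.1 hcon))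
    exact WithBot.coe_le_coe.2 (Order.le_of_lt_add_one hm)

section Dimension

variable {n d : ℕ} {H : PolyMap n}

theorem IsPrimitive.two_add_rkJ_le (hp : IsPrimitive H) (h : IsHQT H d) : 2 + rkJ H ≤ n := by
  have hht := hp (vanishingIdeal ℂ (imageClosure H)) inferInstance fun i x hx => by
    rw [aeval_eq_eval]; exact h.imageClosure_subset_V hx i
  have := height_add_le_ringKrullDim (h := 2) (by exact_mod_cast hht) (algDim_imageClosure H).ge
  rw [ringKrullDim_mvPolynomial_complex, Nat.card_eq_fintype_card, Fintype.card_fin] at this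
  exact (Nat.cast_le (α := WithBot ℕ∞)).1 this

theorem IsPrimitive.algDim_V_le (hp : IsPrimitive H) {k : ℕ} (hk : n ≤ 2 + k) :
    algDim (V H) ≤ (k : WithBot ℕ∞) := by
  refine le_of_not_succ_le fun hdim => ?_
  obtain ⟨P, hP, hVP, hPk⟩ := exists_prime_of_le_ringKrullDim_quotient hdim
  have hht := hp P hP fun i => hVP fun x hx => by rw [aeval_eq_eval]; exact hx i
  have := height_add_le_ringKrullDim (h := 2) (by exact_mod_cast hht) hPk
  rw [ringKrullDim_mvPolynomial_complex, Nat.card_eq_fintype_card, Fintype.card_fin] at this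
  have : 2 + (k + 1) ≤ n := (Nat.cast_le (α := WithBot ℕ∞)).1 this
  omega

/-- A linear form vanishing on the image is an invariant. -/
theorem eq_top_of_imageClosure_subset (hl : ¬ HasLinearInvariant H)
    {L : Submodule ℂ (Fin n → ℂ)} (hW : imageClosure H ⊆ L) : L = ⊤ := by
  by_contra hne
  obtain ⟨v, -, hv⟩ := SetLike.exists_of_lt (lt_top_iff_ne_top.2 hne)
  obtain ⟨f, hf, hfL⟩ := exists_linForm_of_notMem hv
  refine hl ⟨linForm f, fun h0 => hf ?_, linForm_isHomogeneous f, ?_⟩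
  · rw [← eval_linForm, h0, map_zero]
  · refine MvPolynomial.funext fun x => ?_
    rw [eval_bind, toFun_ident_add, eval_linForm, eval_linForm, map_add,
      hfL _ (hW (toFun_mem_imageClosure H x)), add_zero]

end Dimension

section DimensionFive

variable {H : PolyMap 5}

theorem two_le_rkJ_of_not_hasLinearInvariant (hH : PolyMap.IsHomogeneous H)
    (hqt : IsQuasiTranslation H) (hl : ¬ HasLinearInvariant H) : 2 ≤ rkJ H := by
  by_contra hr
  obtain ⟨p, hp⟩ := exists_imageClosure_subset_span hH hqt (by omega)
  have h1 := eq_top_of_imageClosure_subset hl hp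
  have h2 := finrank_span_le_card (R := ℂ) ({p} : Set (Fin 5 → ℂ))
  rw [h1, finrank_top, Module.finrank_fin_fun] at h2
  simp at h2

/-- A homogeneous quasi-translation in dimension five without linear invariants has rank three. -/
theorem rkJ_eq_three (hH : PolyMap.IsHomogeneous H) (hqt : IsQuasiTranslation H)
    (hl : ¬ HasLinearInvariant H) : rkJ H = 3 := by
  have hr := two_le_rkJ_of_not_hasLinearInvariant hH hqt hl
  obtain ⟨d, h⟩ := exists_isHQT hH hqt (by omega)
  obtain ⟨H', d', h', hW, -, hp⟩ := h.exists_isPrimitive hr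
  have h1 := hp.two_add_rkJ_le h'
  rw [rkJ_eq_of_imageClosure_eq hW] at h1
  -- The image spans the whole space, so in rank two `V H` would be everything and `H` would vanish.
  have h2 : rkJ H ≠ 2 := fun h2 => by
    have hV := h.span_subset_V h2
    rw [eq_top_of_imageClosure_subset hl Submodule.subset_span] at hV
    have := rkJ_le_finrank (imageClosure_subset_submodule (H := H) (L := ⊥) fun x => by
      rw [Submodule.mem_bot, ← IsHQT.mem_V_iff]
      exact hV trivial)
    rw [finrank_bot] at this
    omega
  omega

theorem isProjectiveApex_of_isApex {n d : ℕ} {H : PolyMap n} (h : IsHQT H d) {a : Fin n → ℂ}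
    (ha0 : a ≠ 0) (ha : IsApex (imageClosure H) a) : IsProjectiveApex (imageClosure H) a := by
  have key : ∀ l : ℂ, l ≠ -1 → ∀ c ∈ imageClosure H, c + l • a ∈ imageClosure H := by
    intro l hl c hc
    have hl' : 1 + l ≠ 0 := fun h0 => hl (by linear_combination h0)
    -- The parameter is chosen so that scaling by `1 + l` gives exactly `c + l • a`; the excluded
    -- value `l = -1` is reached by two half steps.
    have := h.smul_mem_imageClosure (1 + l) (ha (l / (1 + l)) c hc)
    rw [smul_add, smul_smul, smul_smul, mul_div_cancel₀ _ hl', mul_sub, mul_one,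
      mul_div_cancel₀ _ hl', add_sub_cancel_right, one_smul] at this
    exact this
  refine ⟨ha0, fun l c hc => ?_⟩
  by_cases hl : l = -1
  · have h2 := key (-1 / 2) (by norm_num) _ (key (-1 / 2) (by norm_num) c hc)
    rw [add_assoc, ← add_smul] at h2
    rw [hl]
    norm_num at h2 ⊢
    exact h2
  · exact key l hl c hc

theorem exists_isProjectiveApex (hH : PolyMap.IsHomogeneous H) (hqt : IsQuasiTranslation H)
    (hl : ¬ HasLinearInvariant H) : ∃ p, IsProjectiveApex (imageClosure H) p := by
  have hr := rkJ_eq_three hH hqt hl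
  obtain ⟨d, h⟩ := exists_isHQT hH hqt (by omega)
  obtain ⟨H', d', h', hW, -, hp⟩ := h.exists_isPrimitive (by omega)
  have hr' := (rkJ_eq_of_imageClosure_eq hW).trans hr
  rw [← hW]
  by_contra hcon
  have h1 : NoApexCond H' := by
    refine ⟨?_, hr'.le, ?_⟩
    -- Codimension at least two in $\mathbb C^5$ bounds the dimension by three, and $W\subseteq
    -- V(H')$ attains it.
    · refine le_antisymm ?_ ((algDim_imageClosure H').ge.trans
        (algDim_mono h'.imageClosure_subset_V))
      rw [hr']
      exact hp.algDim_V_le (by norm_num)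
    · rintro ⟨a, ha0, ha⟩
      exact hcon ⟨a, isProjectiveApex_of_isApex h' ha0 ha⟩
  obtain ⟨⟨L, hL, hWL⟩, -⟩ := h1.fourDimCond (by norm_num) ⟨d', h'.hom⟩ h'.qt (by omega)
  rw [hW] at hWL
  rw [eq_top_of_imageClosure_subset hl hWL.subset, finrank_top, Module.finrank_fin_fun] at hL
  omega

end DimensionFive

/-! ### Linear conjugation. -/

section Conjugation

variable {n d : ℕ} {H : PolyMap n} (T : GL (Fin n) ℂ)

theorem toFun_linear (M : Matrix (Fin n) (Fin n) ℂ) (x : Fin n → ℂ) :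
    toFun (fun k => ∑ l, C (M k l) * X l) x = M.mulVec x := by
  ext k
  simp [toFun, Matrix.mulVec, dotProduct]

theorem isHomogeneous_linear (M : Matrix (Fin n) (Fin n) ℂ) (k : Fin n) :
    (∑ l, C (M k l) * X l : MvPolynomial (Fin n) ℂ).IsHomogeneous 1 :=
  IsHomogeneous.sum _ _ _ fun l _ => (isHomogeneous_X _ l).C_mul _

theorem isHomogeneous_bind_linear (M : Matrix (Fin n) (Fin n) ℂ) {p : MvPolynomial (Fin n) ℂ}
    (hp : p.IsHomogeneous d) : (bind₁ (fun k => ∑ l, C (M k l) * X l) p).IsHomogeneous d := by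
  have := hp.aeval (fun k => ∑ l, C (M k l) * X l) (fun k => isHomogeneous_linear M k)
  rwa [one_mul] at this

theorem toFun_linConj (x : Fin n → ℂ) : toFun (linConj T H) x =
    (T⁻¹ : GL (Fin n) ℂ).val.mulVec (toFun H (T.val.mulVec x)) := by
  ext i
  rw [← toFun_linear T.val]
  simp [toFun, linConj, Matrix.mulVec, dotProduct, eval_bind]

theorem linConj_isHomogeneous (hH : PolyMap.IsHomogeneous H) :
    PolyMap.IsHomogeneous (linConj T H) := by
  obtain ⟨d, hd⟩ := hH
  exact ⟨d, fun i => IsHomogeneous.sum _ _ _ fun j _ =>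
    (isHomogeneous_bind_linear T.val (hd j)).C_mul _⟩

theorem inv_mulVec_mulVec (x : Fin n → ℂ) :
    (T⁻¹ : GL (Fin n) ℂ).val.mulVec (T.val.mulVec x) = x := by
  rw [Matrix.mulVec_mulVec, ← Units.val_mul, inv_mul_cancel, Units.val_one, Matrix.one_mulVec]

theorem mulVec_inv_mulVec (x : Fin n → ℂ) :
    T.val.mulVec ((T⁻¹ : GL (Fin n) ℂ).val.mulVec x) = x := by
  rw [Matrix.mulVec_mulVec, ← Units.val_mul, mul_inv_cancel, Units.val_one, Matrix.one_mulVec]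

theorem linConj_isQuasiTranslation (hqt : IsQuasiTranslation H) :
    IsQuasiTranslation (linConj T H) := by
  refine isQuasiTranslation_of_toFun fun x t => ?_
  simp only [toFun_linConj, Matrix.mulVec_add, Matrix.mulVec_smul, mulVec_inv_mulVec]
  rw [toFun_add_smul hqt]

theorem mulVec_mem_imageClosure_linConj {w : Fin n → ℂ} (hw : w ∈ imageClosure H) :
    (T⁻¹ : GL (Fin n) ℂ).val.mulVec w ∈ imageClosure (linConj T H) := by
  rw [mem_imageClosure']
  intro f hf
  rw [← toFun_linear, ← eval_bind]
  refine eval_eq_zero_of_mem (fun x => ?_) hw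
  rw [eval_bind, toFun_linear]
  have := hf ((T⁻¹ : GL (Fin n) ℂ).val.mulVec x)
  rwa [toFun_linConj, mulVec_inv_mulVec] at this

theorem not_hasLinearInvariant_linConj (hl : ¬ HasLinearInvariant H) :
    ¬ HasLinearInvariant (linConj T H) := by
  rintro ⟨f, hf0, hf, hinv⟩
  have hev : ∀ x, eval x (bind₁ (fun k => ∑ l, C ((T⁻¹ : GL (Fin n) ℂ).val k l) * X l) f) =
      eval ((T⁻¹ : GL (Fin n) ℂ).val.mulVec x) f := fun x => by
    rw [eval_bind, toFun_linear]
  refine hl ⟨bind₁ (fun k => ∑ l, C ((T⁻¹ : GL (Fin n) ℂ).val k l) * X l) f, fun h0 => hf0 ?_,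
    isHomogeneous_bind_linear _ hf, ?_⟩
  · refine MvPolynomial.funext fun x => ?_
    have := hev (T.val.mulVec x)
    rwa [h0, map_zero, inv_mulVec_mulVec, eq_comm] at this
  · refine MvPolynomial.funext fun x => ?_
    rw [eval_bind, toFun_ident_add, hev, hev, Matrix.mulVec_add]
    have := congrArg (eval ((T⁻¹ : GL (Fin n) ℂ).val.mulVec x)) hinv
    rwa [eval_bind, toFun_ident_add, toFun_linConj, mulVec_inv_mulVec] at this

theorem exists_GL_mulVec_eq {v p : Fin n → ℂ} (hv : v ≠ 0) (hp : p ≠ 0) :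
    ∃ T : GL (Fin n) ℂ, (T⁻¹ : GL (Fin n) ℂ).val.mulVec p = v := by
  obtain ⟨A, hA⟩ := SeparatingDual.exists_continuousLinearEquiv_apply_eq (R := ℂ) hp hv
  let B : (Fin n → ℂ) ≃ₗ[ℂ] (Fin n → ℂ) := A.toLinearEquiv
  let S : GL (Fin n) ℂ := ⟨LinearMap.toMatrix' B, LinearMap.toMatrix' B.symm, by
    rw [← LinearMap.toMatrix'_comp]; simp, by rw [← LinearMap.toMatrix'_comp]; simp⟩
  refine ⟨S⁻¹, ?_⟩
  rw [inv_inv]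
  change (LinearMap.toMatrix' (B : (Fin n → ℂ) →ₗ[ℂ] _)).mulVec p = v
  rw [LinearMap.toMatrix'_mulVec]
  exact hA

end Conjugation

section Transcendence

variable {n : ℕ} {H : PolyMap n}

/-- If the translates of the image along a coordinate axis stay in the image closure, then that
component is transcendental over the others. -/
theorem transcendental_of_add_single_mem (i₀ : Fin n)
    (h : ∀ x, ∀ μ : ℂ, toFun H x + μ • Pi.single i₀ 1 ∈ imageClosure H) :
    Transcendental (Algebra.adjoin ℂ (H '' {i | i ≠ i₀})) (H i₀) := by
  rintro ⟨P, hP0, hP⟩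
  have hcoef : ∀ k, ∃ u : MvPolynomial (Fin n) ℂ, bind₁ H u = P.coeff k ∧
      ∀ (y : Fin n → ℂ) (μ : ℂ), eval (y + μ • Pi.single i₀ 1) u = eval y u := by
    intro k
    have himg : H '' {i | i ≠ i₀} = bind₁ H '' (X '' {i | i ≠ i₀}) := by
      rw [Set.image_image]; simp
    have hmem : (P.coeff k : MvPolynomial (Fin n) ℂ) ∈
        (Algebra.adjoin ℂ (X '' {i | i ≠ i₀})).map (bind₁ H) := by
      rw [AlgHom.map_adjoin, ← himg]
      exact (P.coeff k).2
    obtain ⟨u, hu, huP⟩ := hmem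
    refine ⟨u, huP, fun y μ => ?_⟩
    clear huP
    induction hu using Algebra.adjoin_induction with
    | mem x hx =>
      obtain ⟨i, hi, rfl⟩ := hx
      have hi' : i ≠ i₀ := hi
      simp [hi']
    | algebraMap r => simp [MvPolynomial.algebraMap_eq]
    | add x y _ _ hx hy => rw [map_add, map_add, hx, hy]
    | mul x y _ _ hx hy => rw [map_mul, map_mul, hx, hy]
  choose u hu hinv using hcoef
  refine hP0 (Polynomial.ext fun k => Subtype.ext (MvPolynomial.funext fun x => ?_))
  let U : MvPolynomial (Fin n) ℂ := ∑ k ∈ Finset.range (P.natDegree + 1), u k * X i₀ ^ k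
  have hU : ∀ x, eval (toFun H x) U = 0 := fun x => by
    have h1 := congrArg (eval x) hP
    rw [Polynomial.aeval_eq_sum_range, map_sum, map_zero] at h1
    rw [map_sum, ← h1]
    refine Finset.sum_congr rfl fun k _ => ?_
    rw [Algebra.smul_def, map_mul, map_mul, map_pow, map_pow, eval_X, ← eval_bind, hu]
    rfl
  have hpoly : ∑ k ∈ Finset.range (P.natDegree + 1),
      Polynomial.monomial k (eval x (P.coeff k : MvPolynomial (Fin n) ℂ)) = 0 := by
    refine Polynomial.funext fun t => ?_
    -- The shift turns coordinate `i₀` into `t` and leaves the coefficients alone. The relation thus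
    -- holds for every `t`, and all its coefficients vanish.
    have h1 := eval_eq_zero_of_mem hU
      (h x (t - eval x (H i₀)))
    rw [Polynomial.eval_finsetSum, Polynomial.eval_zero, ← h1, map_sum]
    refine Finset.sum_congr rfl fun k _ => ?_
    rw [map_mul, hinv, ← eval_bind, hu, map_pow, eval_X, Polynomial.eval_monomial]
    simp [toFun]
  have h1 := congrArg (fun p => Polynomial.coeff p k) hpoly
  simp only [Polynomial.finsetSum_coeff, Polynomial.coeff_monomial, Finset.sum_ite_eq',
    Finset.mem_range, Polynomial.coeff_zero] at h1
  by_cases hk : k < P.natDegree + 1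
  · rw [if_pos hk] at h1
    simpa using h1
  · rw [Polynomial.coeff_eq_zero_of_natDegree_lt (by omega)]
    simp

end Transcendence

theorem isCaseB {H : PolyMap 5} (hH : PolyMap.IsHomogeneous H) (hqt : IsQuasiTranslation H)
    (hl : ¬ HasLinearInvariant H) : IsCaseB H := by
  obtain ⟨p, hp0, hp⟩ := exists_isProjectiveApex hH hqt hl
  obtain ⟨T, hT⟩ := exists_GL_mulVec_eq (v := Pi.single (4 : Fin 5) (1 : ℂ)) (by simp) hp0
  have hH' := linConj_isHomogeneous T hH
  have hqt' := linConj_isQuasiTranslation T hqt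
  have hl' := not_hasLinearInvariant_linConj T hl
  refine ⟨⟨hH, hqt, rkJ_eq_three hH hqt hl⟩, T, ⟨hH', hqt', rkJ_eq_three hH' hqt' hl'⟩,
    transcendental_of_add_single_mem 4 fun x μ => ?_, ?_⟩
  · rw [toFun_linConj, ← hT, ← Matrix.mulVec_smul, ← Matrix.mulVec_add]
    exact mulVec_mem_imageClosure_linConj T (hp μ _ (toFun_mem_imageClosure H _))
  -- Without linear invariants such a subspace would be all of $\mathbb C^5$.
  · rintro ⟨L, hL, hLW⟩
    rw [eq_top_of_imageClosure_subset hl' hLW.ge, finrank_top, Module.finrank_fin_fun] at hL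
    omega

end

end QuasiTranslation

end

open QuasiTranslation QuasiTranslation.PolyMap in
theorem mainTheorem2 :
    (∀ (n : ℕ) (_ : 1 ≤ n) (H : PolyMap n), IsHomogeneous H → IsQuasiTranslation H →
      (rkJ H : ℚ) ≤ ((n : ℚ) + 1) / 2 →
        (NoApexCond H → FinitePlanesInClosureCond H) ∧
        (FinitePlanesInClosureCond H → NoCommonPartnerCond H) ∧
        (NoCommonPartnerCond H → SpanOfTwoPlanesCond H) ∧
        (4 ≤ n → SpanOfTwoPlanesCond H → FourDimCond H) ∧
        (NoApexCond H → FourDimCond H)) ∧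
    (∀ H : PolyMap 5, IsHomogeneous H → IsQuasiTranslation H → ¬ HasLinearInvariant H →
      (∃ p : Fin 5 → ℂ, IsProjectiveApex (imageClosure H) p) ∧ IsCaseB H) := by
  refine ⟨fun n hn H hH hqt hr => ?_, fun H hH hqt hl =>
    ⟨exists_isProjectiveApex hH hqt hl, isCaseB hH hqt hl⟩⟩
  have hr' : 2 * rkJ H ≤ n + 1 := by
    rw [le_div_iff₀ (by norm_num)] at hr
    have : rkJ H * 2 ≤ n + 1 := by exact_mod_cast hr
    omega
  exact ⟨fun h1 => h1.finitePlanesInClosureCond hH hqt,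
    fun h2 => h2.noCommonPartnerCond hH hqt,
    fun h3 => h3.spanOfTwoPlanesCond hH hqt hr',
    fun hn4 h4 => h4.fourDimCond hH hqt hn4,
    fun h1 => h1.fourDimCond hn hH hqt hr'⟩
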